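/- \textbf{Conventions.} Put $I=(0,1]$. For a smooth manifold $X$, a \emph{net} of maps $\mathbb{R}\to X$ is a family $(u_\varepsilon)_{\varepsilon\in I}$ of smooth maps depending smoothly on $\varepsilon$ (that is, $(\varepsilon,t)\mapsto u_\varepsilon(t)$ is smooth on $I\times\mathbb{R}$). All $O(\cdot)$-estimates are for $\varepsilon\searrow 0$. A net of functions $\mathbb{R}\to\mathbb{R}$ is \emph{moderate} if for every compact $K\subset\mathbb{R}$ and every $k\in\mathbb{N}_0$ there is $m\in\mathbb{N}$ with $\sup_{t\in K}|u_\varepsilon^{(k)}(t)|=O(\varepsilon^{-m})$; a moderate net is \emph{negligible} if $\sup_{t\in K}|u_\varepsilon(t)|=O(\varepsilon^m)$ for every compact $K$ and every $m\in\mathbb{N}$. $\mathcal{G}(\mathbb{R})$ is the algebra of moderate nets modulo negligible nets. $\mathcal{G}[\mathbb{R},X]$ is the set of nets $(u_\varepsilon)_\varepsilon$ of maps $\mathbb{R}\to X$ such that $(\psi\circ u_\varepsilon)_\varepsilon$ is moderate for every $\psi\in C^\infty(X,\mathbb{R})$, modulo the relation $(u_\varepsilon)\sim(w_\varepsilon)$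 iff $(\psi\circ u_\varepsilon-\psi\circ w_\varepsilon)_\varepsilon$ is negligible for every $\psi\in C^\infty(X,\mathbb{R})$. A \emph{generalized delta function} is an element $D\in\mathcal{G}(\mathbb{R})$ that has a representative $(\delta_\varepsilon)_{\varepsilon\in I}$ which is a strict delta net: $\operatorname{supp}\delta_\varepsilon\subseteq(-\varepsilon,\varepsilon)$ for all $\varepsilon\in I$, $\int_{\mathbb{R}}\delta_\varepsilon\to1$ as $\varepsilon\searrow0$, and there is $C>0$ with $\int_{\mathbb{R}}|\delta_\varepsilon|\le C$ for all $\varepsilon\in I$. \textbf{Theorem.} Let $(N,h)$ be a connected, complete, smooth, second countable Riemannian manifold of dimension $n$, let $D\in\mathcal{G}(\mathbb{R})$ be a generalized delta function, $f\in C^\infty(N)$, $v_0,\dot v_0\in\mathbb{R}$, $x_0\in N$ and $\dot x_0\in T_{x_0}N$. Then the initial value problem for the geodesics (parametrized by $u$) of the generalized metric $dh^2+2\,du\,dv+f(x)D(u)\,du^2$ on $N\times\mathbb{R}^2$, \[ \ddot v(u)=-\,df_{x(u)}(\dot x(u))\,D(u)-\tfrac12 f(x(u))\,\dot D(u),\qquad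 \nabla^h_{\dot x}\dot x(u)=\tfrac12\,\mathrm{grad}^h f(x(u))\,D(u), \] \[ v(-1)=v_0,\quad x(-1)=x_0,\quad \dot v(-1)=\dot v_0,\quad \dot x(-1)=\dot x_0, \] has a unique solution $(v,x)\in\mathcal{G}[\mathbb{R},\mathbb{R}\times N]$. Here all operations are performed componentwise on representatives; the first equation holds in $\mathcal{G}(\mathbb{R})$, and the second one as an equality of generalized vector fields along $x$, i.e. in every chart $e$ of $N$ the components of the difference of the two sides at parameter $u$ are $O(\varepsilon^m)$ for every $m$, uniformly for $u$ in a compact set with $x_\varepsilon(u)$ in a compact subset of the domain of $e$. The initial conditions for $v$ hold up to negligible nets of real numbers, and those for $x$ hold in $TN$ in the sense that $\psi(x_\varepsilon(-1),\dot x_\varepsilon(-1))-\psi(x_0,\dot x_0)=O(\varepsilon^m)$ for every $m$ and every $\psi\in C^\infty(TN)$. -/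

import Mathlib

open Set Filter Topology Manifold ContDiff MeasureTheory Bundle

noncomputable section

namespace Colombeau

/-! ### Generalized numbers, generalized functions on `ℝ`

A net is a function `u : ℝ → ℝ → X`, written `u ε t`; only its values for `ε ∈ I = (0,1]` matter. -/

/-- The net `(u_ε)` consists of smooth maps `ℝ → X` depending smoothly on `ε ∈ (0,1]`: the map
`(ε, t) ↦ u_ε(t)` is smooth on `(0,1] × ℝ`. -/
def IsSmoothNet {E H X : Type*} [NormedAddCommGroup E] [NormedSpace ℝ E] [TopologicalSpace H]
    (J : ModelWithCorners ℝ E H) [TopologicalSpace X] [ChartedSpace H X] (u : ℝ → ℝ → X) : Prop :=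
  ContMDiffOn 𝓘(ℝ, ℝ × ℝ) J ∞ (fun q : ℝ × ℝ => u q.1 q.2) (Ioc (0 : ℝ) 1 ×ˢ univ)

/-- Moderateness estimates: on every compact set, every derivative of `u_ε` is `O(ε^{-N})` for
some `N`. -/
def HasModerateGrowth (u : ℝ → ℝ → ℝ) : Prop :=
  ∀ K : Set ℝ, IsCompact K → ∀ k : ℕ, ∃ (N : ℕ) (C : ℝ),
    ∀ᶠ ε in 𝓝[>] (0 : ℝ), ∀ t ∈ K, |iteratedDeriv k (u ε) t| ≤ C * (ε⁻¹) ^ N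

/-- Negligibility of a net of real numbers: it is `O(ε^m)` for all `m`. -/
def IsNegligibleNumber (a : ℝ → ℝ) : Prop :=
  ∀ m : ℕ, ∃ C : ℝ, ∀ᶠ ε in 𝓝[>] (0 : ℝ), |a ε| ≤ C * ε ^ m

/-- Negligibility of a (moderate) net of functions on `ℝ`: on every compact set it is `O(ε^m)` for
all `m`. -/
def IsNegligible (u : ℝ → ℝ → ℝ) : Prop :=
  ∀ K : Set ℝ, IsCompact K → ∀ m : ℕ, ∃ C : ℝ,
    ∀ᶠ ε in 𝓝[>] (0 : ℝ), ∀ t ∈ K, |u ε t| ≤ C * ε ^ m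

theorem IsNegligible.refl (u : ℝ → ℝ → ℝ) : IsNegligible fun ε t => u ε t - u ε t := by
  intro K _ m
  exact ⟨0, by simp⟩

theorem IsNegligible.symm {u v : ℝ → ℝ → ℝ} (h : IsNegligible fun ε t => u ε t - v ε t) :
    IsNegligible fun ε t => v ε t - u ε t := by
  intro K hK m
  obtain ⟨C, hC⟩ := h K hK m
  refine ⟨C, hC.mono fun ε hε t ht => ?_⟩
  rw [abs_sub_comm]
  exact hε t ht

theorem IsNegligible.trans {u v w : ℝ → ℝ → ℝ} (h : IsNegligible fun ε t => u ε t - v ε t)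
    (h' : IsNegligible fun ε t => v ε t - w ε t) : IsNegligible fun ε t => u ε t - w ε t := by
  intro K hK m
  obtain ⟨C, hC⟩ := h K hK m
  obtain ⟨C', hC'⟩ := h' K hK m
  refine ⟨C + C', ?_⟩
  filter_upwards [hC, hC'] with ε h1 h2 t ht
  have h3 := abs_sub_le (u ε t) (v ε t) (w ε t)
  have h4 := h1 t ht
  have h5 := h2 t ht
  rw [add_mul]
  linarith

/-- Moderate nets of smooth functions on `ℝ`. -/
def ModerateNet : Type :=
  {u : ℝ → ℝ → ℝ // IsSmoothNet 𝓘(ℝ, ℝ) u ∧ HasModerateGrowth u}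

/-- Two moderate nets are equivalent if their difference is negligible. -/
instance moderateNetSetoid : Setoid ModerateNet where
  r u v := IsNegligible fun ε t => u.1 ε t - v.1 ε t
  iseqv :=
    { refl := fun u => IsNegligible.refl u.1
      symm := fun h => IsNegligible.symm h
      trans := fun h h' => IsNegligible.trans h h' }

/-- The special Colombeau algebra `𝒢(ℝ)`. -/
def GenFun : Type := Quotient moderateNetSetoid

/-- Strict delta nets. -/
structure IsStrictDeltaNet (δ : ℝ → ℝ → ℝ) : Prop where
  support_subset : ∀ ε ∈ Ioc (0 : ℝ) 1, tsupport (δ ε) ⊆ Ioo (-ε) ε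
  tendsto_integral : Tendsto (fun ε => ∫ t, δ ε t) (𝓝[>] (0 : ℝ)) (𝓝 1)
  bounded_L1 : ∃ C > 0, ∀ ε ∈ Ioc (0 : ℝ) 1, ∫ t, |δ ε t| ≤ C

/-- A generalized delta function is an element of `𝒢(ℝ)` having a strict delta net as a
representative. -/
def GenFun.IsDelta (D : GenFun) : Prop :=
  ∃ δ : ModerateNet, IsStrictDeltaNet δ.1 ∧ (⟦δ⟧ : GenFun) = D

/-! ### Generalized functions with values in a manifold -/

section ManifoldValued

variable {E H : Type*} [NormedAddCommGroup E] [NormedSpace ℝ E] [TopologicalSpace H]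
  (J : ModelWithCorners ℝ E H) (X : Type*) [TopologicalSpace X] [ChartedSpace H X]

/-- Moderate nets of smooth maps `ℝ → X`: those for which `ψ ∘ u_ε` is moderate for every smooth
`ψ : X → ℝ`. -/
def ModerateMapNet : Type _ :=
  {u : ℝ → ℝ → X // IsSmoothNet J u ∧
    ∀ ψ : X → ℝ, ContMDiff J 𝓘(ℝ, ℝ) ∞ ψ → HasModerateGrowth fun ε t => ψ (u ε t)}

/-- Two moderate nets of maps are equivalent if `ψ ∘ u_ε - ψ ∘ w_ε` is negligible for every smooth
`ψ : X → ℝ`. -/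
instance moderateMapNetSetoid : Setoid (ModerateMapNet J X) where
  r u w := ∀ ψ : X → ℝ, ContMDiff J 𝓘(ℝ, ℝ) ∞ ψ →
    IsNegligible fun ε t => ψ (u.1 ε t) - ψ (w.1 ε t)
  iseqv :=
    { refl := fun u ψ _ => IsNegligible.refl fun ε t => ψ (u.1 ε t)
      symm := fun h ψ hψ => IsNegligible.symm (h ψ hψ)
      trans := fun h h' ψ hψ => IsNegligible.trans (h ψ hψ) (h' ψ hψ) }

/-- The space `𝒢[ℝ, X]` of generalized functions on `ℝ` with values in the manifold `X`. -/
def GenMap : Type _ := Quotient (moderateMapNetSetoid J X)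

variable {X}

/-- The generalized point represented by the net `(p_ε)` of points of `X` equals the classical
point `q`. -/
def GenPointEq (p : ℝ → X) (q : X) : Prop :=
  ∀ ψ : X → ℝ, ContMDiff J 𝓘(ℝ, ℝ) ∞ ψ → IsNegligibleNumber fun ε => ψ (p ε) - ψ q

end ManifoldValued

/-! ### Riemannian geometry in charts -/

section Riemannian

variable {n : ℕ} {N : Type*} [TopologicalSpace N] [ChartedSpace (EuclideanSpace ℝ (Fin n)) N]

/-- The velocity vector `ẋ(t)` of a curve `x` in `N`. -/
def velocity (x : ℝ → N) (t : ℝ) : TangentSpace (𝓡 n) (x t) :=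
  mfderiv 𝓘(ℝ, ℝ) (𝓡 n) x t (1 : ℝ)

/-- The derivative `df(ẋ(t))` of `f : N → ℝ` in the direction of the velocity of a curve `x`. -/
def diffAlong (f : N → ℝ) (x : ℝ → N) (t : ℝ) : ℝ :=
  mfderiv (𝓡 n) 𝓘(ℝ, ℝ) f (x t) (velocity (n := n) x t)

variable (n) in
/-- The equation `v̈ = - df(ẋ) D - ½ f(x) Ḋ` in `𝒢(ℝ)`, on representatives. -/
def SolvesV (f : N → ℝ) (δ v : ℝ → ℝ → ℝ) (x : ℝ → ℝ → N) : Prop :=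
  IsNegligible fun ε t => deriv (deriv (v ε)) t
    - (-diffAlong (n := n) f (x ε) t * δ ε t
      - (1 / 2 : ℝ) * f (x ε t) * deriv (δ ε) t)

/-- The `i`-th partial derivative of a function on `ℝⁿ`. -/
def partialDeriv (i : Fin n) (F : EuclideanSpace ℝ (Fin n) → ℝ) (y : EuclideanSpace ℝ (Fin n)) :
    ℝ :=
  fderiv ℝ F y (EuclideanSpace.single i 1)

/-- The coordinate vector field `∂_i` of the chart `e`, at the point with coordinates `y`. -/
def coordVector (e : OpenPartialHomeomorph N (EuclideanSpace ℝ (Fin n))) (i : Fin n)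
    (y : EuclideanSpace ℝ (Fin n)) : TangentSpace (𝓡 n) (e.symm y) :=
  mfderiv (𝓡 n) (𝓡 n) e.symm y (EuclideanSpace.single i 1)

variable [RiemannianBundle (fun p : N => TangentSpace (𝓡 n) p)]

/-- The matrix `(h_{ij})` of the metric in the chart `e`. -/
def metricCoeff (e : OpenPartialHomeomorph N (EuclideanSpace ℝ (Fin n)))
    (y : EuclideanSpace ℝ (Fin n)) : Matrix (Fin n) (Fin n) ℝ :=
  Matrix.of fun i j => inner ℝ (coordVector e i y) (coordVector e j y)

/-- The Christoffel symbols `Γ^k_{ij}` of the Levi-Civita connection in the chart `e`. -/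
def christoffel (e : OpenPartialHomeomorph N (EuclideanSpace ℝ (Fin n))) (k i j : Fin n)
    (y : EuclideanSpace ℝ (Fin n)) : ℝ :=
  (1 / 2 : ℝ) * ∑ l, (metricCoeff e y)⁻¹ k l *
    (partialDeriv i (fun z => metricCoeff e z j l) y
      + partialDeriv j (fun z => metricCoeff e z i l) y
      - partialDeriv l (fun z => metricCoeff e z i j) y)

/-- The `k`-th component of the covariant acceleration `∇_ẋ ẋ` of a curve in the chart `e`, at a
time `t` at which the curve is in the domain of `e`. -/
def covAccel (e : OpenPartialHomeomorph N (EuclideanSpace ℝ (Fin n))) (x : ℝ → N) (k : Fin n)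
    (t : ℝ) : ℝ :=
  deriv (deriv fun s => e (x s) k) t
    + ∑ i, ∑ j, christoffel e k i j (e (x t))
        * deriv (fun s => e (x s) i) t * deriv (fun s => e (x s) j) t

/-- The `k`-th component of the gradient of `f : N → ℝ` in the chart `e`. -/
def gradCoord (e : OpenPartialHomeomorph N (EuclideanSpace ℝ (Fin n))) (f : N → ℝ) (k : Fin n)
    (y : EuclideanSpace ℝ (Fin n)) : ℝ :=
  ∑ m, (metricCoeff e y)⁻¹ k m * partialDeriv m (fun z => f (e.symm z)) y

/-! ### The geodesic system -/

/-- The equation `∇_ẋ ẋ = ½ grad f(x) D` between generalized vector fields along the generalized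
curve `x`, on representatives: in every chart `e`, and for every compact subset `L` of its domain,
the coordinates of the difference of both sides are negligible for those parameters `t` for which
`x_ε(t)` is in `L`. -/
def SolvesX (f : N → ℝ) (δ : ℝ → ℝ → ℝ) (x : ℝ → ℝ → N) : Prop :=
  ∀ e ∈ IsManifold.maximalAtlas (𝓡 n) ∞ N, ∀ L : Set N, IsCompact L → L ⊆ e.source →
    ∀ k : Fin n, ∀ K : Set ℝ, IsCompact K → ∀ m : ℕ, ∃ C : ℝ,
      ∀ᶠ ε in 𝓝[>] (0 : ℝ), ∀ t ∈ K, x ε t ∈ L →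
        |covAccel e (x ε) k t - (1 / 2 : ℝ) * gradCoord e f k (e (x ε t)) * δ ε t| ≤ C * ε ^ m

/-- `(v, x) = S ∈ 𝒢[ℝ, ℝ × N]` solves the geodesic system
`v̈ = - df(ẋ) D - ½ f(x) Ḋ`, `∇_ẋ ẋ = ½ grad f(x) D`, with data
`v(-1) = v₀`, `v̇(-1) = v₁`, `x(-1) = x₀`, `ẋ(-1) = x₁`.
All operations are componentwise and do not depend on the choice of the representatives. The two
conditions on `x` at `-1` are one identity of generalized points of the tangent bundle. -/
def IsGeodesicSolution [IsManifold (𝓡 n) ∞ N] (f : N → ℝ) (D : GenFun) (v₀ v₁ : ℝ) (x₀ : N) (x₁ : TangentSpace (𝓡 n) x₀)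
    (S : GenMap (𝓘(ℝ, ℝ).prod (𝓡 n)) (ℝ × N)) : Prop :=
  ∃ (δ : ModerateNet) (w : ModerateMapNet (𝓘(ℝ, ℝ).prod (𝓡 n)) (ℝ × N)),
    (⟦δ⟧ : GenFun) = D ∧ (⟦w⟧ : GenMap (𝓘(ℝ, ℝ).prod (𝓡 n)) (ℝ × N)) = S ∧
    SolvesV n f δ.1 (fun ε t => (w.1 ε t).1) (fun ε t => (w.1 ε t).2) ∧
    SolvesX (n := n) f δ.1 (fun ε t => (w.1 ε t).2) ∧
    IsNegligibleNumber (fun ε => (w.1 ε (-1)).1 - v₀) ∧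
    IsNegligibleNumber (fun ε => deriv (fun t => (w.1 ε t).1) (-1) - v₁) ∧
    GenPointEq (𝓡 n).tangent
      (fun ε => (⟨(w.1 ε (-1)).2, velocity (n := n) (fun t => (w.1 ε t).2) (-1)⟩ :
        TangentBundle (𝓡 n) N))
      ⟨x₀, x₁⟩

end Riemannian

end Colombeau

end

set_option linter.unusedSectionVars false

noncomputable section

namespace Colombeau

/-! ### Smooth dependence of flows on the initial condition -/

section Flow

set_option synthInstance.maxHeartbeats 200000
set_option maxHeartbeats 400000

/-! Existence. For small ε the forcing δ_ε lives in (-ε, ε), so away from 0 the curve x_ε has to be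
an unforced geodesic. One takes the geodesic γ with the prescribed data at -1, which is global by
completeness (`exists_geodesic`), passes to a chart at γ(0) and solves the forced equation there.
The forcing enters the velocity equation only and is bounded in L¹, so it changes the velocity by a
bounded amount whatever ε is. Velocities therefore stay in a fixed ball, and during a short time
independent of ε the position cannot leave the chart (`exists_forced_family_in_chart`). After the
impulse the curve continues as a geodesic whose data lie in a fixed compact set. The result,
`exists_forced_net`, is a net of exact solutions which on bounded time intervals stays in a compact
subset of N and has bounded velocity. With p = v' + ½ f(x) δ the equation for v becomes v' = p - ½
f(x) δ, p' = -½ (f ∘ x)' δ. The derivative of δ has disappeared, so v and p are bounded as well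
(`exists_driven_net`). Moderateness of all derivatives follows by differentiating this first order
system repeatedly: its state stays in a compact set, and powers of 1/ε come only from δ and its
derivatives (`moderateOn_iteratedDeriv_of_forced`).

Two tools support this. Smoothness in ε rests on the smoothness of flows: the flow is read off from
a local inverse of (s, u) ↦ (s, u - s ∫ F ∘ u) on the Banach space of continuous curves
(`exists_flowBox_of_contDiff`), and parameters are then treated as extra state variables.
Independence of the chart comes from the Euler-Lagrange expression: it is the geodesic defect
lowered by the metric, and it pulls back under coordinate changes (`eulerLagrange_pullback`,
`ChartEqAt.change_chart`).

Uniqueness. An arbitrary solution is compared with the reference net through finitely many smooth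
functions on N: cutoffs and extended coordinates for finitely many charts that cover the compact set
containing the reference curves. Let D be the sum of the squares of the differences of these
functions along the two curves, and of the differences of their time derivatives. While D < 1, the
cutoffs force the unknown curve into the chart of the reference curve, with bounded velocity, and
the equations give |D'| ≤ const (1 + |δ|) D + negligible. The coefficient is bounded in L¹ and D(-1)
is negligible, so Gronwall makes D negligible and in particular keeps D below 1
(`gronwall_of_lt_one`, `negligibleOn_of_second_order`, `IsReferenceNet.negligibleOn_sub`). The same
substitution as for p handles v (`IsReferenceNet.negligibleOn_sub_fst`), and a Lipschitz estimate in
charts passes from the comparison functions to every smooth function on ℝ × N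
(`negligibleOn_comp_sub`). -/

/-- Pointwise application of a continuous family of linear maps to a continuous map. -/
def familyApply (K X Y : Type*) [TopologicalSpace K] [CompactSpace K] [NormedAddCommGroup X]
    [NormedSpace ℝ X] [NormedAddCommGroup Y] [NormedSpace ℝ Y] :
    C(K, X →L[ℝ] Y) →L[ℝ] C(K, X) →L[ℝ] C(K, Y) :=
  LinearMap.mkContinuous₂
    (LinearMap.mk₂ ℝ (fun (A : C(K, X →L[ℝ] Y)) (v : C(K, X)) =>
        (⟨fun t => A t (v t), by fun_prop⟩ : C(K, Y)))
      (fun A B v => by ext t; simp) (fun c A v => by ext t; simp)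
      (fun A v w => by ext t; simp) (fun c A v => by ext t; simp)) 1 (by
    intro A v
    rw [ContinuousMap.norm_le _ (by positivity)]
    intro t
    calc ‖A t (v t)‖ ≤ ‖A t‖ * ‖v t‖ := (A t).le_opNorm _
      _ ≤ 1 * ‖A‖ * ‖v‖ := by
        rw [one_mul]
        gcongr
        · exact A.norm_coe_le_norm t
        · exact v.norm_coe_le_norm t)

/-- Composition with a continuous map as a map of spaces of continuous functions. -/
def nemytskii (K : Type*) [TopologicalSpace K] {X Y : Type*} [TopologicalSpace X]
    [TopologicalSpace Y] (F : C(X, Y)) (u : C(K, X)) : C(K, Y) := F.comp u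

/-- The range of `u` is compact, so the continuity of the derivative of `F` is uniform near it. The
mean value inequality then holds with one constant for all points of `K`. No compactness of balls in
`X` is needed. -/
theorem hasFDerivAt_nemytskii {K X Y : Type*} [TopologicalSpace K] [CompactSpace K]
    [NormedAddCommGroup X] [NormedSpace ℝ X] [NormedAddCommGroup Y] [NormedSpace ℝ Y]
    {F : X → Y} (hF : ContDiff ℝ ∞ F) (u : C(K, X)) :
    HasFDerivAt (nemytskii K ⟨F, hF.continuous⟩)
      (familyApply K X Y (nemytskii K ⟨fderiv ℝ F, hF.continuous_fderiv (by simp)⟩ u)) u := by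
  rw [hasFDerivAt_iff_isLittleO, Asymptotics.isLittleO_iff]
  intro c hc
  have hcomp : IsCompact (range u) := isCompact_range u.continuous
  have hu := hcomp.uniformContinuousAt_of_continuousAt (fderiv ℝ F)
    (fun a _ => (hF.continuous_fderiv (by simp)).continuousAt) (Metric.dist_mem_uniformity hc)
  obtain ⟨η, hη, hball⟩ := Metric.mem_uniformity_dist.1 hu
  filter_upwards [Metric.ball_mem_nhds u hη] with v hv
  rw [ContinuousMap.norm_le _ (by positivity)]
  intro t
  have hvt : dist (v t) (u t) < η := (ContinuousMap.dist_apply_le_dist t).trans_lt hv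
  have key : ‖F (v t) - F (u t) - fderiv ℝ F (u t) (v t - u t)‖ ≤ c * ‖v t - u t‖ := by
    refine (convex_ball (u t) η).norm_image_sub_le_of_norm_hasFDerivWithin_le' (𝕜 := ℝ)
      (f' := fderiv ℝ F) (fun x hx => ?_) (fun x hx => ?_) (Metric.mem_ball_self hη) hvt
    · exact ((hF.differentiable (by simp)) x).hasFDerivAt.hasFDerivWithinAt
    · have := hball (a := u t) (b := x) (by rw [dist_comm]; exact hx) (mem_range_self t)
      simp only [dist_eq_norm] at this
      rw [norm_sub_rev]
      exact this.le
  refine key.trans ?_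
  gcongr
  exact (v - u).norm_coe_le_norm t

/-- The derivative at `u` is multiplication by the composition of `fderiv ℝ F` with `u`, that is, a
composition operator of the same kind with values in operators. This is why the target `Y` varies in
the induction, and why `X` and `Y` share a universe: `X →L[ℝ] Y` must again be an admissible target.
-/
theorem contDiff_nemytskii_nat.{u} {K : Type*} [TopologicalSpace K] [CompactSpace K] {X : Type u}
    [NormedAddCommGroup X] [NormedSpace ℝ X] (n : ℕ) :
    ∀ {Y : Type u} [NormedAddCommGroup Y] [NormedSpace ℝ Y] {F : X → Y} (hF : ContDiff ℝ ∞ F),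
      ContDiff ℝ n (nemytskii K ⟨F, hF.continuous⟩) := by
  induction n with
  | zero =>
    intro Y _ _ F hF
    exact contDiff_zero.2 (ContinuousMap.continuous_postcomp ⟨F, hF.continuous⟩)
  | succ n ih =>
    intro Y _ _ F hF
    push_cast
    rw [contDiff_succ_iff_hasFDerivAt]
    refine ⟨_, ?_, fun u => hasFDerivAt_nemytskii hF u⟩
    exact (familyApply K X Y).contDiff.comp (ih (hF.fderiv_right (by simp)))

end Flow

/-! ### Smooth local flows by the inverse function theorem. -/

section FlowBox

/-- The inclusion of a space as constant maps. -/
def constMapCLM (K X : Type*) [TopologicalSpace K] [CompactSpace K] [NormedAddCommGroup X]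
    [NormedSpace ℝ X] : X →L[ℝ] C(K, X) where
  toFun := ContinuousMap.const K
  map_add' _ _ := rfl
  map_smul' _ _ := rfl
  cont := ContinuousMap.continuous_const'

variable {V : Type*} [NormedAddCommGroup V] [NormedSpace ℝ V]

theorem contDiff_nemytskii {K : Type*} [TopologicalSpace K] [CompactSpace K] {F : V → V}
    (hF : ContDiff ℝ ∞ F) : ContDiff ℝ ∞ (nemytskii K ⟨F, hF.continuous⟩) :=
  contDiff_infty.2 fun n => contDiff_nemytskii_nat n hF

variable [CompleteSpace V]

/-- The primitive vanishing at `0`, as an operator on continuous functions on `[0, 1]`. -/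
def primitiveOp (V : Type*) [NormedAddCommGroup V] [NormedSpace ℝ V] [CompleteSpace V] :
    C(Icc (0 : ℝ) 1, V) →L[ℝ] C(Icc (0 : ℝ) 1, V) :=
  LinearMap.mkContinuous
    { toFun := fun u => ⟨fun t => ∫ s in (0 : ℝ)..t, u (projIcc 0 1 zero_le_one s), by
          have h : Continuous fun s => u (projIcc (0 : ℝ) 1 zero_le_one s) :=
            u.continuous.comp continuous_projIcc
          exact (intervalIntegral.continuous_primitive (fun a b => h.intervalIntegrable a b) 0).comp
            continuous_subtype_val⟩
      map_add' := fun u v => by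
        ext t
        have h (w : C(Icc (0 : ℝ) 1, V)) : IntervalIntegrable
            (fun s => w (projIcc (0 : ℝ) 1 zero_le_one s)) volume 0 t :=
          (w.continuous.comp continuous_projIcc).intervalIntegrable _ _
        exact intervalIntegral.integral_add (h u) (h v)
      map_smul' := fun c u => by
        ext t
        exact intervalIntegral.integral_smul c _ } 1 (by
    intro u
    rw [ContinuousMap.norm_le _ (by positivity)]
    intro t
    have := intervalIntegral.norm_integral_le_of_norm_le_const (a := (0 : ℝ)) (b := t) (C := ‖u‖)
      (f := fun s => u (projIcc 0 1 zero_le_one s)) (fun s _ => u.norm_coe_le_norm _)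
    refine (this.trans ?_)
    rw [sub_zero, abs_of_nonneg t.2.1, one_mul]
    exact mul_le_of_le_one_right (norm_nonneg _) t.2.2)

/-- The map `(s, u) ↦ (s, u - s ∫ F ∘ u)`: its local inverse, at constant functions, is the flow of
`F` with rescaled time. -/
def flowMap {F : V → V} (hF : ContDiff ℝ ∞ F) (q : ℝ × C(Icc (0 : ℝ) 1, V)) :
    ℝ × C(Icc (0 : ℝ) 1, V) :=
  (q.1, q.2 - q.1 • primitiveOp V (nemytskii (Icc (0 : ℝ) 1) ⟨F, hF.continuous⟩ q.2))

theorem contDiff_flowMap {F : V → V} (hF : ContDiff ℝ ∞ F) : ContDiff ℝ ∞ (flowMap hF) := by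
  have h := (contDiff_nemytskii (K := Icc (0 : ℝ) 1) hF).comp
    (contDiff_snd (𝕜 := ℝ) (E := ℝ) (F := C(Icc (0 : ℝ) 1, V)) (n := ∞))
  exact contDiff_fst.prodMk (contDiff_snd.sub
    (contDiff_fst.smul ((primitiveOp V).contDiff.comp h)))

/-- The shear `(s, u) ↦ (s, u - s w)`. -/
def shearEquiv {W : Type*} [NormedAddCommGroup W] [NormedSpace ℝ W] (w : W) :
    (ℝ × W) ≃L[ℝ] ℝ × W :=
  ContinuousLinearEquiv.equivOfInverse
    ((ContinuousLinearMap.fst ℝ ℝ W).prod (ContinuousLinearMap.snd ℝ ℝ W -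
      (ContinuousLinearMap.fst ℝ ℝ W).smulRight w))
    ((ContinuousLinearMap.fst ℝ ℝ W).prod (ContinuousLinearMap.snd ℝ ℝ W +
      (ContinuousLinearMap.fst ℝ ℝ W).smulRight w))
    (fun x => by ext <;> simp) (fun x => by ext <;> simp)

/-- The nonlinear term carries the factor s, so at s = 0 only the derivative in s sees it. What
remains is a shear, which is invertible. -/
theorem hasFDerivAt_flowMap_zero {F : V → V} (hF : ContDiff ℝ ∞ F) (u : C(Icc (0 : ℝ) 1, V)) :
    HasFDerivAt (flowMap hF)
      (shearEquiv (primitiveOp V (nemytskii (Icc (0 : ℝ) 1) ⟨F, hF.continuous⟩ u)) :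
        ℝ × C(Icc (0 : ℝ) 1, V) →L[ℝ] ℝ × C(Icc (0 : ℝ) 1, V)) (0, u) := by
  let W := C(Icc (0 : ℝ) 1, V)
  have hN : ContDiff ℝ ∞ fun q : ℝ × W =>
      primitiveOp V (nemytskii (Icc (0 : ℝ) 1) ⟨F, hF.continuous⟩ q.2) :=
    (primitiveOp V).contDiff.comp ((contDiff_nemytskii (K := Icc (0 : ℝ) 1) hF).comp contDiff_snd)
  have hN' := ((hN.differentiable (by simp)) ((0 : ℝ), u)).hasFDerivAt
  have h1 := (hasFDerivAt_fst (𝕜 := ℝ) (p := ((0 : ℝ), u))).smul hN'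
  have h2 := (hasFDerivAt_fst (𝕜 := ℝ) (p := ((0 : ℝ), u))).prodMk
    ((hasFDerivAt_snd (𝕜 := ℝ) (p := ((0 : ℝ), u))).sub h1)
  refine HasFDerivAt.congr_fderiv (f := flowMap hF) h2 ?_
  ext <;> simp [shearEquiv]

/-- This is the integral form of the equation for the orbit τ ↦ α(sτ), run on [0, 1] at speed s. It
says that `flowMap` sends this orbit to a constant function. -/
theorem image_flow_sub_eq {F : V → V} (hF : Continuous F) {α : ℝ → V} {η s : ℝ} (hs : |s| < η)
    (hα : ∀ t ∈ Ioo (-η) η, HasDerivAt α (F (α t)) t) (τ : Icc (0 : ℝ) 1) :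
    α (s * τ) - s • ∫ σ in (0 : ℝ)..τ, F (α (s * (projIcc (0 : ℝ) 1 zero_le_one σ : ℝ))) = α 0 := by
  have hmem : ∀ σ ∈ Icc (0 : ℝ) 1, s * σ ∈ Ioo (-η) η := by
    intro σ hσ
    rw [mem_Ioo, ← abs_lt, abs_mul, abs_of_nonneg hσ.1]
    exact (mul_le_of_le_one_right (abs_nonneg s) hσ.2).trans_lt hs
  have hsub : uIcc (0 : ℝ) τ ⊆ Icc 0 1 := by
    rw [uIcc_of_le τ.2.1]
    exact Icc_subset_Icc_right τ.2.2
  have hd : ∀ σ ∈ uIcc (0 : ℝ) τ, HasDerivAt (fun σ => α (s * σ)) (s • F (α (s * σ))) σ := by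
    intro σ hσ
    have h1 := hα _ (hmem σ (hsub hσ))
    have h2 : HasDerivAt (fun σ : ℝ => s * σ) s σ := by
      simpa using (hasDerivAt_id σ).const_mul s
    exact h1.scomp σ h2
  have hcont : ContinuousOn (fun σ => s • F (α (s * σ))) (uIcc (0 : ℝ) τ) := by
    refine ContinuousOn.const_smul ?_ s
    exact hF.comp_continuousOn fun σ hσ => (hd σ hσ).continuousAt.continuousWithinAt
  have hint := intervalIntegral.integral_eq_sub_of_hasDerivAt hd hcont.intervalIntegrable
  rw [mul_zero, intervalIntegral.integral_smul] at hint
  have hcongr : ∫ σ in (0 : ℝ)..τ, F (α (s * (projIcc (0 : ℝ) 1 zero_le_one σ : ℝ)))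
      = ∫ σ in (0 : ℝ)..τ, F (α (s * σ)) := by
    refine intervalIntegral.integral_congr fun σ hσ => ?_
    rw [projIcc_of_mem _ (hsub hσ)]
  rw [hcongr, hint]
  abel

/-- A smooth vector field on a Banach space has a smooth local flow. -/
theorem exists_flowBox_of_contDiff {F : V → V} (hF : ContDiff ℝ ∞ F) (c : V) :
    ∃ r > 0, ∃ η > 0, ∃ φ : ℝ × V → V,
      ContDiffOn ℝ ∞ φ (Ioo (-η) η ×ˢ Metric.ball c r) ∧
      ∀ p ∈ Metric.ball c r, φ (0, p) = p ∧
        ∀ t ∈ Ioo (-η) η, HasDerivAt (fun t => φ (t, p)) (F (φ (t, p))) t := by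
  set I := Icc (0 : ℝ) 1
  set u₀ : C(I, V) := ContinuousMap.const I c
  set w := primitiveOp V (nemytskii I ⟨F, hF.continuous⟩ u₀)
  have hΘ := contDiff_flowMap hF
  have hder := hasFDerivAt_flowMap_zero hF u₀
  -- The local inverse, applied to (s, constant p) and evaluated at the endpoint 1, will be the
  -- time-s flow of p. It is smooth but not visibly a flow; the continuous flow of Picard-Lindelöf
  -- is identified with it in `hident`.
  set Θ := hΘ.contDiffAt.toOpenPartialHomeomorph (flowMap hF) hder (by simp) with hΘdef
  have hΘcoe : (Θ : ℝ × C(I, V) → ℝ × C(I, V)) = flowMap hF := rfl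
  have hsrc : ((0 : ℝ), u₀) ∈ Θ.source :=
    hΘ.contDiffAt.mem_toOpenPartialHomeomorph_source hder (by simp)
  have hval : flowMap hF (0, u₀) = (0, u₀) := by simp [flowMap]
  -- points near which the derivative is invertible
  have hinv : ∀ᶠ q in 𝓝 ((0 : ℝ), u₀), q ∈ Θ.source ∧
      fderiv ℝ (flowMap hF) q ∈ range ((↑) : ((ℝ × C(I, V)) ≃L[ℝ] (ℝ × C(I, V))) → _) := by
    refine Filter.Eventually.and (Θ.open_source.mem_nhds hsrc) ?_
    have hc : ContinuousAt (fderiv ℝ (flowMap hF)) ((0 : ℝ), u₀) :=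
      (hΘ.continuous_fderiv (by simp)).continuousAt
    refine hc ?_
    rw [hder.fderiv]
    exact ContinuousLinearEquiv.nhds _
  have hsymm0 : Θ.symm ((0 : ℝ), u₀) = ((0 : ℝ), u₀) := by
    conv_lhs => rw [← hval]
    exact Θ.left_inv hsrc
  have htgt0 : ((0 : ℝ), u₀) ∈ Θ.target := by
    have := Θ.map_source hsrc
    rwa [hΘcoe, hval] at this
  -- Picard-Lindelöf
  obtain ⟨ε, hε, a, r, L, K, hr, hpl⟩ :=
    IsPicardLindelof.of_contDiffAt_one (hF.of_le (by simp) : ContDiff ℝ 1 F).contDiffAt (x₀ := c)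
  obtain ⟨α, hα, hαc⟩ :=
    (hpl 0).exists_forall_mem_closedBall_eq_hasDerivWithinAt_continuousOn
  simp only [zero_sub, zero_add] at hα hαc
  have hαd : ∀ p ∈ Metric.closedBall c r, ∀ t ∈ Ioo (-ε) ε,
      HasDerivAt (fun t => α (p, t)) (F (α (p, t))) t := fun p hp t ht =>
    ((hα p hp).2 t (Ioo_subset_Icc_self ht)).hasDerivAt (Icc_mem_nhds ht.1 ht.2)
  have hα00 : α (c, 0) = c := (hα c (Metric.mem_closedBall_self r.2)).1
  have hαat : ContinuousAt α (c, 0) :=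
    hαc.continuousAt (prod_mem_nhds (Metric.closedBall_mem_nhds c hr)
      (Icc_mem_nhds (by linarith) hε))
  -- neighbourhoods
  obtain ⟨ρ, hρ, hball⟩ := Metric.mem_nhds_iff.1 (hinv)
  have hconst : Continuous fun q : ℝ × V => (q.1, ContinuousMap.const I q.2) :=
    continuous_fst.prodMk (ContinuousMap.continuous_const'.comp continuous_snd)
  have hnear : ∀ᶠ q in 𝓝 ((0 : ℝ), c), (q.1, ContinuousMap.const I q.2) ∈ Θ.target ∧
      Θ.symm (q.1, ContinuousMap.const I q.2) ∈ Metric.ball ((0 : ℝ), u₀) ρ := by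
    have h1 : Tendsto (fun q : ℝ × V => (q.1, ContinuousMap.const I q.2)) (𝓝 ((0 : ℝ), c))
        (𝓝 ((0 : ℝ), u₀)) := hconst.tendsto ((0 : ℝ), c)
    refine (h1.eventually (Θ.open_target.eventually_mem htgt0)).and ?_
    have h2 := Θ.symm.continuousAt htgt0
    have h3 : Metric.ball ((0 : ℝ), u₀) ρ ∈ 𝓝 (Θ.symm ((0 : ℝ), u₀)) := by
      rw [hsymm0]; exact Metric.ball_mem_nhds _ hρ
    exact h1.eventually (h2 h3)
  have hnear2 : ∀ᶠ q in 𝓝 (c, (0 : ℝ)), dist (α q) c < ρ / 2 := by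
    have := hαat (Metric.ball_mem_nhds _ (half_pos hρ))
    rwa [hα00] at this
  obtain ⟨κ₁, hκ₁, hb1⟩ := Metric.mem_nhds_iff.1 hnear
  obtain ⟨κ₂, hκ₂, hb2⟩ := Metric.mem_nhds_iff.1 hnear2
  obtain ⟨κ, hκ, hk1, hk2, hkr, hkε, hkρ⟩ :
      ∃ κ > 0, κ ≤ κ₁ ∧ κ ≤ κ₂ ∧ κ ≤ r ∧ κ ≤ ε ∧ κ ≤ ρ / 2 :=
    ⟨min κ₁ (min κ₂ (min r (min ε (ρ / 2)))), by
      have : (0 : ℝ) < r := hr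
      have := half_pos hρ
      positivity, by simp, by simp, by simp, by simp, by simp⟩
  -- identification of the flow
  have hident : ∀ p ∈ Metric.ball c κ, ∀ s ∈ Ioo (-κ) κ,
      (Θ.symm (s, ContinuousMap.const I p)).2 ⟨1, right_mem_Icc.2 zero_le_one⟩ = α (p, s) := by
    intro p hp s hs
    have hpr : p ∈ Metric.closedBall c r := Metric.ball_subset_closedBall
      (Metric.ball_subset_ball hkr hp)
    have hsabs : |s| < κ := abs_lt.2 hs
    have hmem : ∀ τ : I, s * τ ∈ Ioo (-κ) κ := by
      intro τ
      rw [mem_Ioo, ← abs_lt, abs_mul, abs_of_nonneg τ.2.1]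
      exact (mul_le_of_le_one_right (abs_nonneg s) τ.2.2).trans_lt hsabs
    have hcont : Continuous fun τ : I => α (p, s * τ) := by
      refine continuous_iff_continuousAt.2 fun τ => ?_
      have h1 := (hαd p hpr (s * τ) (Ioo_subset_Ioo (by linarith) hkε (hmem τ))).continuousAt
      have h2 : ContinuousAt (fun τ : I => s * (τ : ℝ)) τ := by fun_prop
      exact ContinuousAt.comp (f := fun τ : I => s * (τ : ℝ)) (g := fun t => α (p, t)) h1 h2
    set u : C(I, V) := ⟨fun τ => α (p, s * τ), hcont⟩
    have hu : dist u u₀ ≤ ρ / 2 := by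
      rw [ContinuousMap.dist_le (by positivity)]
      intro τ
      have : ((p, s * τ) : V × ℝ) ∈ Metric.ball (c, (0 : ℝ)) κ₂ := by
        rw [Metric.mem_ball, Prod.dist_eq, max_lt_iff]
        refine ⟨lt_of_lt_of_le hp hk2, ?_⟩
        rw [dist_zero_right, Real.norm_eq_abs]
        exact (abs_lt.2 (hmem τ)).trans_le hk2
      exact (hb2 this).le
    have hsu : (s, u) ∈ Θ.source := by
      refine (hball ?_).1
      rw [Metric.mem_ball, Prod.dist_eq, max_lt_iff]
      refine ⟨?_, by change dist u u₀ < ρ; linarith⟩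
      rw [dist_zero_right, Real.norm_eq_abs]
      linarith
    have himg : Θ (s, u) = (s, ContinuousMap.const I p) := by
      rw [hΘcoe]
      refine Prod.ext rfl ?_
      ext τ
      have h1 := image_flow_sub_eq hF.continuous (α := fun t => α (p, t)) (η := κ) hsabs
        (fun t ht => hαd p hpr t (Ioo_subset_Ioo (by linarith) hkε ht)) τ
      rw [(hα p hpr).1] at h1
      exact h1
    -- The rescaled orbit lies in the source of Θ, where Θ is injective, so it is the preimage of
    -- the constant function.
    rw [← himg, Θ.left_inv hsu]
    simp [u]
  refine ⟨κ, hκ, κ, hκ, fun q => α (q.2, q.1), ?_, fun p hp => ?_⟩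
  · have hsm : ContDiffOn ℝ ∞ (fun q : ℝ × V =>
        (Θ.symm (q.1, ContinuousMap.const I q.2)).2 ⟨1, right_mem_Icc.2 zero_le_one⟩)
        (Ioo (-κ) κ ×ˢ Metric.ball c κ) := by
      intro q hq
      have hqb : q ∈ Metric.ball ((0 : ℝ), c) κ₁ := by
        rw [Metric.mem_ball, Prod.dist_eq, max_lt_iff]
        refine ⟨?_, lt_of_lt_of_le hq.2 hk1⟩
        rw [dist_zero_right, Real.norm_eq_abs]
        exact (abs_lt.2 hq.1).trans_le hk1
      obtain ⟨htg, hsy⟩ := hb1 hqb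
      obtain ⟨-, f', hf'⟩ := hball hsy
      have hd : HasFDerivAt Θ (f' : ℝ × C(I, V) →L[ℝ] ℝ × C(I, V))
          (Θ.symm (q.1, ContinuousMap.const I q.2)) := by
        rw [hf', hΘcoe]
        exact (hΘ.differentiable (by simp) _).hasFDerivAt
      have hs := Θ.contDiffAt_symm htg hd (n := ∞) (by rw [hΘcoe]; exact hΘ.contDiffAt)
      have hlin : ContDiff ℝ ∞ fun q : ℝ × V => (q.1, ContinuousMap.const I q.2) :=
        contDiff_fst.prodMk
          ((constMapCLM I V).contDiff.comp contDiff_snd)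
      have hev : ContDiff ℝ ∞ fun v : ℝ × C(I, V) => v.2 ⟨1, right_mem_Icc.2 zero_le_one⟩ :=
        (ContinuousMap.evalCLM ℝ (⟨1, right_mem_Icc.2 zero_le_one⟩ : I) : C(I, V) →L[ℝ] V).contDiff.comp
          contDiff_snd
      exact (hev.contDiffAt.comp q (hs.comp q hlin.contDiffAt)).contDiffWithinAt
    exact hsm.congr fun q hq => (hident q.2 hq.2 q.1 hq.1).symm
  · have hpr : p ∈ Metric.closedBall c r := Metric.ball_subset_closedBall
      (Metric.ball_subset_ball hkr hp)
    exact ⟨(hα p hpr).1, fun t ht => hαd p hpr t (Ioo_subset_Ioo (by linarith) hkε ht)⟩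

end FlowBox

/-! ### Uniqueness, parameter dependence and existence for ordinary differential equations. -/

section VectorODE

variable {V : Type*} [NormedAddCommGroup V] [NormedSpace ℝ V]

/-- The hypothesis `hstep` yields both halves of the connectedness argument: with t₁ = t it makes
the set of good times open, and with t₂ = t it makes it relatively closed. -/
theorem forall_of_local_propagation {J : Set ℝ} (hJ : IsPreconnected J) (hJo : IsOpen J)
    {Q : ℝ → Prop} {t₀ : ℝ} (ht₀ : t₀ ∈ J) (h₀ : Q t₀)
    (hstep : ∀ t ∈ J, ∃ η > 0, ∀ t₁ ∈ J, |t₁ - t| < η → Q t₁ → ∀ t₂ ∈ J, |t₂ - t| < η → Q t₂) :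
    ∀ t ∈ J, Q t := by
  suffices h : J ⊆ J ∩ {t | Q t} from fun t ht => (h ht).2
  refine hJ.subset_of_closure_inter_subset ?_ ⟨t₀, ht₀, ht₀, h₀⟩ ?_
  · rw [isOpen_iff_mem_nhds]
    rintro t ⟨ht, hQ⟩
    obtain ⟨η, hη, h⟩ := hstep t ht
    filter_upwards [hJo.mem_nhds ht, Metric.ball_mem_nhds t hη] with t₂ h2 h3
    exact ⟨h2, h t ht (by simpa using hη) hQ t₂ h2 h3⟩
  · rintro t ⟨hcl, ht⟩
    obtain ⟨η, hη, h⟩ := hstep t ht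
    obtain ⟨t₁, ht₁, hd⟩ := Metric.mem_closure_iff.1 hcl η hη
    rw [dist_comm] at hd
    exact ⟨ht, h t₁ ht₁.1 hd ht₁.2 t ht (by simpa using hη)⟩

theorem eqOn_of_solves_ode {F : V → V} {Ω : Set V} (hΩ : IsOpen Ω) (hF : ContDiffOn ℝ ∞ F Ω)
    {f g : ℝ → V} {J : Set ℝ} (hJ : IsPreconnected J) (hJo : IsOpen J)
    (hf : ∀ t ∈ J, f t ∈ Ω ∧ HasDerivAt f (F (f t)) t)
    (hg : ∀ t ∈ J, g t ∈ Ω ∧ HasDerivAt g (F (g t)) t) {t₀ : ℝ} (ht₀ : t₀ ∈ J)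
    (h : f t₀ = g t₀) : EqOn f g J := by
  refine forall_of_local_propagation hJ hJo ht₀ h fun t ht => ?_
  by_cases hc : f t = g t
  · obtain ⟨K, s, hs, hlip⟩ := ((hF.contDiffAt (hΩ.mem_nhds (hf t ht).1)).of_le
      (by simp : (1 : WithTop ℕ∞) ≤ ∞)).exists_lipschitzOnWith
    have he : f =ᶠ[𝓝 t] g := by
      refine ODE_solution_unique_of_eventually (v := fun _ => F) (s := fun _ => s) (K := K)
        (Eventually.of_forall fun _ => hlip) ?_ ?_ hc
      · filter_upwards [hJo.mem_nhds ht, (hf t ht).2.continuousAt hs] with u hu hu'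
        exact ⟨(hf u hu).2, hu'⟩
      · rw [hc] at hs
        filter_upwards [hJo.mem_nhds ht, (hg t ht).2.continuousAt hs] with u hu hu'
        exact ⟨(hg u hu).2, hu'⟩
    obtain ⟨η, hη, hb⟩ := Metric.mem_nhds_iff.1 he
    exact ⟨η, hη, fun _ _ _ _ t₂ _ h2 => hb h2⟩
  -- If the curves differ at t they differ nearby, and the propagation property holds vacuously.
  · have hne : ∀ᶠ u in 𝓝 t, f u ≠ g u :=
      ((hf t ht).2.continuousAt.prodMk (hg t ht).2.continuousAt).eventually
        (isClosed_diagonal.isOpen_compl.mem_nhds (x := (f t, g t)) hc)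
    obtain ⟨η, hη, hb⟩ := Metric.mem_nhds_iff.1 hne
    exact ⟨η, hη, fun t₁ _ h1 hQ => absurd hQ (hb h1)⟩

variable [FiniteDimensional ℝ V]

/-- A smooth vector field on an open set has a smooth local flow. -/
theorem exists_flowBox {F : V → V} {Ω : Set V} (hΩ : IsOpen Ω) (hF : ContDiffOn ℝ ∞ F Ω) {c : V}
    (hc : c ∈ Ω) :
    ∃ r > 0, ∃ η > 0, ∃ φ : ℝ × V → V,
      ContDiffOn ℝ ∞ φ (Ioo (-η) η ×ˢ Metric.ball c r) ∧
      ∀ p ∈ Metric.ball c r, φ (0, p) = p ∧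
        ∀ t ∈ Ioo (-η) η, φ (t, p) ∈ Ω ∧ HasDerivAt (fun t => φ (t, p)) (F (φ (t, p))) t := by
  have : CompleteSpace V := FiniteDimensional.complete ℝ V
  obtain ⟨ρ, hρ, hb⟩ := Metric.isOpen_iff.1 hΩ c hc
  -- The cut-off field is smooth on the whole space. Orbits that remain within ρ / 4 of c only see
  -- the original field.
  let χ : ContDiffBump c := ⟨ρ / 4, ρ / 2, by positivity, by linarith⟩
  have hG : ContDiff ℝ ∞ fun x => χ x • F x := by
    rw [contDiff_iff_contDiffAt]
    intro x
    by_cases hx : x ∈ Metric.ball c ρ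
    · exact χ.contDiffAt.smul (hF.contDiffAt (hΩ.mem_nhds (hb hx)))
    · have h0 : (fun x => χ x • F x) =ᶠ[𝓝 x] fun _ => 0 := by
        have : (Metric.closedBall c (ρ / 2))ᶜ ∈ 𝓝 x := by
          refine Metric.isClosed_closedBall.isOpen_compl.mem_nhds fun h => hx ?_
          exact Metric.closedBall_subset_ball (by linarith) h
        filter_upwards [this] with y hy
        have hy' : ρ / 2 < dist y c := by simpa using hy
        rw [χ.zero_of_le_dist hy'.le, zero_smul]
      exact contDiffAt_const.congr_of_eventuallyEq h0
  obtain ⟨r, hr, η, hη, φ, hφ, hsol⟩ := exists_flowBox_of_contDiff hG c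
  have hφc : ContinuousAt φ (0, c) :=
    hφ.continuousOn.continuousAt (prod_mem_nhds (Ioo_mem_nhds (by linarith) hη)
      (Metric.ball_mem_nhds _ hr))
  have hφ0 : φ (0, c) = c := (hsol c (Metric.mem_ball_self hr)).1
  have hev := hφc (Metric.ball_mem_nhds (φ (0, c)) (ε := ρ / 4) (by positivity))
  rw [hφ0] at hev
  obtain ⟨κ, hκ, hκb⟩ := Metric.mem_nhds_iff.1 hev
  have hsub : ∀ t ∈ Ioo (-(min κ η)) (min κ η), ∀ p ∈ Metric.ball c (min κ r),
      dist (φ (t, p)) c < ρ / 4 := by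
    intro t ht p hp
    refine hκb (a := (t, p)) ?_
    rw [mem_ball_iff_norm, Prod.norm_def, max_lt_iff]
    refine ⟨?_, ?_⟩
    · rw [Prod.fst_sub, sub_zero, Real.norm_eq_abs]
      exact (abs_lt.2 ht).trans_le (min_le_left _ _)
    · rw [Prod.snd_sub, ← dist_eq_norm]
      exact lt_of_lt_of_le hp (min_le_left _ _)
  refine ⟨min κ r, lt_min hκ hr, min κ η, lt_min hκ hη, φ, hφ.mono (prod_mono ?_ ?_),
    fun p hp => ⟨(hsol p (Metric.ball_subset_ball (min_le_right _ _) hp)).1, fun t ht => ?_⟩⟩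
  · exact Ioo_subset_Ioo (neg_le_neg (min_le_right _ _)) (min_le_right _ _)
  · exact Metric.ball_subset_ball (min_le_right _ _)
  · have h1 := hsub t ht p hp
    refine ⟨hb (h1.trans (by linarith)), ?_⟩
    have h2 := (hsol p (Metric.ball_subset_ball (min_le_right _ _) hp)).2 t
      (Ioo_subset_Ioo (neg_le_neg (min_le_right _ _)) (min_le_right _ _) ht)
    rwa [χ.one_of_mem_closedBall (show φ (t, p) ∈ Metric.closedBall c (ρ / 4) from h1.le),
      one_smul] at h2

/-- A family of solutions depending smoothly on a parameter at one time does so at all times. -/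
theorem contDiffOn_family_of_solves {P : Type*} [NormedAddCommGroup P] [NormedSpace ℝ P]
    {F : V → V} {Ω : Set V} (hΩ : IsOpen Ω) (hF : ContDiffOn ℝ ∞ F Ω) {U : Set P} (hU : IsOpen U)
    {a b t₀ : ℝ} (ht₀ : t₀ ∈ Ioo a b) {α : P → ℝ → V}
    (hα : ∀ s ∈ U, ∀ t ∈ Ioo a b, α s t ∈ Ω ∧ HasDerivAt (α s) (F (α s t)) t)
    (h₀ : ContDiffOn ℝ ∞ (fun s => α s t₀) U) :
    ContDiffOn ℝ ∞ (fun q : P × ℝ => α q.1 q.2) (U ×ˢ Ioo a b) := by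
  -- local propagation
  have hstep : ∀ s₀ ∈ U, ∀ t ∈ Ioo a b, ∃ η > 0, ∀ t₁ ∈ Ioo a b, |t₁ - t| < η →
      (∃ W, IsOpen W ∧ s₀ ∈ W ∧ ContDiffOn ℝ ∞ (fun s => α s t₁) W) →
      ∃ W, IsOpen W ∧ s₀ ∈ W ∧
        ContDiffOn ℝ ∞ (fun q : P × ℝ => α q.1 q.2) (W ×ˢ (Ioo a b ∩ Metric.ball t η)) := by
    intro s₀ hs₀ t ht
    obtain ⟨r, hr, η, hη, φ, hφ, hsol⟩ := exists_flowBox hΩ hF (hα s₀ hs₀ t ht).1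
    obtain ⟨κ, hκ, hκb⟩ := Metric.mem_nhds_iff.1
      ((hα s₀ hs₀ t ht).2.continuousAt (Metric.ball_mem_nhds _ hr))
    -- Two times within η / 2 of t are less than η apart, so the flow box started at t₁ reaches t₂.
    refine ⟨min κ (η / 2), lt_min hκ (half_pos hη), fun t₁ ht₁ hd₁ ⟨W, hWo, hsW, hW⟩ => ?_⟩
    have hin : α s₀ t₁ ∈ Metric.ball (α s₀ t) r := hκb (lt_of_lt_of_le hd₁ (min_le_left _ _))
    have hWc : ContinuousOn (fun s => α s t₁) (W ∩ U) := hW.continuousOn.mono inter_subset_left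
    have hopen := hWc.isOpen_inter_preimage (hWo.inter hU)
      (Metric.isOpen_ball (x := α s₀ t) (ε := r))
    refine ⟨_, hopen, ⟨⟨hsW, hs₀⟩, hin⟩, ?_⟩
    have hdist : ∀ t₂ ∈ Metric.ball t (min κ (η / 2)), |t₂ - t₁| < η := by
      intro t₂ ht₂
      have h2 : |t₂ - t| < η / 2 := lt_of_lt_of_le ht₂ (min_le_right _ _)
      have h1 : |t₁ - t| < η / 2 := hd₁.trans_le (min_le_right _ _)
      rw [abs_lt] at *
      constructor <;> linarith
    have heq : ∀ q ∈ (W ∩ U ∩ (fun s => α s t₁) ⁻¹' Metric.ball (α s₀ t) r) ×ˢ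
        (Ioo a b ∩ Metric.ball t (min κ (η / 2))),
        α q.1 q.2 = φ (q.2 - t₁, α q.1 t₁) := by
      rintro ⟨s, t₂⟩ ⟨⟨⟨hsW, hsU⟩, hsb⟩, ht₂, ht₂b⟩
      have hJ := isPreconnected_Ioo (a := max a (t₁ - η)) (b := min b (t₁ + η))
      refine eqOn_of_solves_ode hΩ hF hJ isOpen_Ioo (f := α s) (t₀ := t₁)
        (g := fun t => φ (t - t₁, α s t₁)) (fun u hu => hα s hsU u ?_) (fun u hu => ?_) ?_ ?_ ?_
      · exact ⟨(le_max_left _ _).trans_lt hu.1, hu.2.trans_le (min_le_left _ _)⟩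
      · have hu1 := (le_max_right _ _).trans_lt hu.1
        have hu2 := hu.2.trans_le (min_le_right _ _)
        have h3 := (hsol _ hsb).2 (u - t₁) ⟨by linarith, by linarith⟩
        exact ⟨h3.1, h3.2.comp_sub_const u t₁⟩
      · exact ⟨max_lt ht₁.1 (by linarith), lt_min ht₁.2 (by linarith)⟩
      · simp only [sub_self]
        exact ((hsol _ hsb).1).symm
      · have h4 := abs_lt.1 (hdist t₂ ht₂b)
        exact ⟨max_lt ht₂.1 (by linarith [h4.1]), lt_min ht₂.2 (by linarith [h4.2])⟩
    refine ContDiffOn.congr ?_ heq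
    refine hφ.comp (t := Ioo (-η) η ×ˢ Metric.ball (α s₀ t) r) (g := φ)
      (f := fun q : P × ℝ => (q.2 - t₁, α q.1 t₁)) ?_ ?_
    · refine ContDiffOn.prodMk (contDiff_snd.sub contDiff_const).contDiffOn ?_
      exact (hW.comp contDiff_fst.contDiffOn fun q hq => hq.1.1.1)
    · rintro ⟨s, t₂⟩ ⟨⟨⟨hsW, hsU⟩, hsb⟩, ht₂, ht₂b⟩
      exact ⟨abs_lt.1 (hdist t₂ ht₂b), hsb⟩
  have hall : ∀ s₀ ∈ U, ∀ t ∈ Ioo a b,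
      ∃ W, IsOpen W ∧ s₀ ∈ W ∧ ContDiffOn ℝ ∞ (fun s => α s t) W := by
    intro s₀ hs₀
    refine forall_of_local_propagation isPreconnected_Ioo isOpen_Ioo ht₀ ⟨U, hU, hs₀, h₀⟩ ?_
    intro t ht
    obtain ⟨η, hη, h⟩ := hstep s₀ hs₀ t ht
    refine ⟨η, hη, fun t₁ ht₁ hd hQ t₂ ht₂ hd₂ => ?_⟩
    obtain ⟨W, hWo, hsW, hW⟩ := h t₁ ht₁ hd hQ
    refine ⟨W, hWo, hsW, ?_⟩
    exact hW.comp (f := fun s => (s, t₂)) (contDiff_id.prodMk contDiff_const).contDiffOn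
      fun s hs => ⟨hs, ht₂, hd₂⟩
  rintro ⟨s₀, t⟩ ⟨hs₀, ht⟩
  obtain ⟨η, hη, h⟩ := hstep s₀ hs₀ t ht
  obtain ⟨W, hWo, hsW, hW⟩ := h t ht (by simpa using hη) (hall s₀ hs₀ t ht)
  exact (hW.contDiffAt (prod_mem_nhds (hWo.mem_nhds hsW)
    ((isOpen_Ioo.inter Metric.isOpen_ball).mem_nhds
      ⟨ht, Metric.mem_ball_self hη⟩))).contDiffWithinAt

/-- Compact support makes the fields globally bounded and Lipschitz. Picard-Lindelöf then works on
all of [-1, 1] at once, with a ball so large that no solution can leave it. -/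
theorem exists_solution_of_compactSupport {G₀ G₁ : V → V} (hG₀ : ContDiff ℝ ∞ G₀)
    (hG₁ : ContDiff ℝ ∞ G₁) (hc₀ : HasCompactSupport G₀) (hc₁ : HasCompactSupport G₁)
    {d : ℝ → ℝ} (hd : Continuous d) {t₀ : ℝ} (ht₀ : t₀ ∈ Icc (-1 : ℝ) 1) (c : V) :
    ∃ α : ℝ → V, α t₀ = c ∧
      ∀ t ∈ Ioo (-1 : ℝ) 1, HasDerivAt α (G₀ (α t) + d t • G₁ (α t)) t := by
  have : CompleteSpace V := FiniteDimensional.complete ℝ V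
  obtain ⟨M₀, hM₀⟩ := hc₀.exists_bound_of_continuous hG₀.continuous
  obtain ⟨M₁, hM₁⟩ := hc₁.exists_bound_of_continuous hG₁.continuous
  obtain ⟨Md, hMd⟩ := (isCompact_Icc (a := (-1 : ℝ)) (b := 1)).exists_bound_of_continuousOn
    hd.continuousOn
  obtain ⟨K₀, hK₀⟩ := hG₀.lipschitzWith_of_hasCompactSupport hc₀ (by simp)
  obtain ⟨K₁, hK₁⟩ := hG₁.lipschitzWith_of_hasCompactSupport hc₁ (by simp)
  have hM₀' : 0 ≤ M₀ := (norm_nonneg _).trans (hM₀ 0)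
  have hM₁' : 0 ≤ M₁ := (norm_nonneg _).trans (hM₁ 0)
  have hMd' : 0 ≤ Md := (norm_nonneg _).trans (hMd t₀ ht₀)
  -- The factor 2 in the radius bounds the time from `t₀` to either end of [-1, 1].
  have hpl : IsPicardLindelof (fun t x => G₀ x + d t • G₁ x) (tmin := -1) (tmax := 1) ⟨t₀, ht₀⟩ c
      (2 * (M₀ + Md * M₁).toNNReal) 0 (M₀ + Md * M₁).toNNReal (K₀ + Md.toNNReal * K₁) := by
    refine ⟨fun t ht => ?_, fun x _ => ?_, fun t ht x _ => ?_, ?_⟩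
    · refine (LipschitzWith.of_dist_le_mul fun x y => ?_).lipschitzOnWith
      rw [dist_eq_norm]
      have h1 := hK₀.dist_le_mul x y
      have h2 := hK₁.dist_le_mul x y
      have h3 := hMd t ht
      calc ‖G₀ x + d t • G₁ x - (G₀ y + d t • G₁ y)‖
          = ‖(G₀ x - G₀ y) + d t • (G₁ x - G₁ y)‖ := by rw [smul_sub]; congr 1; abel
        _ ≤ dist (G₀ x) (G₀ y) + ‖d t‖ * dist (G₁ x) (G₁ y) := by
          rw [dist_eq_norm, dist_eq_norm, ← norm_smul]; exact norm_add_le _ _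
        _ ≤ K₀ * dist x y + Md * (K₁ * dist x y) := by gcongr
        _ = _ := by push_cast; rw [Real.coe_toNNReal _ hMd']; ring
    · exact (continuous_const.add (hd.smul continuous_const)).continuousOn
    · rw [Real.coe_toNNReal _ (by positivity)]
      refine (norm_add_le _ _).trans ?_
      rw [norm_smul]
      have h3 := hMd t ht
      have h4 := hM₀ x
      have h5 := hM₁ x
      gcongr
    · push_cast
      rw [Real.coe_toNNReal _ (by positivity), sub_zero, mul_comm]
      gcongr
      exact max_le (by linarith [ht₀.1]) (by linarith [ht₀.2])
  obtain ⟨α, h1, h2⟩ := hpl.exists_eq_forall_mem_Icc_hasDerivWithinAt₀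
  exact ⟨α, h1, fun t ht => (h2 t (Ioo_subset_Icc_self ht)).hasDerivAt (Icc_mem_nhds ht.1 ht.2)⟩

/-- Solutions of a compactly supported ODE with a smooth net of forcing terms form a smooth net. -/
theorem exists_smooth_family_of_compactSupport {G₀ G₁ : V → V} (hG₀ : ContDiff ℝ ∞ G₀)
    (hG₁ : ContDiff ℝ ∞ G₁) (hc₀ : HasCompactSupport G₀) (hc₁ : HasCompactSupport G₁)
    {d : ℝ → ℝ → ℝ} (hd : ContDiffOn ℝ ∞ (fun q : ℝ × ℝ => d q.1 q.2) (Ioo 0 1 ×ˢ univ))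
    {t₀ : ℝ} (ht₀ : t₀ ∈ Ioo (-1 : ℝ) 1) (c : V) :
    ∃ α : ℝ → ℝ → V, (∀ ε ∈ Ioo (0 : ℝ) 1, α ε t₀ = c ∧
      ∀ t ∈ Ioo (-1 : ℝ) 1, HasDerivAt (α ε) (G₀ (α ε t) + d ε t • G₁ (α ε t)) t) ∧
      ContDiffOn ℝ ∞ (fun q : ℝ × ℝ => α q.1 q.2) (Ioo 0 1 ×ˢ Ioo (-1) 1) := by
  have hdc : ∀ ε ∈ Ioo (0 : ℝ) 1, Continuous (d ε) := by
    intro ε hε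
    rw [← continuousOn_univ]
    exact hd.continuousOn.comp (f := fun t => (ε, t)) (by fun_prop) fun t _ => ⟨hε, mem_univ _⟩
  have hex : ∀ ε ∈ Ioo (0 : ℝ) 1, ∃ α : ℝ → V, α t₀ = c ∧
      ∀ t ∈ Ioo (-1 : ℝ) 1, HasDerivAt α (G₀ (α t) + d ε t • G₁ (α t)) t := fun ε hε =>
    exists_solution_of_compactSupport hG₀ hG₁ hc₀ hc₁ (hdc ε hε) (Ioo_subset_Icc_self ht₀) c
  choose! α hα₀ hα using hex
  refine ⟨α, fun ε hε => ⟨hα₀ ε hε, hα ε hε⟩, ?_⟩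
  -- The parameter ε and the time t join the state, with velocities 0 and 1. The field becomes
  -- autonomous, and dependence on ε becomes dependence on the initial value.
  have hΩ : IsOpen ((Ioo (0 : ℝ) 1 ×ˢ univ : Set (ℝ × ℝ)) ×ˢ (univ : Set V)) :=
    (isOpen_Ioo.prod isOpen_univ).prod isOpen_univ
  have hF : ContDiffOn ℝ ∞ (fun p : (ℝ × ℝ) × V =>
      (((0, 1), G₀ p.2 + d p.1.1 p.1.2 • G₁ p.2) : (ℝ × ℝ) × V))
      ((Ioo (0 : ℝ) 1 ×ˢ univ : Set (ℝ × ℝ)) ×ˢ (univ : Set V)) := by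
    refine contDiff_const.contDiffOn.prodMk ((hG₀.comp contDiff_snd).contDiffOn.add ?_)
    exact (hd.comp contDiff_fst.contDiffOn fun p hp => hp.1).smul
      (hG₁.comp contDiff_snd).contDiffOn
  have key := contDiffOn_family_of_solves (α := fun ε t => (((ε, t), α ε t) : (ℝ × ℝ) × V))
    (U := Ioo 0 1) hΩ hF isOpen_Ioo ht₀ (fun ε hε t ht => ⟨⟨⟨hε, mem_univ _⟩, mem_univ _⟩, ?_⟩) ?_
  · exact contDiff_snd.comp_contDiffOn key
  · exact ((hasDerivAt_const t ε).prodMk (hasDerivAt_id t)).prodMk (hα ε hε t ht)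
  · refine (contDiff_id.prodMk contDiff_const).contDiffOn.prodMk ?_
    exact contDiffOn_const.congr fun ε hε => hα₀ ε hε

end VectorODE

theorem contDiffOn_smul_vector {V W : Type*} [NormedAddCommGroup V] [NormedSpace ℝ V]
    [NormedAddCommGroup W] [NormedSpace ℝ W] {c : V → ℝ} {s : Set V} (hc : ContDiffOn ℝ ∞ c s)
    (w : W) : ContDiffOn ℝ ∞ (fun z => c z • w) s :=
  hc.smul contDiffOn_const

/-! ### The metric in charts and its transformation under coordinate changes. -/

section ChartMetric

variable {n : ℕ} {N : Type*} [TopologicalSpace N] [ChartedSpace (EuclideanSpace ℝ (Fin n)) N]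

local notation "𝔼" => EuclideanSpace ℝ (Fin n)

/-- The derivative of the inverse of a chart, as an endomorphism of the model space. -/
def chartLift (e : OpenPartialHomeomorph N 𝔼) (z : 𝔼) : 𝔼 →L[ℝ] 𝔼 :=
  (mfderiv (𝓡 n) (𝓡 n) e.symm z : TangentSpace (𝓡 n) z →L[ℝ] TangentSpace (𝓡 n) (e.symm z))

theorem mdifferentiableAt_chart_symm [IsManifold (𝓡 n) ∞ N] {e : OpenPartialHomeomorph N 𝔼}
    (he : e ∈ IsManifold.maximalAtlas (𝓡 n) ∞ N) {z : 𝔼} (hz : z ∈ e.target) :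
    MDifferentiableAt (𝓡 n) (𝓡 n) e.symm z :=
  (contMDiffAt_symm_of_mem_maximalAtlas he hz).mdifferentiableAt (by simp)

theorem mdifferentiableAt_chart [IsManifold (𝓡 n) ∞ N] {e : OpenPartialHomeomorph N 𝔼}
    (he : e ∈ IsManifold.maximalAtlas (𝓡 n) ∞ N) {p : N} (hp : p ∈ e.source) :
    MDifferentiableAt (𝓡 n) (𝓡 n) e p :=
  (contMDiffAt_of_mem_maximalAtlas he hp).mdifferentiableAt (by simp)

/-- The derivative of a chart at the point with coordinates `z`, as an endomorphism of the model
space. -/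
def chartDrop (e : OpenPartialHomeomorph N 𝔼) (p : N) : 𝔼 →L[ℝ] 𝔼 :=
  (mfderiv (𝓡 n) (𝓡 n) e p : TangentSpace (𝓡 n) p →L[ℝ] TangentSpace (𝓡 n) (e p))

theorem chartDrop_comp_chartLift [IsManifold (𝓡 n) ∞ N] {e : OpenPartialHomeomorph N 𝔼}
    (he : e ∈ IsManifold.maximalAtlas (𝓡 n) ∞ N) {z : 𝔼} (hz : z ∈ e.target) :
    (chartDrop e (e.symm z)).comp (chartLift e z) = ContinuousLinearMap.id ℝ 𝔼 := by
  have h1 : HasMFDerivAt (𝓡 n) (𝓡 n) (e ∘ e.symm) z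
      ((chartDrop e (e.symm z)).comp (chartLift e z)) :=
    (mdifferentiableAt_chart he (e.map_target hz)).hasMFDerivAt.comp z
      (mdifferentiableAt_chart_symm he hz).hasMFDerivAt
  have h2 : HasMFDerivAt (𝓡 n) (𝓡 n) (e ∘ e.symm) z (ContinuousLinearMap.id ℝ 𝔼) := by
    refine (hasMFDerivAt_id z).congr_of_eventuallyEq ?_
    filter_upwards [e.open_target.mem_nhds hz] with y hy using e.right_inv hy
  exact hasMFDerivAt_unique h1 h2

theorem chartLift_injective [IsManifold (𝓡 n) ∞ N] {e : OpenPartialHomeomorph N 𝔼}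
    (he : e ∈ IsManifold.maximalAtlas (𝓡 n) ∞ N) {z : 𝔼} (hz : z ∈ e.target) :
    Function.Injective (chartLift e z) := fun u v h => by
  have := congrArg (chartDrop e (e.symm z)) h
  have h1 := DFunLike.congr_fun (chartDrop_comp_chartLift he hz) u
  have h2 := DFunLike.congr_fun (chartDrop_comp_chartLift he hz) v
  simp only [ContinuousLinearMap.comp_apply, ContinuousLinearMap.id_apply] at h1 h2
  rw [← h1, ← h2, this]

/-- The coordinate change between two charts. -/
theorem contDiffOn_coordChange [IsManifold (𝓡 n) ∞ N] {e e' : OpenPartialHomeomorph N 𝔼}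
    (he : e ∈ IsManifold.maximalAtlas (𝓡 n) ∞ N) (he' : e' ∈ IsManifold.maximalAtlas (𝓡 n) ∞ N) :
    ContDiffOn ℝ ∞ (e' ∘ e.symm) (e.symm.trans e').source := by
  rw [← contMDiffOn_iff_contDiffOn]
  exact (contMDiffOn_of_mem_maximalAtlas he').comp
    ((contMDiffOn_symm_of_mem_maximalAtlas he).mono fun z hz => by simpa using hz.1)
    fun z hz => by simpa using hz.2

theorem chartLift_eq_comp [IsManifold (𝓡 n) ∞ N] {e e' : OpenPartialHomeomorph N 𝔼}
    (he : e ∈ IsManifold.maximalAtlas (𝓡 n) ∞ N) (he' : e' ∈ IsManifold.maximalAtlas (𝓡 n) ∞ N)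
    {z : 𝔼} (hz : z ∈ (e.symm.trans e').source) :
    chartLift e z = (chartLift e' (e' (e.symm z))).comp (fderiv ℝ (e' ∘ e.symm) z) := by
  have hz1 : z ∈ e.target := by simpa using hz.1
  have hz2 : e.symm z ∈ e'.source := by simpa using hz.2
  have hφ : HasMFDerivAt (𝓡 n) (𝓡 n) (e' ∘ e.symm) z (fderiv ℝ (e' ∘ e.symm) z) := by
    refine HasFDerivAt.hasMFDerivAt ?_
    exact (((contDiffOn_coordChange he he').contDiffAt
      ((e.symm.trans e').open_source.mem_nhds hz)).differentiableAt (by simp)).hasFDerivAt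
  have h1 : HasMFDerivAt (𝓡 n) (𝓡 n) (e'.symm ∘ (e' ∘ e.symm)) z
      ((chartLift e' (e' (e.symm z))).comp (fderiv ℝ (e' ∘ e.symm) z)) :=
    (mdifferentiableAt_chart_symm he' (e'.map_source hz2)).hasMFDerivAt.comp z hφ
  have h2 : HasMFDerivAt (𝓡 n) (𝓡 n) (e'.symm ∘ (e' ∘ e.symm)) z (chartLift e z) := by
    refine (mdifferentiableAt_chart_symm he hz1).hasMFDerivAt.congr_of_eventuallyEq ?_
    filter_upwards [(e.symm.trans e').open_source.mem_nhds hz] with y hy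
    have hy2 : e.symm y ∈ e'.source := by simpa using hy.2
    exact e'.left_inv hy2
  exact hasMFDerivAt_unique h2 h1

variable [RiemannianBundle (fun p : N => TangentSpace (𝓡 n) p)]

/-- The Riemannian scalar product on the tangent space at `p`, transported to the model space. -/
def tangentInner (p : N) (u v : 𝔼) : ℝ :=
  inner ℝ (show TangentSpace (𝓡 n) p from u) (show TangentSpace (𝓡 n) p from v)

theorem tangentInner_add_left (p : N) (u u' v : 𝔼) :
    tangentInner p (u + u') v = tangentInner p u v + tangentInner p u' v :=
  inner_add_left (𝕜 := ℝ) (E := TangentSpace (𝓡 n) p) u u' v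

theorem tangentInner_smul_left (p : N) (c : ℝ) (u v : 𝔼) :
    tangentInner p (c • u) v = c * tangentInner p u v :=
  real_inner_smul_left (F := TangentSpace (𝓡 n) p) u v c

theorem tangentInner_comm (p : N) (u v : 𝔼) : tangentInner p u v = tangentInner p v u :=
  real_inner_comm (F := TangentSpace (𝓡 n) p) v u

theorem tangentInner_self_pos (p : N) {u : 𝔼} (hu : u ≠ 0) : 0 < tangentInner p u u :=
  real_inner_self_pos (F := TangentSpace (𝓡 n) p).2 hu

theorem metricCoeff_eq_tangentInner (e : OpenPartialHomeomorph N 𝔼) (z : 𝔼) (i j : Fin n) :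
    metricCoeff e z i j = tangentInner (e.symm z) (chartLift e z (EuclideanSpace.single i 1))
      (chartLift e z (EuclideanSpace.single j 1)) := rfl

/-- The bilinear form of the metric in a chart. -/
def metricForm (e : OpenPartialHomeomorph N 𝔼) (z : 𝔼) : 𝔼 →L[ℝ] 𝔼 →L[ℝ] ℝ :=
  ∑ i, ∑ j, metricCoeff e z i j •
    ((EuclideanSpace.proj i : 𝔼 →L[ℝ] ℝ).smulRight (EuclideanSpace.proj j : 𝔼 →L[ℝ] ℝ))

theorem metricForm_apply (e : OpenPartialHomeomorph N 𝔼) (z u v : 𝔼) :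
    metricForm e z u v = ∑ i, ∑ j, metricCoeff e z i j * (u i * v j) := by
  simp [metricForm]

theorem metricForm_eq_tangentInner (e : OpenPartialHomeomorph N 𝔼) (z u v : 𝔼) :
    metricForm e z u v = tangentInner (e.symm z) (chartLift e z u) (chartLift e z v) := by
  let B : 𝔼 →ₗ[ℝ] 𝔼 →ₗ[ℝ] ℝ := LinearMap.mk₂ ℝ
    (fun u v => tangentInner (e.symm z) (chartLift e z u) (chartLift e z v))
    (fun u u' v => by rw [map_add, tangentInner_add_left])
    (fun c u v => by rw [map_smul, tangentInner_smul_left, smul_eq_mul])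
    (fun u v v' => by
      rw [map_add, tangentInner_comm, tangentInner_add_left, tangentInner_comm,
        tangentInner_comm _ (chartLift e z v')])
    (fun c u v => by
      rw [map_smul, tangentInner_comm, tangentInner_smul_left, tangentInner_comm, smul_eq_mul])
  have hsum : ∀ w : 𝔼, w = ∑ i, w i • EuclideanSpace.single i (1 : ℝ) := fun w => by
    conv_lhs => rw [← (EuclideanSpace.basisFun (Fin n) ℝ).sum_repr w]
    simp
  change _ = B u v
  conv_rhs => rw [hsum u, hsum v]
  simp only [map_sum, LinearMap.sum_apply, map_smul, LinearMap.smul_apply, smul_eq_mul,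
    Finset.mul_sum]
  rw [metricForm_apply, Finset.sum_comm]
  refine Finset.sum_congr rfl fun j _ => Finset.sum_congr rfl fun i _ => ?_
  rw [metricCoeff_eq_tangentInner]
  change _ = v j * (u i * tangentInner _ _ _)
  ring

theorem metricForm_comm (e : OpenPartialHomeomorph N 𝔼) (z u v : 𝔼) :
    metricForm e z u v = metricForm e z v u := by
  rw [metricForm_eq_tangentInner, metricForm_eq_tangentInner, tangentInner_comm]

variable [IsManifold (𝓡 n) ∞ N]

theorem metricForm_pos {e : OpenPartialHomeomorph N 𝔼}
    (he : e ∈ IsManifold.maximalAtlas (𝓡 n) ∞ N) {z : 𝔼} (hz : z ∈ e.target) {u : 𝔼} (hu : u ≠ 0) :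
    0 < metricForm e z u u := by
  rw [metricForm_eq_tangentInner]
  refine tangentInner_self_pos _ fun h => hu ?_
  exact chartLift_injective he hz (by rw [h, map_zero])

theorem eq_of_metricForm_eq {e : OpenPartialHomeomorph N 𝔼}
    (he : e ∈ IsManifold.maximalAtlas (𝓡 n) ∞ N) {z : 𝔼} (hz : z ∈ e.target) {u w : 𝔼}
    (h : ∀ v, metricForm e z u v = metricForm e z w v) : u = w := by
  by_contra hne
  have h1 := metricForm_pos he hz (sub_ne_zero.2 hne)
  have h2 := h (u - w)
  have h3 : metricForm e z (u - w) (u - w) =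
      metricForm e z u (u - w) - metricForm e z w (u - w) := by
    rw [map_sub (metricForm e z)]; rfl
  linarith

/-- Change of charts for the metric. -/
theorem metricForm_coordChange {e e' : OpenPartialHomeomorph N 𝔼}
    (he : e ∈ IsManifold.maximalAtlas (𝓡 n) ∞ N) (he' : e' ∈ IsManifold.maximalAtlas (𝓡 n) ∞ N)
    {z : 𝔼} (hz : z ∈ (e.symm.trans e').source) (u v : 𝔼) :
    metricForm e z u v = metricForm e' (e' (e.symm z)) (fderiv ℝ (e' ∘ e.symm) z u)
      (fderiv ℝ (e' ∘ e.symm) z v) := by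
  have hz2 : e.symm z ∈ e'.source := by simpa using hz.2
  rw [metricForm_eq_tangentInner, metricForm_eq_tangentInner, e'.left_inv hz2,
    chartLift_eq_comp he he' hz]
  rfl

/-- A vector killed by the matrix is orthogonal to everything, hence zero because the form is
definite. -/
theorem isUnit_metricCoeff {e : OpenPartialHomeomorph N 𝔼}
    (he : e ∈ IsManifold.maximalAtlas (𝓡 n) ∞ N) {z : 𝔼} (hz : z ∈ e.target) :
    IsUnit (metricCoeff e z) := by
  rw [← Matrix.mulVec_injective_iff_isUnit]
  intro u w h
  have : (WithLp.toLp 2 u : 𝔼) = WithLp.toLp 2 w := by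
    refine eq_of_metricForm_eq he hz fun v => ?_
    rw [metricForm_comm, metricForm_comm e z (WithLp.toLp 2 w), metricForm_apply, metricForm_apply]
    refine Finset.sum_congr rfl fun i _ => ?_
    have := congrFun h i
    simp only [Matrix.mulVec, dotProduct] at this
    calc ∑ j, metricCoeff e z i j * (v i * u j) = v i * ∑ j, metricCoeff e z i j * u j := by
          rw [Finset.mul_sum]; exact Finset.sum_congr rfl fun j _ => by ring
      _ = v i * ∑ j, metricCoeff e z i j * w j := by rw [this]
      _ = _ := by rw [Finset.mul_sum]; exact Finset.sum_congr rfl fun j _ => by simp; ring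
  exact WithLp.toLp_injective 2 this

variable [IsContMDiffRiemannianBundle (𝓡 n) ∞ (EuclideanSpace ℝ (Fin n))
      (fun p : N => TangentSpace (𝓡 n) p)]

/-- The coordinate fields are images of constant fields under the tangent map of the inverse chart,
hence smooth sections of the tangent bundle. The smoothness of the Riemannian metric then applies to
their inner products. -/
theorem contDiffOn_metricCoeff {e : OpenPartialHomeomorph N 𝔼}
    (he : e ∈ IsManifold.maximalAtlas (𝓡 n) ∞ N) (i j : Fin n) :
    ContDiffOn ℝ ∞ (fun z => metricCoeff e z i j) e.target := by
  have hsec : ∀ i : Fin n, ContMDiffOn (𝓡 n) (𝓡 n).tangent ∞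
      (fun z => (⟨e.symm z, coordVector e i z⟩ : TangentBundle (𝓡 n) N)) e.target := by
    intro i
    have h1 := (contMDiffOn_symm_of_mem_maximalAtlas he).contMDiffOn_tangentMapWithin
      (m := ∞) (by simp) e.open_target.uniqueMDiffOn
    have h2 : ContMDiffOn (𝓡 n) (𝓡 n).tangent ∞
        (fun z : 𝔼 => (⟨z, EuclideanSpace.single i (1 : ℝ)⟩ : TangentBundle (𝓡 n) 𝔼)) e.target :=
      contMDiffOn_vectorSpace_iff_contDiffOn.2 contDiffOn_const
    refine (h1.comp h2 fun z hz => hz).congr fun z hz => ?_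
    simp only [Function.comp, tangentMapWithin]
    rw [mfderivWithin_of_isOpen e.open_target hz]
    rfl
  rw [← contMDiffOn_iff_contDiffOn]
  exact ContMDiffOn.inner_bundle (F := 𝔼) (hsec i) (hsec j)

theorem contDiffOn_metricForm {e : OpenPartialHomeomorph N 𝔼}
    (he : e ∈ IsManifold.maximalAtlas (𝓡 n) ∞ N) : ContDiffOn ℝ ∞ (metricForm e) e.target :=
  ContDiffOn.sum fun i _ => ContDiffOn.sum fun j _ =>
    contDiffOn_smul_vector (contDiffOn_metricCoeff he i j) _

end ChartMetric

/-! ### The Euler-Lagrange form of the geodesic equation -/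

section EulerLagrange

variable {V : Type*} [NormedAddCommGroup V] [NormedSpace ℝ V]

theorem _root_.HasFDerivAt.apply_vector {W₁ W₂ : Type*} [NormedAddCommGroup W₁] [NormedSpace ℝ W₁]
    [NormedAddCommGroup W₂] [NormedSpace ℝ W₂] {c : V → W₁ →L[ℝ] W₂} {c' : V →L[ℝ] W₁ →L[ℝ] W₂}
    {z : V} (h : HasFDerivAt c c' z) (u : W₁) :
    HasFDerivAt (fun y => c y u) ((ContinuousLinearMap.apply ℝ W₂ u).comp c') z :=
  (ContinuousLinearMap.apply ℝ W₂ u).hasFDerivAt.comp z h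

theorem _root_.HasFDerivAt.comp_map {W₁ W₂ : Type*} [NormedAddCommGroup W₁] [NormedSpace ℝ W₁]
    [NormedAddCommGroup W₂] [NormedSpace ℝ W₂] {c : V → W₁ →L[ℝ] W₂} {c' : V →L[ℝ] W₁ →L[ℝ] W₂}
    {φ : V → V} {φ' : V →L[ℝ] V} {z : V} (h : HasFDerivAt c c' (φ z)) (hφ : HasFDerivAt φ φ' z) :
    HasFDerivAt (fun y => c (φ y)) (c'.comp φ') z :=
  h.comp z hφ

/-- The Euler-Lagrange expression of the energy of a metric `G`, at the position `z`, with velocity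
`w` and acceleration `a`, evaluated in the direction `v`. -/
def eulerLagrange (G : V → V →L[ℝ] V →L[ℝ] ℝ) (z w a v : V) : ℝ :=
  G z a v + fderiv ℝ G z w w v - (1 / 2 : ℝ) * fderiv ℝ G z v w w

-- This is the product rule for the pulled back form: one term from the base point of G' and one
-- from each of the two arguments.
set_option synthInstance.maxHeartbeats 200000 in
theorem fderiv_pullback {G G' : V → V →L[ℝ] V →L[ℝ] ℝ} {φ : V → V} {z : V}
    (hφ : ContDiffAt ℝ ∞ φ z) (hG : DifferentiableAt ℝ G z) (hG' : DifferentiableAt ℝ G' (φ z))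
    (h : ∀ᶠ y in 𝓝 z, ∀ u v, G y u v = G' (φ y) (fderiv ℝ φ y u) (fderiv ℝ φ y v)) (d u v : V) :
    fderiv ℝ G z d u v = fderiv ℝ G' (φ z) (fderiv ℝ φ z d) (fderiv ℝ φ z u) (fderiv ℝ φ z v)
      + G' (φ z) (fderiv ℝ (fderiv ℝ φ) z d u) (fderiv ℝ φ z v)
      + G' (φ z) (fderiv ℝ φ z u) (fderiv ℝ (fderiv ℝ φ) z d v) := by
  have hφ1 : HasFDerivAt φ (fderiv ℝ φ z) z := (hφ.differentiableAt (by simp)).hasFDerivAt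
  have hφ2 : HasFDerivAt (fderiv ℝ φ) (fderiv ℝ (fderiv ℝ φ) z) z :=
    ((hφ.fderiv_right (m := ∞) (by simp)).differentiableAt (by simp)).hasFDerivAt
  have hL : HasFDerivAt (fun y => G y u v)
      ((ContinuousLinearMap.apply ℝ ℝ v).comp
        ((ContinuousLinearMap.apply ℝ (V →L[ℝ] ℝ) u).comp (fderiv ℝ G z))) z :=
    (hG.hasFDerivAt.apply_vector u).apply_vector v
  have hu : ∀ u : V, HasFDerivAt (fun y => fderiv ℝ φ y u)
      ((ContinuousLinearMap.apply ℝ V u).comp (fderiv ℝ (fderiv ℝ φ) z)) z := fun u =>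
    hφ2.apply_vector u
  have hR0 := HasFDerivAt.comp_map hG'.hasFDerivAt hφ1
  have hR1 := hR0.clm_apply (hu u)
  have hR := hR1.clm_apply (hu v)
  have hE : (fun y => G y u v) =ᶠ[𝓝 z]
      fun y => G' (φ y) (fderiv ℝ φ y u) (fderiv ℝ φ y v) := by
    filter_upwards [h] with y hy using hy u v
  have := DFunLike.congr_fun (hL.unique (hR.congr_of_eventuallyEq hE)) d
  simp at this
  rw [this]
  ring

/-- The acceleration picks up the second derivative of φ in the direction (w, w). The two other
terms with second derivatives that `fderiv_pullback` produces cancel by symmetry of the second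
derivative. Hence the expression is a covector, and the transformation law of the Christoffel
symbols is never needed. -/
theorem eulerLagrange_pullback {G G' : V → V →L[ℝ] V →L[ℝ] ℝ} {φ : V → V} {z : V}
    (hφ : ContDiffAt ℝ ∞ φ z) (hG : DifferentiableAt ℝ G z) (hG' : DifferentiableAt ℝ G' (φ z))
    (h : ∀ᶠ y in 𝓝 z, ∀ u v, G y u v = G' (φ y) (fderiv ℝ φ y u) (fderiv ℝ φ y v))
    (hsymm : ∀ u v, G' (φ z) u v = G' (φ z) v u) (w a v : V) :
    eulerLagrange G z w a v = eulerLagrange G' (φ z) (fderiv ℝ φ z w)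
      (fderiv ℝ φ z a + fderiv ℝ (fderiv ℝ φ) z w w) (fderiv ℝ φ z v) := by
  have hs : fderiv ℝ (fderiv ℝ φ) z v w = fderiv ℝ (fderiv ℝ φ) z w v :=
    (hφ.isSymmSndFDerivAt (by
    rw [minSmoothness_of_isRCLikeNormedField]
    change ((2 : ℕ∞) : WithTop ℕ∞) ≤ ((⊤ : ℕ∞) : WithTop ℕ∞)
    exact WithTop.coe_le_coe.2 le_top)).eq v w
  have h0 := h.self_of_nhds a v
  simp only [eulerLagrange, fderiv_pullback hφ hG hG' h, h0, hs, map_add]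
  rw [add_apply, hsymm (fderiv ℝ (fderiv ℝ φ) z w v)]
  ring

end EulerLagrange

/-! ### Christoffel symbols and gradients in coordinates. -/

section Christoffel

theorem contDiffOn_det {V ι : Type*} [NormedAddCommGroup V] [NormedSpace ℝ V] [Fintype ι]
    [DecidableEq ι] {M : V → Matrix ι ι ℝ} {s : Set V}
    (hM : ∀ i j, ContDiffOn ℝ ∞ (fun z => M z i j) s) : ContDiffOn ℝ ∞ (fun z => (M z).det) s := by
  simp only [Matrix.det_apply]
  refine ContDiffOn.sum fun σ _ => ?_
  refine ContDiffOn.const_smul _ ?_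
  exact contDiffOn_prod fun i _ => hM _ _

/-- By Cramer's rule the entries of the inverse are quotients of determinants. -/
theorem contDiffOn_matrix_inv {V ι : Type*} [NormedAddCommGroup V] [NormedSpace ℝ V] [Fintype ι]
    [DecidableEq ι] {M : V → Matrix ι ι ℝ} {s : Set V}
    (hM : ∀ i j, ContDiffOn ℝ ∞ (fun z => M z i j) s) (hu : ∀ z ∈ s, IsUnit (M z)) (i j : ι) :
    ContDiffOn ℝ ∞ (fun z => (M z)⁻¹ i j) s := by
  simp only [Matrix.inv_def, Ring.inverse_eq_inv', Matrix.smul_apply, smul_eq_mul]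
  refine ((contDiffOn_det hM).inv fun z hz => ?_).mul ?_
  · exact ((Matrix.isUnit_iff_isUnit_det _).1 (hu z hz)).ne_zero
  · simp only [Matrix.adjugate_apply]
    refine contDiffOn_det fun k l => ?_
    simp only [Matrix.updateRow_apply]
    split_ifs
    · exact contDiffOn_const
    · exact hM k l

variable {n : ℕ} {N : Type*} [TopologicalSpace N] [ChartedSpace (EuclideanSpace ℝ (Fin n)) N]

local notation "𝔼" => EuclideanSpace ℝ (Fin n)

theorem contDiffOn_comp_chart_symm {e : OpenPartialHomeomorph N 𝔼}
    (he : e ∈ IsManifold.maximalAtlas (𝓡 n) ∞ N) {f : N → ℝ}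
    (hf : ContMDiff (𝓡 n) 𝓘(ℝ, ℝ) ∞ f) : ContDiffOn ℝ ∞ (fun z => f (e.symm z)) e.target := by
  rw [← contMDiffOn_iff_contDiffOn]
  exact hf.comp_contMDiffOn (contMDiffOn_symm_of_mem_maximalAtlas he)

variable [RiemannianBundle (fun p : N => TangentSpace (𝓡 n) p)]

/-- The acceleration of a geodesic at the position `z` with velocity `w`, in a chart. -/
def chartAccel (e : OpenPartialHomeomorph N 𝔼) (z w : 𝔼) : 𝔼 :=
  WithLp.toLp 2 fun k => -∑ i, ∑ j, christoffel e k i j z * w i * w j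

/-- Half of the gradient of `f` in a chart. -/
def chartHalfGrad (e : OpenPartialHomeomorph N 𝔼) (f : N → ℝ) (z : 𝔼) : 𝔼 :=
  WithLp.toLp 2 fun k => (1 / 2 : ℝ) * gradCoord e f k z

theorem sum_coord_smul_single (u : 𝔼) : u = ∑ i, u i • EuclideanSpace.single i (1 : ℝ) := by
  conv_lhs => rw [← (EuclideanSpace.basisFun (Fin n) ℝ).sum_repr u]
  simp

theorem fderiv_eq_sum_partialDeriv (F : 𝔼 → ℝ) (z v : 𝔼) :
    fderiv ℝ F z v = ∑ i, v i * partialDeriv i F z := by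
  conv_lhs => rw [sum_coord_smul_single v]
  simp [partialDeriv]

theorem contDiffOn_partialDeriv {F : 𝔼 → ℝ} {s : Set 𝔼} (hs : IsOpen s)
    (hF : ContDiffOn ℝ ∞ F s) (i : Fin n) : ContDiffOn ℝ ∞ (partialDeriv i F) s :=
  (hF.fderiv_of_isOpen hs (by simp)).clm_apply contDiffOn_const

variable [IsManifold (𝓡 n) ∞ N]

/-- Raising an index with the inverse matrix and lowering it with the metric cancel. Both the
gradient and the Christoffel symbols have this raised form. -/
theorem metricForm_raise {e : OpenPartialHomeomorph N 𝔼}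
    (he : e ∈ IsManifold.maximalAtlas (𝓡 n) ∞ N) {z : 𝔼} (hz : z ∈ e.target) (c : Fin n → ℝ)
    (v : 𝔼) : metricForm e z (WithLp.toLp 2 fun k => ∑ m, (metricCoeff e z)⁻¹ k m * c m) v
      = ∑ j, c j * v j := by
  have hsym : ∀ i j, metricCoeff e z i j = metricCoeff e z j i := fun i j => by
    rw [metricCoeff_eq_tangentInner, metricCoeff_eq_tangentInner, tangentInner_comm]
  have hmul := Matrix.mul_nonsing_inv (metricCoeff e z)
    ((Matrix.isUnit_iff_isUnit_det _).1 (isUnit_metricCoeff he hz))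
  rw [metricForm_apply, Finset.sum_comm]
  refine Finset.sum_congr rfl fun j _ => ?_
  have h1 : ∑ i, metricCoeff e z i j * ∑ m, (metricCoeff e z)⁻¹ i m * c m = c j := by
    have h2 : (metricCoeff e z).mulVec ((metricCoeff e z)⁻¹.mulVec c) j = c j := by
      rw [Matrix.mulVec_mulVec, hmul, Matrix.one_mulVec]
    rw [← h2]
    simp only [Matrix.mulVec, dotProduct]
    exact Finset.sum_congr rfl fun i _ => by rw [hsym i j]
  rw [← h1, Finset.sum_mul]
  exact Finset.sum_congr rfl fun i _ => by simp only; ring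

theorem metricForm_chartHalfGrad {e : OpenPartialHomeomorph N 𝔼}
    (he : e ∈ IsManifold.maximalAtlas (𝓡 n) ∞ N) {z : 𝔼} (hz : z ∈ e.target) (f : N → ℝ) (v : 𝔼) :
    metricForm e z (chartHalfGrad e f z) v
      = (1 / 2 : ℝ) * fderiv ℝ (fun y => f (e.symm y)) z v := by
  have h : chartHalfGrad e f z = WithLp.toLp 2 fun k => ∑ m, (metricCoeff e z)⁻¹ k m *
      ((1 / 2 : ℝ) * partialDeriv m (fun y => f (e.symm y)) z) := by
    simp only [chartHalfGrad, gradCoord, Finset.mul_sum]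
    congr 1
    ext k
    exact Finset.sum_congr rfl fun m _ => by ring
  rw [h, metricForm_raise he hz, fderiv_eq_sum_partialDeriv, Finset.mul_sum]
  exact Finset.sum_congr rfl fun m _ => by ring

variable [IsContMDiffRiemannianBundle (𝓡 n) ∞ (EuclideanSpace ℝ (Fin n))
      (fun p : N => TangentSpace (𝓡 n) p)]

set_option synthInstance.maxHeartbeats 200000 in
theorem fderiv_metricForm {e : OpenPartialHomeomorph N 𝔼}
    (he : e ∈ IsManifold.maximalAtlas (𝓡 n) ∞ N) {z : 𝔼} (hz : z ∈ e.target) (d u v : 𝔼) :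
    fderiv ℝ (metricForm e) z d u v =
      ∑ a, ∑ i, ∑ j, d a * partialDeriv a (fun y => metricCoeff e y i j) z * (u i * v j) := by
  have h1 : fderiv ℝ (metricForm e) z d u v = fderiv ℝ (fun y => metricForm e y u v) z d := by
    have h := ((contDiffOn_metricForm he).contDiffAt (e.open_target.mem_nhds hz)).differentiableAt
      (by simp)
    have h2 := ((h.hasFDerivAt.apply_vector u).apply_vector v).fderiv
    exact (DFunLike.congr_fun h2 d).symm
  rw [h1, fderiv_eq_sum_partialDeriv]
  refine Finset.sum_congr rfl fun a _ => ?_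
  have h3 : ∀ i j, DifferentiableAt ℝ (fun y => metricCoeff e y i j) z := fun i j =>
    ((contDiffOn_metricCoeff he i j).contDiffAt (e.open_target.mem_nhds hz)).differentiableAt
      (by simp)
  have h4 : partialDeriv a (fun y => metricForm e y u v) z =
      ∑ i, ∑ j, partialDeriv a (fun y => metricCoeff e y i j) z * (u i * v j) := by
    simp only [metricForm_apply, partialDeriv]
    rw [fderiv_fun_sum fun i _ => DifferentiableAt.fun_sum fun j _ => (h3 i j).mul_const _,
      sum_apply]
    refine Finset.sum_congr rfl fun i _ => ?_
    rw [fderiv_fun_sum fun j _ => (h3 i j).mul_const _, sum_apply]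
    refine Finset.sum_congr rfl fun j _ => ?_
    rw [fderiv_mul_const (h3 i j), smul_apply, smul_eq_mul, mul_comm]
  rw [h4, Finset.mul_sum]
  refine Finset.sum_congr rfl fun i _ => ?_
  rw [Finset.mul_sum]
  exact Finset.sum_congr rfl fun j _ => by ring

/-- Lowering the index of the coordinate equation removes the inverse matrix and leaves Christoffel
symbols of the first kind. Contracted twice with the velocity, these give the Euler-Lagrange
expression. This carries the coordinate equation over to a form that behaves well under changes of
charts. -/
theorem metricForm_sub_chartAccel {e : OpenPartialHomeomorph N 𝔼}
    (he : e ∈ IsManifold.maximalAtlas (𝓡 n) ∞ N) {z : 𝔼} (hz : z ∈ e.target) (w a v : 𝔼) :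
    metricForm e z (a - chartAccel e z w) v = eulerLagrange (metricForm e) z w a v := by
  set dg : Fin n → Fin n → Fin n → ℝ :=
    fun a i j => partialDeriv a (fun y => metricCoeff e y i j) z with hdg
  have h : -chartAccel e z w = WithLp.toLp 2 fun k => ∑ l, (metricCoeff e z)⁻¹ k l *
      ((1 / 2 : ℝ) * ∑ i, ∑ j, (dg i j l + dg j i l - dg l i j) * w i * w j) := by
    simp only [chartAccel, ← WithLp.toLp_neg]
    congr 1
    ext k
    simp only [Pi.neg_apply, neg_neg, christoffel, Finset.mul_sum, Finset.sum_mul]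
    calc _ = ∑ i, ∑ l, ∑ j, _ := Finset.sum_congr rfl fun i _ => Finset.sum_comm
      _ = ∑ l, ∑ i, ∑ j, _ := Finset.sum_comm
      _ = _ := Finset.sum_congr rfl fun l _ => Finset.sum_congr rfl fun i _ =>
        Finset.sum_congr rfl fun j _ => by simp only [hdg]; ring
  rw [sub_eq_add_neg, map_add, add_apply, h, metricForm_raise he hz, eulerLagrange,
    fderiv_metricForm he hz, fderiv_metricForm he hz]
  change _ + _ = _ + ∑ a, ∑ i, ∑ j, w a * dg a i j * (w i * v j) -
    (1 / 2 : ℝ) * ∑ a, ∑ i, ∑ j, v a * dg a i j * (w i * w j)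
  rw [add_sub_assoc]
  congr 1
  have e1 : ∑ a, ∑ i, ∑ j, w a * dg a i j * (w i * v j)
      = ∑ j, ∑ a, ∑ i, w a * dg a i j * (w i * v j) := by
    calc _ = ∑ a, ∑ j, ∑ i, _ := Finset.sum_congr rfl fun a _ => Finset.sum_comm
      _ = _ := Finset.sum_comm
  have e2 : ∀ j, ∑ a, ∑ i, w a * dg a i j * (w i * v j)
      = ∑ a, ∑ i, w a * dg i a j * (w i * v j) := by
    intro j
    rw [Finset.sum_comm]
    exact Finset.sum_congr rfl fun a _ => Finset.sum_congr rfl fun i _ => by ring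
  rw [e1, Finset.mul_sum, ← Finset.sum_sub_distrib]
  refine Finset.sum_congr rfl fun l _ => ?_
  -- Contraction with w twice symmetrizes, so the single derivative term of the Euler-Lagrange
  -- expression equals the mean of the first two terms of the Christoffel symbol.
  have e3 : ∑ a, ∑ i, w a * dg a i l * (w i * v l) = (1 / 2 : ℝ) *
      (∑ a, ∑ i, w a * dg a i l * (w i * v l) + ∑ a, ∑ i, w a * dg i a l * (w i * v l)) := by
    rw [← e2 l]; ring
  rw [e3, ← mul_sub, mul_assoc, ← Finset.sum_add_distrib, ← Finset.sum_sub_distrib, Finset.sum_mul]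
  congr 1
  refine Finset.sum_congr rfl fun i _ => ?_
  rw [← Finset.sum_add_distrib, ← Finset.sum_sub_distrib, Finset.sum_mul]
  exact Finset.sum_congr rfl fun j _ => by ring

theorem contDiffOn_chartAccel {e : OpenPartialHomeomorph N 𝔼}
    (he : e ∈ IsManifold.maximalAtlas (𝓡 n) ∞ N) :
    ContDiffOn ℝ ∞ (fun p : 𝔼 × 𝔼 => chartAccel e p.1 p.2) (e.target ×ˢ univ) := by
  rw [contDiffOn_piLp]
  intro k
  refine ContDiffOn.neg (ContDiffOn.sum fun i _ => ContDiffOn.sum fun j _ => ?_)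
  have hd : ∀ a i j, ContDiffOn ℝ ∞ (partialDeriv a fun y => metricCoeff e y i j) e.target :=
    fun a i j => contDiffOn_partialDeriv e.open_target (contDiffOn_metricCoeff he i j) a
  have hΓ : ContDiffOn ℝ ∞ (fun z => christoffel e k i j z) e.target := by
    refine contDiffOn_const.mul (ContDiffOn.sum fun l _ => ?_)
    exact (contDiffOn_matrix_inv (contDiffOn_metricCoeff he)
      (fun z hz => isUnit_metricCoeff he hz) k l).mul (((hd i j l).add (hd j i l)).sub (hd l i j))
  have hw : ∀ i, ContDiffOn ℝ ∞ (fun p : 𝔼 × 𝔼 => p.2 i) (e.target ×ˢ univ) := fun i =>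
    ((EuclideanSpace.proj i : 𝔼 →L[ℝ] ℝ).contDiff.comp contDiff_snd).contDiffOn
  exact ((hΓ.comp contDiff_fst.contDiffOn fun p hp => hp.1).mul (hw i)).mul (hw j)

theorem contDiffOn_chartHalfGrad {e : OpenPartialHomeomorph N 𝔼}
    (he : e ∈ IsManifold.maximalAtlas (𝓡 n) ∞ N) {f : N → ℝ}
    (hf : ContMDiff (𝓡 n) 𝓘(ℝ, ℝ) ∞ f) : ContDiffOn ℝ ∞ (chartHalfGrad e f) e.target := by
  rw [contDiffOn_piLp]
  intro k
  refine contDiffOn_const.mul (ContDiffOn.sum fun m _ => ?_)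
  exact (contDiffOn_matrix_inv (contDiffOn_metricCoeff he)
    (fun z hz => isUnit_metricCoeff he hz) k m).mul
    (contDiffOn_partialDeriv e.open_target (contDiffOn_comp_chart_symm he hf) m)

end Christoffel

/-! ### Curves solving the forced geodesic equation -/

theorem contDiffAt_deriv {V : Type*} [NormedAddCommGroup V] [NormedSpace ℝ V] {z : ℝ → V} {t : ℝ}
    (hz : ContDiffAt ℝ ∞ z t) : ContDiffAt ℝ ∞ (deriv z) t :=
  (hz.fderiv_right (m := ∞) (by simp)).clm_apply contDiffAt_const

theorem hasDerivAt_fst_comp {V W : Type*} [NormedAddCommGroup V] [NormedSpace ℝ V]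
    [NormedAddCommGroup W] [NormedSpace ℝ W] {c : ℝ → V × W} {c' : V × W} {t : ℝ}
    (h : HasDerivAt c c' t) : HasDerivAt (fun s => (c s).1) c'.1 t :=
  (ContinuousLinearMap.fst ℝ V W).hasFDerivAt.comp_hasDerivAt t h

theorem hasDerivAt_snd_comp {V W : Type*} [NormedAddCommGroup V] [NormedSpace ℝ V]
    [NormedAddCommGroup W] [NormedSpace ℝ W] {c : ℝ → V × W} {c' : V × W} {t : ℝ}
    (h : HasDerivAt c c' t) : HasDerivAt (fun s => (c s).2) c'.2 t :=
  (ContinuousLinearMap.snd ℝ V W).hasFDerivAt.comp_hasDerivAt t h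

theorem hasDerivAt_clm_comp_apply {V W₁ W₂ : Type*} [NormedAddCommGroup V] [NormedSpace ℝ V]
    [NormedAddCommGroup W₁] [NormedSpace ℝ W₁] [NormedAddCommGroup W₂] [NormedSpace ℝ W₂]
    {G : V → W₁ →L[ℝ] W₂} {z : ℝ → V} {z' : V} {u : ℝ → W₁} {u' : W₁} {t : ℝ}
    (hG : DifferentiableAt ℝ G (z t)) (hz : HasDerivAt z z' t) (hu : HasDerivAt u u' t) :
    HasDerivAt (fun s => G (z s) (u s)) (fderiv ℝ G (z t) z' (u t) + G (z t) u') t :=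
  (hG.hasFDerivAt.comp_hasDerivAt t hz).clm_apply hu

section Curves

variable {n : ℕ} {N : Type*} [TopologicalSpace N] [ChartedSpace (EuclideanSpace ℝ (Fin n)) N]

local notation "𝔼" => EuclideanSpace ℝ (Fin n)

theorem contDiffAt_chart_comp [IsManifold (𝓡 n) ∞ N] {e : OpenPartialHomeomorph N 𝔼}
    (he : e ∈ IsManifold.maximalAtlas (𝓡 n) ∞ N) {x : ℝ → N} {t : ℝ}
    (hx : ContMDiffAt 𝓘(ℝ, ℝ) (𝓡 n) ∞ x t) (ht : x t ∈ e.source) :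
    ContDiffAt ℝ ∞ (fun s => e (x s)) t := by
  rw [← contMDiffAt_iff_contDiffAt]
  exact (contMDiffAt_of_mem_maximalAtlas he ht).comp t hx

theorem velocity_eq_chartLift [IsManifold (𝓡 n) ∞ N] {e : OpenPartialHomeomorph N 𝔼}
    (he : e ∈ IsManifold.maximalAtlas (𝓡 n) ∞ N) {x : ℝ → N} {t : ℝ}
    (hx : ContMDiffAt 𝓘(ℝ, ℝ) (𝓡 n) ∞ x t) (ht : x t ∈ e.source) :
    (velocity (n := n) x t : 𝔼) = chartLift e (e (x t)) (deriv (fun s => e (x s)) t) := by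
  have h1 : HasMFDerivAt 𝓘(ℝ, ℝ) (𝓡 n) (fun s => e (x s)) t
      (ContinuousLinearMap.toSpanSingleton ℝ (deriv (fun s => e (x s)) t)) :=
    ((contDiffAt_chart_comp he hx ht).differentiableAt (by simp)).hasDerivAt.hasFDerivAt.hasMFDerivAt
  have h2 : HasMFDerivAt 𝓘(ℝ, ℝ) (𝓡 n) (e.symm ∘ fun s => e (x s)) t
      ((chartLift e (e (x t))).comp
        (ContinuousLinearMap.toSpanSingleton ℝ (deriv (fun s => e (x s)) t))) :=
    (mdifferentiableAt_chart_symm he (e.map_source ht)).hasMFDerivAt.comp t h1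
  have h3 : HasMFDerivAt 𝓘(ℝ, ℝ) (𝓡 n) x t ((chartLift e (e (x t))).comp
        (ContinuousLinearMap.toSpanSingleton ℝ (deriv (fun s => e (x s)) t))) := by
    have h := h2.congr_of_eventuallyEq (f₁ := x) ?_
    · have hxt : (e.symm ∘ fun s => e (x s)) t = x t := e.left_inv ht
      refine ⟨hx.continuousAt, ?_⟩
      exact h.2
    · filter_upwards [hx.continuousAt.preimage_mem_nhds (e.open_source.mem_nhds ht)] with s hs
      exact (e.left_inv hs).symm
  have h4 := h3.mfderiv
  simp only [velocity, h4]
  change (chartLift e (e (x t))) (ContinuousLinearMap.toSpanSingleton ℝ _ (1 : ℝ)) = _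
  simp

variable [RiemannianBundle (fun p : N => TangentSpace (𝓡 n) p)]

/-- The forced geodesic equation at a time, in a chart. -/
def ChartEqAt (f : N → ℝ) (e : OpenPartialHomeomorph N 𝔼) (a : ℝ) (x : ℝ → N) (t : ℝ) : Prop :=
  deriv (deriv fun s => e (x s)) t =
    chartAccel e (e (x t)) (deriv (fun s => e (x s)) t) + a • chartHalfGrad e f (e (x t))

/-- Smooth solutions of the geodesic equation with forcing term `½ a grad f`. -/
def IsSol (f : N → ℝ) (a : ℝ → ℝ) (x : ℝ → N) (J : Set ℝ) : Prop :=
  ContMDiffOn 𝓘(ℝ, ℝ) (𝓡 n) ∞ x J ∧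
    ∀ t ∈ J, ∀ e ∈ IsManifold.maximalAtlas (𝓡 n) ∞ N, x t ∈ e.source → ChartEqAt f e (a t) x t

/-- Geodesics. -/
def IsGeod (x : ℝ → N) (J : Set ℝ) : Prop :=
  IsSol (n := n) (fun _ => 0) (fun _ => 0) x J

theorem isSol_iff_isGeod {f : N → ℝ} {a : ℝ → ℝ} {x : ℝ → N} {J : Set ℝ}
    (ha : ∀ t ∈ J, a t = 0) : IsSol (n := n) f a x J ↔ IsGeod (n := n) x J := by
  refine and_congr_right fun _ => forall₂_congr fun t ht => ?_
  simp [ChartEqAt, ha t ht]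

theorem IsSol.mono {f : N → ℝ} {a : ℝ → ℝ} {x : ℝ → N} {J J' : Set ℝ}
    (h : IsSol (n := n) f a x J) (hJ : J' ⊆ J) : IsSol (n := n) f a x J' :=
  ⟨h.1.mono hJ, fun t ht => h.2 t (hJ ht)⟩

theorem IsGeod.mono {x : ℝ → N} {J J' : Set ℝ}
    (h : IsGeod (n := n) x J) (hJ : J' ⊆ J) : IsGeod (n := n) x J' :=
  IsSol.mono h hJ

theorem ChartEqAt.congr_of_eventuallyEq {f : N → ℝ} {e : OpenPartialHomeomorph N 𝔼} {a : ℝ}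
    {x y : ℝ → N} {t : ℝ} (h : ChartEqAt f e a x t) (hxy : x =ᶠ[𝓝 t] y) : ChartEqAt f e a y t := by
  have h1 : (fun s => e (x s)) =ᶠ[𝓝 t] fun s => e (y s) := hxy.fun_comp e
  unfold ChartEqAt at *
  rwa [h1.deriv.deriv_eq, h1.deriv_eq, hxy.eq_of_nhds] at h

theorem isSol_of_locally {f : N → ℝ} {a : ℝ → ℝ} {x : ℝ → N} {J : Set ℝ}
    (h : ∀ t ∈ J, ∃ y : ℝ → N, ∃ J' ∈ 𝓝 t, IsSol (n := n) f a y J' ∧ y =ᶠ[𝓝 t] x) :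
    IsSol (n := n) f a x J := by
  refine ⟨fun t ht => ?_, fun t ht e he hte => ?_⟩
  · obtain ⟨y, J', hJ', hy, hyx⟩ := h t ht
    exact ((hy.1.contMDiffAt hJ').congr_of_eventuallyEq hyx.symm).contMDiffWithinAt
  · obtain ⟨y, J', hJ', hy, hyx⟩ := h t ht
    exact (hy.2 t (mem_of_mem_nhds hJ') e he (by rwa [hyx.eq_of_nhds])).congr_of_eventuallyEq hyx

theorem covAccel_eq [IsManifold (𝓡 n) ∞ N] {e : OpenPartialHomeomorph N 𝔼} {x : ℝ → N} {t : ℝ}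
    (hz : ContDiffAt ℝ ∞ (fun s => e (x s)) t) (k : Fin n) :
    covAccel e x k t = (deriv (deriv fun s => e (x s)) t
      - chartAccel e (e (x t)) (deriv (fun s => e (x s)) t)) k := by
  have hcoord : ∀ {z : ℝ → 𝔼} {s : ℝ} (k : Fin n), DifferentiableAt ℝ z s →
      deriv (fun s => z s k) s = deriv z s k := fun {z s} k hz =>
    ((EuclideanSpace.proj k : 𝔼 →L[ℝ] ℝ).hasFDerivAt.comp_hasDerivAt s hz.hasDerivAt).deriv
  have h1 : ∀ k, (deriv fun s => e (x s) k) =ᶠ[𝓝 t] fun s => deriv (fun s => e (x s)) s k := by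
    intro k
    have : ∀ᶠ s in 𝓝 t, ContDiffAt ℝ 1 (fun s => e (x s)) s :=
      (hz.of_le (by simp)).eventually (by simp)
    filter_upwards [this] with s hs using hcoord k (hs.differentiableAt (by simp))
  have h2 : DifferentiableAt ℝ (deriv fun s => e (x s)) t :=
    (contDiffAt_deriv hz).differentiableAt (by simp)
  simp only [covAccel, chartAccel, PiLp.sub_apply, sub_neg_eq_add]
  rw [(h1 k).deriv_eq, hcoord k h2]
  simp only [fun i => (h1 i).eq_of_nhds]

theorem chartEqAt_iff_covAccel [IsManifold (𝓡 n) ∞ N] {f : N → ℝ} {a : ℝ}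
    {e : OpenPartialHomeomorph N 𝔼} {x : ℝ → N} {t : ℝ}
    (hz : ContDiffAt ℝ ∞ (fun s => e (x s)) t) :
    ChartEqAt f e a x t ↔
      ∀ k, covAccel e x k t - (1 / 2 : ℝ) * gradCoord e f k (e (x t)) * a = 0 := by
  simp only [ChartEqAt, covAccel_eq hz, ← sub_eq_zero (a := deriv _ t), PiLp.ext_iff]
  refine forall_congr' fun k => ?_
  simp only [PiLp.sub_apply, PiLp.add_apply, PiLp.smul_apply, smul_eq_mul, PiLp.zero_apply]
  simp only [chartHalfGrad]
  rw [← sub_sub, mul_comm a]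


/-- The phase space vector field of the forced geodesic equation, in a chart. -/
def phaseField (f : N → ℝ) (e : OpenPartialHomeomorph N 𝔼) (a : ℝ) (c : 𝔼 × 𝔼) : 𝔼 × 𝔼 :=
  (c.2, chartAccel e c.1 c.2 + a • chartHalfGrad e f c.1)

theorem hasDerivAt_phase [IsManifold (𝓡 n) ∞ N] {f : N → ℝ} {a : ℝ → ℝ} {x : ℝ → N} {J : Set ℝ} (hJ : IsOpen J)
    (hx : IsSol (n := n) f a x J) {e : OpenPartialHomeomorph N 𝔼}
    (he : e ∈ IsManifold.maximalAtlas (𝓡 n) ∞ N) {t : ℝ} (ht : t ∈ J) (hte : x t ∈ e.source) :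
    HasDerivAt (fun s => (e (x s), deriv (fun r => e (x r)) s))
      (phaseField f e (a t) (e (x t), deriv (fun r => e (x r)) t)) t := by
  have hz := contDiffAt_chart_comp he (hx.1.contMDiffAt (hJ.mem_nhds ht)) hte
  have h2 := ((contDiffAt_deriv hz).differentiableAt (by simp)).hasDerivAt
  rw [hx.2 t ht e he hte] at h2
  exact (hz.differentiableAt (by simp)).hasDerivAt.prodMk h2

variable [IsManifold (𝓡 n) ∞ N]
  [IsContMDiffRiemannianBundle (𝓡 n) ∞ (EuclideanSpace ℝ (Fin n))
      (fun p : N => TangentSpace (𝓡 n) p)]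

/-- The forced geodesic equation does not depend on the chart. -/
theorem ChartEqAt.change_chart {f : N → ℝ} (hf : ContMDiff (𝓡 n) 𝓘(ℝ, ℝ) ∞ f) {a : ℝ} {x : ℝ → N}
    {t : ℝ} (hx : ContMDiffAt 𝓘(ℝ, ℝ) (𝓡 n) ∞ x t) {e e' : OpenPartialHomeomorph N 𝔼}
    (he : e ∈ IsManifold.maximalAtlas (𝓡 n) ∞ N) (he' : e' ∈ IsManifold.maximalAtlas (𝓡 n) ∞ N)
    (ht : x t ∈ e.source) (ht' : x t ∈ e'.source) (h : ChartEqAt f e a x t) :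
    ChartEqAt f e' a x t := by
  set z : ℝ → 𝔼 := fun s => e (x s) with hz_def
  set y : ℝ → 𝔼 := fun s => e' (x s) with hy_def
  set φ : 𝔼 → 𝔼 := e' ∘ e.symm with hφ_def
  have hz := contDiffAt_chart_comp he hx ht
  have hzt : z t ∈ (e.symm.trans e').source := by
    simp [z, e.left_inv ht, ht', e.map_source ht]
  have hopen := (e.symm.trans e').open_source
  have hφ : ContDiffAt ℝ ∞ φ (z t) := (contDiffOn_coordChange he he').contDiffAt (hopen.mem_nhds hzt)
  have hyz : y =ᶠ[𝓝 t] fun s => φ (z s) := by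
    filter_upwards [hx.continuousAt.preimage_mem_nhds (e.open_source.mem_nhds ht)] with s hs
    exact congrArg e' (e.left_inv hs).symm
  have hφzt : φ (z t) = y t := hyz.eq_of_nhds.symm
  have hy1 : deriv y =ᶠ[𝓝 t] fun s => fderiv ℝ φ (z s) (deriv z s) := by
    have h1 : ∀ᶠ s in 𝓝 t, ContDiffAt ℝ 1 z s := (hz.of_le (by simp)).eventually (by simp)
    have h2 : ∀ᶠ s in 𝓝 t, z s ∈ (e.symm.trans e').source :=
      hz.continuousAt.eventually (hopen.mem_nhds hzt)
    refine hyz.deriv.trans ?_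
    filter_upwards [h1, h2] with s hs1 hs2
    have h3 := ((contDiffOn_coordChange he he').contDiffAt (hopen.mem_nhds hs2)).differentiableAt
      (by simp)
    exact (h3.hasFDerivAt.comp_hasDerivAt s (hs1.differentiableAt (by simp)).hasDerivAt).deriv
  have hzd : HasDerivAt z (deriv z t) t := (hz.differentiableAt (by simp)).hasDerivAt
  have hzd2 : HasDerivAt (deriv z) (deriv (deriv z) t) t :=
    ((contDiffAt_deriv hz).differentiableAt (by simp)).hasDerivAt
  have hφ2 : HasFDerivAt (fderiv ℝ φ) (fderiv ℝ (fderiv ℝ φ) (z t)) (z t) :=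
    ((hφ.fderiv_right (m := ∞) (by simp)).differentiableAt (by simp)).hasFDerivAt
  have hy2 : deriv (deriv y) t = fderiv ℝ φ (z t) (deriv (deriv z) t) +
      fderiv ℝ (fderiv ℝ φ) (z t) (deriv z t) (deriv z t) := by
    rw [hy1.deriv_eq]
    have h1 : HasDerivAt (fun s => fderiv ℝ φ (z s)) (fderiv ℝ (fderiv ℝ φ) (z t) (deriv z t)) t :=
      hφ2.comp_hasDerivAt t hzd
    rw [(h1.clm_apply hzd2).deriv, add_comm]
  have hy1t : deriv y t = fderiv ℝ φ (z t) (deriv z t) := hy1.eq_of_nhds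
  have hzT : z t ∈ e.target := e.map_source ht
  have hyT : y t ∈ e'.target := e'.map_source ht'
  -- pullback of the metric
  have hpull : ∀ᶠ p in 𝓝 (z t), ∀ u v, metricForm e p u v =
      metricForm e' (φ p) (fderiv ℝ φ p u) (fderiv ℝ φ p v) := by
    filter_upwards [hopen.mem_nhds hzt] with p hp u v using metricForm_coordChange he he' hp u v
  have hG := ((contDiffOn_metricForm he).contDiffAt (e.open_target.mem_nhds hzT)).differentiableAt
    (by simp)
  have hG' : DifferentiableAt ℝ (metricForm e') (φ (z t)) := by
    rw [hφzt]
    exact ((contDiffOn_metricForm he').contDiffAt (e'.open_target.mem_nhds hyT)).differentiableAt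
      (by simp)
  -- pullback of `f`
  have hfe : HasFDerivAt (fun p => f (e'.symm p)) (fderiv ℝ (fun p => f (e'.symm p)) (φ (z t)))
      (φ (z t)) := by
    rw [hφzt]
    exact (((contDiffOn_comp_chart_symm he' hf).contDiffAt
      (e'.open_target.mem_nhds hyT)).differentiableAt (by simp)).hasFDerivAt
  have hgrad : ∀ v, fderiv ℝ (fun p => f (e.symm p)) (z t) v =
      fderiv ℝ (fun p => f (e'.symm p)) (y t) (fderiv ℝ φ (z t) v) := by
    intro v
    have h1 := hfe.comp (z t) (hφ.differentiableAt (by simp)).hasFDerivAt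
    have h2 : (fun p => f (e.symm p)) =ᶠ[𝓝 (z t)] (fun p => f (e'.symm p)) ∘ φ := by
      filter_upwards [hopen.mem_nhds hzt] with p hp
      have : e.symm p ∈ e'.source := by simpa using hp.2
      simp [φ, e'.left_inv this]
    rw [h2.fderiv_eq, h1.fderiv, hφzt]
    rfl
  -- injectivity, hence surjectivity, of the derivative of the coordinate change
  have hinj : Function.Injective (fderiv ℝ φ (z t)) := by
    intro u v huv
    refine chartLift_injective he hzT ?_
    rw [chartLift_eq_comp he he' hzt]
    change chartLift e' _ (fderiv ℝ φ (z t) u) = chartLift e' _ (fderiv ℝ φ (z t) v)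
    rw [huv]
  have hsurj : Function.Surjective (fderiv ℝ φ (z t)) :=
    (LinearMap.injective_iff_surjective (f := (fderiv ℝ φ (z t)).toLinearMap)).1 hinj
  -- Vectors are compared by testing them with the metric. Every test vector in the chart e' comes
  -- from one in the chart e, and there the pulled back identity reduces to the known equation.
  have key : ∀ v, metricForm e' (y t) (deriv (deriv y) t - chartAccel e' (y t) (deriv y t)) v =
      metricForm e' (y t) (a • chartHalfGrad e' f (y t)) v := by
    intro v'
    obtain ⟨v, rfl⟩ := hsurj v'
    rw [metricForm_sub_chartAccel he' hyT, hy2, hy1t, ← hφzt,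
      ← eulerLagrange_pullback hφ hG hG' hpull (fun u v => metricForm_comm e' _ u v),
      ← metricForm_sub_chartAccel he hzT, hφzt]
    have h' : deriv (deriv z) t - chartAccel e (z t) (deriv z t) = a • chartHalfGrad e f (z t) :=
      sub_eq_of_eq_add' h
    rw [h', map_smul, map_smul, smul_apply, smul_apply, metricForm_chartHalfGrad he hzT,
      metricForm_chartHalfGrad he' hyT, hgrad]
  exact sub_eq_iff_eq_add'.1 (eq_of_metricForm_eq he' hyT key)

/-- A first order solution in one chart satisfies the equation in that chart by construction, and in
all other charts by `ChartEqAt.change_chart`. -/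
theorem isSol_of_phase {f : N → ℝ} (hf : ContMDiff (𝓡 n) 𝓘(ℝ, ℝ) ∞ f) {a : ℝ → ℝ}
    {e : OpenPartialHomeomorph N 𝔼} (he : e ∈ IsManifold.maximalAtlas (𝓡 n) ∞ N) {J : Set ℝ}
    (hJ : IsOpen J) {c : ℝ → 𝔼 × 𝔼} (hc : ContDiffOn ℝ ∞ c J) (hct : ∀ t ∈ J, (c t).1 ∈ e.target)
    (hd : ∀ t ∈ J, HasDerivAt c (phaseField f e (a t) (c t)) t) :
    IsSol (n := n) f a (fun t => e.symm (c t).1) J := by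
  have hsm : ContMDiffOn 𝓘(ℝ, ℝ) (𝓡 n) ∞ (fun t => e.symm (c t).1) J :=
    (contMDiffOn_symm_of_mem_maximalAtlas he).comp
      (contMDiffOn_iff_contDiffOn.2 (contDiff_fst.comp_contDiffOn hc)) hct
  refine ⟨hsm, fun t ht e' he' hte' => ?_⟩
  refine ChartEqAt.change_chart hf (hsm.contMDiffAt (hJ.mem_nhds ht)) he he'
    (e.map_target (hct t ht)) hte' ?_
  have h1 : (fun s => e (e.symm (c s).1)) =ᶠ[𝓝 t] fun s => (c s).1 := by
    filter_upwards [hJ.mem_nhds ht] with s hs using e.right_inv (hct s hs)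
  have h2 : deriv (fun s => (c s).1) =ᶠ[𝓝 t] fun s => (c s).2 := by
    filter_upwards [hJ.mem_nhds ht] with s hs
    exact (hasDerivAt_fst_comp (hd s hs)).deriv
  have h3 : deriv (fun s => (c s).2) t = (phaseField f e (a t) (c t)).2 :=
    (hasDerivAt_snd_comp (hd t ht)).deriv
  unfold ChartEqAt
  rw [(h1.deriv.trans h2).deriv_eq, h3, (h1.deriv.trans h2).eq_of_nhds, h1.eq_of_nhds]
  rfl

theorem contDiffOn_phaseField {f : N → ℝ} (hf : ContMDiff (𝓡 n) 𝓘(ℝ, ℝ) ∞ f)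
    {e : OpenPartialHomeomorph N 𝔼} (he : e ∈ IsManifold.maximalAtlas (𝓡 n) ∞ N) (a : ℝ) :
    ContDiffOn ℝ ∞ (phaseField f e a) (e.target ×ˢ univ) :=
  have h : ContDiffOn ℝ ∞ (fun p : 𝔼 × 𝔼 => chartHalfGrad e f p.1) (e.target ×ˢ univ) :=
    (contDiffOn_chartHalfGrad he hf).comp contDiff_fst.contDiffOn fun _ hp => hp.1
  contDiff_snd.contDiffOn.prodMk ((contDiffOn_chartAccel he).add ((contDiff_const (c := a)).contDiffOn.smul h))

/-- Geodesics have constant speed. -/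
theorem hasDerivAt_speed {x : ℝ → N} {J : Set ℝ} (hJ : IsOpen J) (hx : IsGeod (n := n) x J) {t : ℝ}
    (ht : t ∈ J) :
    HasDerivAt (fun s => tangentInner (x s) (velocity (n := n) x s : 𝔼) (velocity (n := n) x s : 𝔼))
      0 t := by
  set e := chartAt 𝔼 (x t)
  have he : e ∈ IsManifold.maximalAtlas (𝓡 n) ∞ N := IsManifold.chart_mem_maximalAtlas (x t)
  have hte : x t ∈ e.source := mem_chart_source 𝔼 (x t)
  have hxs : ∀ s ∈ J, ContMDiffAt 𝓘(ℝ, ℝ) (𝓡 n) ∞ x s := fun s hs =>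
    hx.1.contMDiffAt (hJ.mem_nhds hs)
  set z : ℝ → 𝔼 := fun s => e (x s) with hz_def
  have hz := contDiffAt_chart_comp he (hxs t ht) hte
  have hzT : z t ∈ e.target := e.map_source hte
  have hloc : (fun s => tangentInner (x s) (velocity (n := n) x s : 𝔼)
      (velocity (n := n) x s : 𝔼)) =ᶠ[𝓝 t] fun s => metricForm e (z s) (deriv z s) (deriv z s) := by
    filter_upwards [hJ.mem_nhds ht,
      (hxs t ht).continuousAt.preimage_mem_nhds (e.open_source.mem_nhds hte)] with s hs hse
    rw [metricForm_eq_tangentInner, velocity_eq_chartLift he (hxs s hs) hse]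
    simp only [z]
    rw [e.left_inv hse]
  have hph := hasDerivAt_phase hJ hx he ht hte
  have hz1 : HasDerivAt z (deriv z t) t := (hz.differentiableAt (by simp)).hasDerivAt
  have hz2 : HasDerivAt (deriv z) (deriv (deriv z) t) t :=
    ((contDiffAt_deriv hz).differentiableAt (by simp)).hasDerivAt
  have hG := ((contDiffOn_metricForm he).contDiffAt (e.open_target.mem_nhds hzT)).differentiableAt
    (by simp)
  have hd := (hasDerivAt_clm_comp_apply hG hz1 hz2).clm_apply hz2
  refine HasDerivAt.congr_of_eventuallyEq ?_ hloc
  refine hd.congr_deriv ?_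
  -- Tested with the velocity itself, the Euler-Lagrange expression is half the time derivative of
  -- the squared speed, and it vanishes along a geodesic.
  have hEL := metricForm_sub_chartAccel he hzT (deriv z t) (deriv (deriv z) t) (deriv z t)
  have heq := hx.2 t ht e he hte
  have h0 : deriv (deriv z) t - chartAccel e (z t) (deriv z t) = 0 := by
    have : deriv (deriv z) t = _ := heq
    rw [this]; simp [z]
  rw [h0, map_zero, zero_apply, eulerLagrange] at hEL
  have hc := metricForm_comm e (z t) (deriv z t) (deriv (deriv z) t)
  rw [add_apply]
  linarith

end Curves

/-! ### Uniqueness of geodesics, gluing, reflection -/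

section Geodesics

variable {n : ℕ} {N : Type*} [TopologicalSpace N] [ChartedSpace (EuclideanSpace ℝ (Fin n)) N]

local notation "𝔼" => EuclideanSpace ℝ (Fin n)

/-- Position and velocity of a curve in a chart. -/
def phase (e : OpenPartialHomeomorph N 𝔼) (x : ℝ → N) (t : ℝ) : 𝔼 × 𝔼 :=
  (e (x t), deriv (fun s => e (x s)) t)

theorem phase_congr {e : OpenPartialHomeomorph N 𝔼} {x y : ℝ → N} {t : ℝ} (h : x =ᶠ[𝓝 t] y) :
    phase e x t = phase e y t := by
  have h1 : (fun s => e (x s)) =ᶠ[𝓝 t] fun s => e (y s) := h.fun_comp e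
  simp only [phase, h1.eq_of_nhds, h1.deriv_eq]

theorem phase_comp_add_const (e : OpenPartialHomeomorph N 𝔼) (x : ℝ → N) (s t : ℝ) :
    phase e (fun r => x (r + s)) t = phase e x (t + s) := by
  simp only [phase]
  rw [deriv_comp_add_const (f := fun r => e (x r))]

theorem contDiffAt_phase [IsManifold (𝓡 n) ∞ N] {e : OpenPartialHomeomorph N 𝔼}
    (he : e ∈ IsManifold.maximalAtlas (𝓡 n) ∞ N) {x : ℝ → N} {t : ℝ}
    (hx : ContMDiffAt 𝓘(ℝ, ℝ) (𝓡 n) ∞ x t) (ht : x t ∈ e.source) :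
    ContDiffAt ℝ ∞ (phase e x) t :=
  (contDiffAt_chart_comp he hx ht).prodMk (contDiffAt_deriv (contDiffAt_chart_comp he hx ht))

variable [RiemannianBundle (fun p : N => TangentSpace (𝓡 n) p)]

theorem IsSol.glue {f : N → ℝ} {a : ℝ → ℝ} {x y : ℝ → N} {J₁ J₂ J : Set ℝ} (hJ₁ : IsOpen J₁)
    (hJ₂ : IsOpen J₂) (hx : IsSol (n := n) f a x J₁) (hy : IsSol (n := n) f a y J₂) {m : ℝ}
    (hm : x =ᶠ[𝓝 m] y) (h₁ : ∀ t ∈ J, t ≤ m → t ∈ J₁) (h₂ : ∀ t ∈ J, m ≤ t → t ∈ J₂) :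
    IsSol (n := n) f a (fun t => if t ≤ m then x t else y t) J := by
  refine isSol_of_locally fun t ht => ?_
  rcases lt_trichotomy t m with h | h | h
  · refine ⟨x, J₁, hJ₁.mem_nhds (h₁ t ht h.le), hx, ?_⟩
    filter_upwards [Iio_mem_nhds h] with s hs
    simp [(show s < m from hs).le]
  · subst h
    refine ⟨x, J₁, hJ₁.mem_nhds (h₁ t ht le_rfl), hx, ?_⟩
    filter_upwards [hm] with s hs
    simp [hs]
  · refine ⟨y, J₂, hJ₂.mem_nhds (h₂ t ht h.le), hy, ?_⟩
    filter_upwards [Ioi_mem_nhds h] with s hs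
    simp [not_le.2 (show m < s from hs)]

theorem chartAccel_neg (e : OpenPartialHomeomorph N 𝔼) (z w : 𝔼) :
    chartAccel e z (-w) = chartAccel e z w := by
  simp [chartAccel]

/-- The acceleration of a geodesic is quadratic in its velocity, so reversing time changes neither
side of the equation. -/
theorem IsGeod.comp_neg {x : ℝ → N} {J : Set ℝ} (h : IsGeod (n := n) x J) :
    IsGeod (n := n) (fun t => x (-t)) (Neg.neg ⁻¹' J) := by
  refine ⟨h.1.comp (contDiff_neg.contMDiff.contMDiffOn) fun t ht => ht, fun t ht e he hte => ?_⟩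
  have h1 := h.2 (-t) ht e he hte
  have h2 : (deriv fun s => e (x (-s))) = fun s => -deriv (fun s => e (x s)) (-s) := by
    ext1 s
    exact deriv_comp_neg (f := fun s => e (x s)) s
  simp only [ChartEqAt, zero_smul, add_zero] at h1 ⊢
  rw [h2, chartAccel_neg, ← h1, deriv.fun_neg, deriv_comp_neg (f := deriv fun s => e (x s)), neg_neg]

theorem IsGeod.comp_add_const {x : ℝ → N} {J : Set ℝ} (h : IsGeod (n := n) x J) (s : ℝ) :
    IsGeod (n := n) (fun t => x (t + s)) ((fun t => t + s) ⁻¹' J) := by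
  refine ⟨h.1.comp ((contDiff_id.add contDiff_const).contMDiff.contMDiffOn) fun t ht => ht,
    fun t ht e he hte => ?_⟩
  have h1 := h.2 (t + s) ht e he hte
  have h2 : (deriv fun r => e (x (r + s))) = fun r => deriv (fun r => e (x r)) (r + s) := by
    ext1 r
    exact deriv_comp_add_const (f := fun s => e (x s)) s r
  simp only [ChartEqAt, zero_smul, add_zero] at h1 ⊢
  rw [h2, ← h1, deriv_comp_add_const (f := deriv fun s => e (x s))]

/-- The geodesic vector field in a chart. -/
def geodField (e : OpenPartialHomeomorph N 𝔼) : 𝔼 × 𝔼 → 𝔼 × 𝔼 := phaseField (fun _ => 0) e 0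

variable [IsManifold (𝓡 n) ∞ N]

theorem IsGeod.hasDerivAt_phase {x : ℝ → N} {J : Set ℝ} (hJ : IsOpen J)
    (hx : IsGeod (n := n) x J) {e : OpenPartialHomeomorph N 𝔼}
    (he : e ∈ IsManifold.maximalAtlas (𝓡 n) ∞ N) {t : ℝ} (ht : t ∈ J) (hte : x t ∈ e.source) :
    HasDerivAt (phase e x) (geodField e (phase e x t)) t :=
  Colombeau.hasDerivAt_phase hJ hx he ht hte

variable [IsContMDiffRiemannianBundle (𝓡 n) ∞ (EuclideanSpace ℝ (Fin n))
      (fun p : N => TangentSpace (𝓡 n) p)]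

theorem contDiffOn_geodField {e : OpenPartialHomeomorph N 𝔼}
    (he : e ∈ IsManifold.maximalAtlas (𝓡 n) ∞ N) :
    ContDiffOn ℝ ∞ (geodField e) (e.target ×ˢ univ) :=
  contDiffOn_phaseField contMDiff_const he 0

theorem IsGeod.eventuallyEq {x y : ℝ → N} {J : Set ℝ} (hJ : IsOpen J)
    (hx : IsGeod (n := n) x J) (hy : IsGeod (n := n) y J) {t : ℝ} (ht : t ∈ J)
    (hxy : x t = y t) {e : OpenPartialHomeomorph N 𝔼}
    (he : e ∈ IsManifold.maximalAtlas (𝓡 n) ∞ N) (hte : x t ∈ e.source)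
    (hph : phase e x t = phase e y t) : x =ᶠ[𝓝 t] y := by
  have hxc := (hx.1.contMDiffAt (hJ.mem_nhds ht)).continuousAt
  have hyc := (hy.1.contMDiffAt (hJ.mem_nhds ht)).continuousAt
  obtain ⟨η, hη, hb⟩ := Metric.mem_nhds_iff.1 (inter_mem (hJ.mem_nhds ht) (inter_mem
    (hxc.preimage_mem_nhds (e.open_source.mem_nhds hte))
    (hyc.preimage_mem_nhds (e.open_source.mem_nhds (hxy ▸ hte)))))
  have key := eqOn_of_solves_ode (e.open_target.prod isOpen_univ) (contDiffOn_geodField he)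
    (f := phase e x) (g := phase e y) (Metric.isPreconnected_ball (x := t) (r := η)) Metric.isOpen_ball
    (fun s hs => ⟨⟨e.map_source (hb hs).2.1, mem_univ _⟩,
      hx.hasDerivAt_phase hJ he (hb hs).1 (hb hs).2.1⟩)
    (fun s hs => ⟨⟨e.map_source (hb hs).2.2, mem_univ _⟩,
      hy.hasDerivAt_phase hJ he (hb hs).1 (hb hs).2.2⟩) (Metric.mem_ball_self hη) hph
  filter_upwards [Metric.ball_mem_nhds t hη] with s hs
  exact e.injOn (hb hs).2.1 (hb hs).2.2 (congrArg Prod.fst (key hs))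

/-- The times at which the germs agree form an open set. At a limit of such times the positions
agree since N is Hausdorff, the velocities in a chart agree by continuity, and local uniqueness
makes the germs agree there too. -/
theorem IsGeod.eqOn [T2Space N] {x y : ℝ → N} {J : Set ℝ} (hJ : IsOpen J) (hJc : IsPreconnected J)
    (hx : IsGeod (n := n) x J) (hy : IsGeod (n := n) y J) {t : ℝ} (ht : t ∈ J)
    (hxy : x =ᶠ[𝓝 t] y) : EqOn x y J := by
  suffices h : J ⊆ {t | x =ᶠ[𝓝 t] y} from fun t ht => (h ht).eq_of_nhds
  refine hJc.subset_of_closure_inter_subset isOpen_setOfPred_eventually_nhds ⟨t, ht, hxy⟩ ?_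
  rintro s ⟨hcl, hs⟩
  have hxs := hx.1.contMDiffAt (hJ.mem_nhds hs)
  have hys := hy.1.contMDiffAt (hJ.mem_nhds hs)
  have hne : (𝓝[{t | x =ᶠ[𝓝 t] y}] s).NeBot := mem_closure_iff_nhdsWithin_neBot.1 hcl
  have heq : x s = y s := by
    refine tendsto_nhds_unique (hxs.continuousAt.mono_left (nhdsWithin_le_nhds (s := {t | x =ᶠ[𝓝 t] y})))
      ((hys.continuousAt.mono_left (nhdsWithin_le_nhds (s := {t | x =ᶠ[𝓝 t] y}))).congr' ?_)
    filter_upwards [self_mem_nhdsWithin] with r hr using (EventuallyEq.eq_of_nhds hr).symm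
  have he : chartAt 𝔼 (x s) ∈ IsManifold.maximalAtlas (𝓡 n) ∞ N :=
    IsManifold.chart_mem_maximalAtlas (x s)
  have hse := mem_chart_source 𝔼 (x s)
  refine hx.eventuallyEq hJ hy hs heq he hse ?_
  refine tendsto_nhds_unique
    ((contDiffAt_phase he hxs hse).continuousAt.mono_left (nhdsWithin_le_nhds (s := {t | x =ᶠ[𝓝 t] y})))
    (((contDiffAt_phase he hys (heq ▸ hse)).continuousAt.mono_left (nhdsWithin_le_nhds (s := {t | x =ᶠ[𝓝 t] y}))).congr' ?_)
  filter_upwards [self_mem_nhdsWithin] with r hr using (phase_congr hr).symm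

theorem IsGeod.eqOn_of_phase [T2Space N] {x y : ℝ → N} {J : Set ℝ} (hJ : IsOpen J)
    (hJc : IsPreconnected J) (hx : IsGeod (n := n) x J) (hy : IsGeod (n := n) y J) {t : ℝ}
    (ht : t ∈ J) {e : OpenPartialHomeomorph N 𝔼} (he : e ∈ IsManifold.maximalAtlas (𝓡 n) ∞ N)
    (hxe : x t ∈ e.source) (hye : y t ∈ e.source) (hph : phase e x t = phase e y t) : EqOn x y J :=
  hx.eqOn hJ hJc hy ht
    (hx.eventuallyEq hJ hy ht (e.injOn hxe hye (congrArg Prod.fst hph)) he hxe hph)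

/-- The geodesic flow in a chart. -/
theorem exists_geodesic_box {e : OpenPartialHomeomorph N 𝔼}
    (he : e ∈ IsManifold.maximalAtlas (𝓡 n) ∞ N) {c : 𝔼 × 𝔼} (hc : c.1 ∈ e.target) :
    ∃ r > 0, ∃ η > 0, ∃ φ : ℝ × (𝔼 × 𝔼) → 𝔼 × 𝔼,
      ContDiffOn ℝ ∞ φ (Ioo (-η) η ×ˢ Metric.ball c r) ∧
      ∀ p ∈ Metric.ball c r, (∀ t ∈ Ioo (-η) η, (φ (t, p)).1 ∈ e.target) ∧
        IsGeod (n := n) (fun t => e.symm (φ (t, p)).1) (Ioo (-η) η) ∧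
        phase e (fun t => e.symm (φ (t, p)).1) 0 = p := by
  obtain ⟨r, hr, η, hη, φ, hφ, hsol⟩ := exists_flowBox (e.open_target.prod isOpen_univ)
    (contDiffOn_geodField he) (c := c) ⟨hc, mem_univ _⟩
  refine ⟨r, hr, η, hη, φ, hφ, fun p hp => ?_⟩
  obtain ⟨h0, h1⟩ := hsol p hp
  have hsm : ContDiffOn ℝ ∞ (fun t => φ (t, p)) (Ioo (-η) η) :=
    hφ.comp (contDiff_id.prodMk contDiff_const).contDiffOn fun t ht => ⟨ht, hp⟩
  refine ⟨fun t ht => (h1 t ht).1.1, isSol_of_phase contMDiff_const he isOpen_Ioo hsm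
    (fun t ht => (h1 t ht).1.1) fun t ht => (h1 t ht).2, ?_⟩
  have hη0 : (0 : ℝ) ∈ Ioo (-η) η := ⟨by linarith, hη⟩
  have h2 : (fun s => e (e.symm (φ (s, p)).1)) =ᶠ[𝓝 0] fun s => (φ (s, p)).1 := by
    filter_upwards [isOpen_Ioo.mem_nhds hη0] with s hs using e.right_inv (h1 s hs).1.1
  simp only [phase]
  rw [h2.eq_of_nhds, h2.deriv_eq, (hasDerivAt_fst_comp (h1 0 hη0).2).deriv, h0]
  rfl

/-- Propagation of smooth dependence of geodesics on parameters, within a chart. -/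
theorem contMDiffOn_geodesic_family_of_box [T2Space N] {P : Type*} [NormedAddCommGroup P]
    [NormedSpace ℝ P] {α : P → ℝ → N} {U : Set P} (hα : ∀ s ∈ U, IsGeod (n := n) (α s) univ)
    {e : OpenPartialHomeomorph N 𝔼} (he : e ∈ IsManifold.maximalAtlas (𝓡 n) ∞ N) {W : Set P}
    (hW : IsOpen W) (hWU : W ⊆ U) {s₀ : P} (hs₀ : s₀ ∈ W) {t₁ : ℝ}
    (hWe : ∀ s ∈ W, α s t₁ ∈ e.source) (hσ : ContDiffOn ℝ ∞ (fun s => phase e (α s) t₁) W)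
    {c : 𝔼 × 𝔼} {r η : ℝ} {φ : ℝ × (𝔼 × 𝔼) → 𝔼 × 𝔼}
    (hφ : ContDiffOn ℝ ∞ φ (Ioo (-η) η ×ˢ Metric.ball c r))
    (hsol : ∀ p ∈ Metric.ball c r, (∀ t ∈ Ioo (-η) η, (φ (t, p)).1 ∈ e.target) ∧
        IsGeod (n := n) (fun t => e.symm (φ (t, p)).1) (Ioo (-η) η) ∧
        phase e (fun t => e.symm (φ (t, p)).1) 0 = p)
    (hc : phase e (α s₀) t₁ ∈ Metric.ball c r) :
    ∃ W', IsOpen W' ∧ s₀ ∈ W' ∧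
      ContMDiffOn 𝓘(ℝ, P × ℝ) (𝓡 n) ∞ (fun q : P × ℝ => α q.1 q.2)
        (W' ×ˢ Ioo (t₁ - η) (t₁ + η)) := by
  have hopen := hσ.continuousOn.isOpen_inter_preimage hW (Metric.isOpen_ball (x := c) (ε := r))
  refine ⟨_, hopen, ⟨hs₀, hc⟩, ?_⟩
  have hmaps : ∀ q ∈ (W ∩ (fun s => phase e (α s) t₁) ⁻¹' Metric.ball c r) ×ˢ
      Ioo (t₁ - η) (t₁ + η),
      (q.2 - t₁, phase e (α q.1) t₁) ∈ Ioo (-η) η ×ˢ Metric.ball c r := by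
    rintro ⟨s, t⟩ ⟨⟨hs, hsb⟩, ht⟩
    simp only [mem_Ioo] at ht
    exact ⟨⟨by simp only; linarith, by simp only; linarith⟩, hsb⟩
  have hsm : ContDiffOn ℝ ∞ (fun q : P × ℝ => (φ (q.2 - t₁, phase e (α q.1) t₁)).1)
      ((W ∩ (fun s => phase e (α s) t₁) ⁻¹' Metric.ball c r) ×ˢ Ioo (t₁ - η) (t₁ + η)) := by
    refine contDiff_fst.comp_contDiffOn (hφ.comp (ContDiffOn.prodMk
      (contDiff_snd.sub contDiff_const).contDiffOn
      (hσ.comp contDiff_fst.contDiffOn fun q hq => hq.1.1)) hmaps)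
  refine ((contMDiffOn_symm_of_mem_maximalAtlas he).comp (contMDiffOn_iff_contDiffOn.2 hsm)
    fun q hq => (hsol _ (hmaps q hq).2).1 _ (hmaps q hq).1).congr ?_
  rintro ⟨s, t⟩ hq
  obtain ⟨⟨hs, hsb⟩, ht⟩ := hq
  have hη : 0 < η := by have := ht.1.trans ht.2; linarith
  obtain ⟨h1, h2, h3⟩ := hsol _ hsb
  have h4 := h2.comp_add_const (-t₁)
  have hset : (fun t => t + -t₁) ⁻¹' Ioo (-η) η = Ioo (t₁ - η) (t₁ + η) := by
    rw [preimage_add_const_Ioo]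
    congr 1 <;> ring
  rw [hset] at h4
  have ht₁ : t₁ ∈ Ioo (t₁ - η) (t₁ + η) := ⟨by linarith, by linarith⟩
  have h0 : (0 : ℝ) ∈ Ioo (-η) η := ⟨by linarith, hη⟩
  refine ((hα s (hWU hs)).mono (subset_univ _)).eqOn_of_phase isOpen_Ioo isPreconnected_Ioo h4 ht₁
    he (hWe s hs) ?_ ?_ ht
  · simp only [add_neg_cancel]
    exact e.map_target (h1 0 h0)
  · rw [phase_comp_add_const e (fun t => e.symm (φ (t, phase e (α s) t₁)).1), add_neg_cancel, h3]

/-- Geodesics depend smoothly on parameters. -/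
theorem contMDiffOn_geodesic_family [T2Space N] {P : Type*} [NormedAddCommGroup P]
    [NormedSpace ℝ P] {α : P → ℝ → N} {U : Set P} (hU : IsOpen U)
    (hα : ∀ s ∈ U, IsGeod (n := n) (α s) univ)
    {e₀ : OpenPartialHomeomorph N 𝔼} (he₀ : e₀ ∈ IsManifold.maximalAtlas (𝓡 n) ∞ N) {t₀ : ℝ}
    (hUe : ∀ s ∈ U, α s t₀ ∈ e₀.source) (hσ : ContDiffOn ℝ ∞ (fun s => phase e₀ (α s) t₀) U) :
    ContMDiffOn 𝓘(ℝ, P × ℝ) (𝓡 n) ∞ (fun q : P × ℝ => α q.1 q.2) (U ×ˢ univ) := by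
  have hall : ∀ s₀ ∈ U, ∀ t : ℝ,
      ∃ O : Set (P × ℝ), IsOpen O ∧ (s₀, t) ∈ O ∧
        ContMDiffOn 𝓘(ℝ, P × ℝ) (𝓡 n) ∞ (fun q : P × ℝ => α q.1 q.2) O := by
    intro s₀ hs₀ t
    refine forall_of_local_propagation (J := univ) isPreconnected_univ isOpen_univ (t₀ := t₀)
      (mem_univ _) (Q := fun t => ∃ O : Set (P × ℝ), IsOpen O ∧ (s₀, t) ∈ O ∧
        ContMDiffOn 𝓘(ℝ, P × ℝ) (𝓡 n) ∞ (fun q : P × ℝ => α q.1 q.2) O) ?_ ?_ t (mem_univ _)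
    · obtain ⟨r, hr, η, hη, φ, hφ, hsol⟩ := exists_geodesic_box he₀
        (c := phase e₀ (α s₀) t₀) (e₀.map_source (hUe s₀ hs₀))
      obtain ⟨W', hW', hs, h⟩ := contMDiffOn_geodesic_family_of_box hα he₀ hU subset_rfl hs₀ hUe hσ
        hφ hsol (Metric.mem_ball_self hr)
      exact ⟨_, hW'.prod isOpen_Ioo, ⟨hs, by constructor <;> simp only <;> linarith⟩, h⟩
    · intro t _
      set e := chartAt 𝔼 (α s₀ t)
      have he : e ∈ IsManifold.maximalAtlas (𝓡 n) ∞ N := IsManifold.chart_mem_maximalAtlas _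
      have hte : α s₀ t ∈ e.source := mem_chart_source 𝔼 _
      obtain ⟨r, hr, η, hη, φ, hφ, hsol⟩ := exists_geodesic_box he
        (c := phase e (α s₀) t) (e.map_source hte)
      have hαs := (hα s₀ hs₀).1.contMDiffAt (x := t) univ_mem
      obtain ⟨κ, hκ, hκb⟩ := Metric.mem_nhds_iff.1 (inter_mem
        ((contDiffAt_phase he hαs hte).continuousAt (Metric.ball_mem_nhds _ hr))
        (hαs.continuousAt.preimage_mem_nhds (e.open_source.mem_nhds hte)))
      refine ⟨min κ (η / 2), lt_min hκ (half_pos hη), fun t₁ _ hd₁ ⟨O, hO, hQO, hQ⟩ t₂ _ hd₂ => ?_⟩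
      have ht₁ := hκb (show t₁ ∈ Metric.ball t κ from lt_of_lt_of_le hd₁ (min_le_left _ _))
      have hev : ∀ᶠ q in 𝓝 (s₀, t₁), q.1 ∈ U ∧ α q.1 q.2 ∈ e.source ∧
          ContDiffAt ℝ ∞ (fun q : P × ℝ => e (α q.1 q.2)) q := by
        have h1 : ∀ᶠ q : P × ℝ in 𝓝 (s₀, t₁), α q.1 q.2 ∈ e.source :=
          (hQ.contMDiffAt (hO.mem_nhds hQO)).continuousAt.preimage_mem_nhds (e.open_source.mem_nhds ht₁.2)
        have h2 : ∀ᶠ q : P × ℝ in 𝓝 (s₀, t₁),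
            ContMDiffAt 𝓘(ℝ, P × ℝ) (𝓡 n) ∞ (fun q : P × ℝ => α q.1 q.2) q := by
          filter_upwards [hO.mem_nhds hQO] with q hq using hQ.contMDiffAt (hO.mem_nhds hq)
        have h3 : ∀ᶠ q : P × ℝ in 𝓝 (s₀, t₁), q.1 ∈ U :=
          continuousAt_fst.preimage_mem_nhds (hU.mem_nhds hs₀)
        filter_upwards [h1, h2, h3] with q hq1 hq2 hq3
        refine ⟨hq3, hq1, ?_⟩
        rw [← contMDiffAt_iff_contDiffAt]
        exact (contMDiffAt_of_mem_maximalAtlas he hq1).comp q hq2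
      obtain ⟨W, hWb, hWo, hsW⟩ := mem_nhds_iff.1
        ((continuous_id.prodMk continuous_const).continuousAt (x := s₀) (f := fun s => (s, t₁))
          |>.preimage_mem_nhds hev)
      have hσ' : ContDiffOn ℝ ∞ (fun s => phase e (α s) t₁) W := by
        intro s hs
        have h1 := (hWb hs).2.2
        have hinc : ContDiffAt ℝ ∞ (fun s : P => (s, t₁)) s := contDiffAt_id.prodMk contDiffAt_const
        -- The velocity at time t₁ is the partial derivative in t of a jointly smooth map, so it
        -- depends smoothly on s. This is why the induction carries joint smoothness near (s₀, t).
        have h2 : ContDiffAt ℝ ∞ (fun s => fderiv ℝ (fun q : P × ℝ => e (α q.1 q.2)) (s, t₁)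
            ((0 : P), (1 : ℝ))) s :=
          ((h1.fderiv_right (m := ∞) (by simp)).comp s hinc).clm_apply contDiffAt_const
        refine ((h1.comp s hinc).prodMk (h2.congr_of_eventuallyEq ?_)).contDiffWithinAt
        filter_upwards [hWo.mem_nhds hs] with s' hs'
        have h3 := (hWb hs').2.2.differentiableAt (by simp)
        have h4 : HasDerivAt (fun t : ℝ => (s', t)) ((0 : P), (1 : ℝ)) t₁ :=
          (hasDerivAt_const _ _).prodMk (hasDerivAt_id _)
        exact (h3.hasFDerivAt.comp_hasDerivAt t₁ h4).deriv
      obtain ⟨W', hW', hs, h⟩ := contMDiffOn_geodesic_family_of_box hα he hWo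
        (fun s hs => (hWb hs).1) hsW (fun s hs => (hWb hs).2.1) hσ' hφ hsol ht₁.1
      refine ⟨_, hW'.prod isOpen_Ioo, ⟨hs, ?_⟩, h⟩
      have h2 := abs_lt.1 (lt_of_lt_of_le hd₂ (min_le_right _ _))
      have h1 := abs_lt.1 (lt_of_lt_of_le hd₁ (min_le_right _ _))
      exact ⟨by linarith [h1.1, h2.1, h1.2, h2.2], by linarith [h1.1, h2.1, h1.2, h2.2]⟩
  rintro ⟨s, t⟩ ⟨hs, -⟩
  obtain ⟨O, hO, hQO, hQ⟩ := hall s hs t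
  exact (hQ.contMDiffAt (hO.mem_nhds hQO)).contMDiffWithinAt

end Geodesics

/-! ### Geodesic completeness -/

section LowerBound

variable {n : ℕ} {N : Type*} [TopologicalSpace N] [ChartedSpace (EuclideanSpace ℝ (Fin n)) N]
  [RiemannianBundle (fun p : N => TangentSpace (𝓡 n) p)] [IsManifold (𝓡 n) ∞ N]
  [IsContMDiffRiemannianBundle (𝓡 n) ∞ (EuclideanSpace ℝ (Fin n))
      (fun p : N => TangentSpace (𝓡 n) p)]

local notation "𝔼" => EuclideanSpace ℝ (Fin n)

-- The form at z₀ is bounded below on the compact unit sphere by 2c, and moving to a nearby z costs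
-- at most c in operator norm. The bound turns control of the Riemannian speed into control of
-- coordinate velocities.
set_option synthInstance.maxHeartbeats 200000 in
theorem exists_metricForm_lower_bound {e : OpenPartialHomeomorph N 𝔼}
    (he : e ∈ IsManifold.maximalAtlas (𝓡 n) ∞ N) {z₀ : 𝔼} (hz₀ : z₀ ∈ e.target) :
    ∃ c > 0, ∀ᶠ z in 𝓝 z₀, ∀ w, c * ‖w‖ ^ 2 ≤ metricForm e z w w := by
  have h1 : ∃ c > 0, ∀ w, ‖w‖ = 1 → 2 * c ≤ metricForm e z₀ w w := by
    -- In dimension 0 the unit sphere is empty and any constant works.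
    by_cases hne : (Metric.sphere (0 : 𝔼) 1).Nonempty
    · have hcont : Continuous fun w => metricForm e z₀ w w :=
        (metricForm e z₀).continuous.clm_apply continuous_id
      obtain ⟨w₀, hw₀, hmin⟩ := (isCompact_sphere (0 : 𝔼) 1).exists_isMinOn hne hcont.continuousOn
      have hpos : 0 < metricForm e z₀ w₀ w₀ :=
        metricForm_pos he hz₀ (by rintro rfl; simp at hw₀)
      refine ⟨metricForm e z₀ w₀ w₀ / 2, by positivity, fun w hw => ?_⟩
      have : metricForm e z₀ w₀ w₀ ≤ metricForm e z₀ w w := hmin (by simpa using hw)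
      linarith
    · exact ⟨1, one_pos, fun w hw => (hne ⟨w, by simpa using hw⟩).elim⟩
  obtain ⟨c, hc, h1⟩ := h1
  refine ⟨c, hc, ?_⟩
  have h2 := ((contDiffOn_metricForm he).continuousOn.continuousAt (e.open_target.mem_nhds hz₀))
  filter_upwards [Metric.tendsto_nhds.1 h2 c hc] with z hz w
  have h3 : 2 * c * ‖w‖ ^ 2 ≤ metricForm e z₀ w w := by
    by_cases hw : w = 0
    · simp [hw]
    · have hn : ‖w‖ ≠ 0 := norm_ne_zero_iff.2 hw
      have h4 := h1 (‖w‖⁻¹ • w) (by rw [norm_smul, norm_inv, norm_norm, inv_mul_cancel₀ hn])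
      simp only [map_smul, smul_apply, smul_eq_mul] at h4
      have h5 : metricForm e z₀ w w = ‖w‖ ^ 2 * (‖w‖⁻¹ * (‖w‖⁻¹ * metricForm e z₀ w w)) := by
        field_simp
      rw [h5, mul_comm]
      gcongr
  have h6 : |(metricForm e z - metricForm e z₀) w w| ≤ c * ‖w‖ ^ 2 := by
    refine ((metricForm e z - metricForm e z₀).le_opNorm₂ w w).trans ?_
    have hz' : ‖metricForm e z - metricForm e z₀‖ ≤ c :=
      le_of_eq_of_le (dist_eq_norm (metricForm e z) (metricForm e z₀)).symm hz.le
    rw [mul_assoc, ← sq]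
    gcongr
  have h7 : (metricForm e z - metricForm e z₀) w w = metricForm e z w w - metricForm e z₀ w w := rfl
  have h8 := (abs_le.1 h6).1
  linarith

end LowerBound

section Complete

variable {n : ℕ} {N : Type*} [MetricSpace N] [ChartedSpace (EuclideanSpace ℝ (Fin n)) N]
  [RiemannianBundle (fun p : N => TangentSpace (𝓡 n) p)] [IsManifold (𝓡 n) ∞ N]
  [IsContMDiffRiemannianBundle (𝓡 n) ∞ (EuclideanSpace ℝ (Fin n))
      (fun p : N => TangentSpace (𝓡 n) p)]

local notation "𝔼" => EuclideanSpace ℝ (Fin n)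

theorem IsGeod.exists_speed {x : ℝ → N} {a b : ℝ} (hx : IsGeod (n := n) x (Ioo a b)) :
    ∃ V, 0 ≤ V ∧ ∀ t ∈ Ioo a b,
      tangentInner (x t) (velocity (n := n) x t : 𝔼) (velocity (n := n) x t : 𝔼) = V ^ 2 := by
  by_cases hab : a < b
  · have hm : (a + b) / 2 ∈ Ioo a b := ⟨by linarith, by linarith⟩
    set V2 := tangentInner (x ((a + b) / 2)) (velocity (n := n) x ((a + b) / 2) : 𝔼)
      (velocity (n := n) x ((a + b) / 2) : 𝔼) with hV2
    have hnn : 0 ≤ V2 := by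
      by_cases h0 : (velocity (n := n) x ((a + b) / 2) : 𝔼) = 0
      · rw [hV2, h0]
        have := tangentInner_smul_left (x ((a + b) / 2)) 0 (0 : 𝔼) 0
        simp at this
        exact this.ge
      · exact (tangentInner_self_pos _ h0).le
    refine ⟨√V2, Real.sqrt_nonneg _, fun t ht => ?_⟩
    rw [Real.sq_sqrt hnn]
    exact isOpen_Ioo.is_const_of_deriv_eq_zero isPreconnected_Ioo
      (fun s hs => (hasDerivAt_speed isOpen_Ioo hx hs).differentiableAt.differentiableWithinAt)
      (fun s hs => (hasDerivAt_speed isOpen_Ioo hx hs).deriv) ht hm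
  · exact ⟨0, le_rfl, fun t ht => (hab (ht.1.trans ht.2)).elim⟩

/-- The distance of N is the infimum of the lengths of curves, and the arc of x itself has length V
(t - s). -/
theorem dist_le_of_speed [IsRiemannianManifold (𝓡 n) N] {x : ℝ → N} {J : Set ℝ}
    (hx : ContMDiffOn 𝓘(ℝ, ℝ) (𝓡 n) ∞ x J) {V : ℝ} (hV : 0 ≤ V)
    (h : ∀ t ∈ J, tangentInner (x t) (velocity (n := n) x t : 𝔼) (velocity (n := n) x t : 𝔼) = V ^ 2)
    {s t : ℝ} (hst : s ≤ t) (hJ : Icc s t ⊆ J) : dist (x s) (x t) ≤ V * (t - s) := by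
  have h1 : edist (x s) (x t) ≤ ENNReal.ofReal (V * (t - s)) := by
    rw [IsRiemannianManifold.out (I := 𝓡 n) (x s) (x t)]
    refine (Manifold.riemannianEDist_le_pathELength (((hx.mono hJ).of_le (by simp))) rfl rfl
      hst).trans ?_
    rw [Manifold.pathELength]
    have h2 : ∀ r ∈ Icc s t, ‖(mfderiv 𝓘(ℝ, ℝ) (𝓡 n) x r (1 : ℝ) : TangentSpace (𝓡 n) (x r))‖ₑ
        ≤ ENNReal.ofReal V := by
      intro r hr
      rw [← ofReal_norm]
      refine ENNReal.ofReal_le_ofReal ?_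
      have h3 := h r (hJ hr)
      refine le_of_eq ((sq_eq_sq₀ (norm_nonneg _) hV).1 ?_)
      rw [← h3]
      exact (real_inner_self_eq_norm_sq (velocity (n := n) x r)).symm
    refine (setLIntegral_mono' measurableSet_Icc h2).trans ?_
    rw [setLIntegral_const, Real.volume_Icc, ← ENNReal.ofReal_mul hV]
  rw [edist_dist] at h1
  exact (ENNReal.ofReal_le_ofReal_iff (mul_nonneg hV (by linarith))).1 h1

/-- A geodesic of a complete manifold can be extended beyond the end of a bounded interval. -/
theorem IsGeod.exists_extension [IsRiemannianManifold (𝓡 n) N] [CompleteSpace N] {x : ℝ → N}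
    {a b : ℝ} (hab : a < b) (hx : IsGeod (n := n) x (Ioo a b)) :
    ∃ b' > b, ∃ y, IsGeod (n := n) y (Ioo a b') ∧ EqOn x y (Ioo a b) := by
  obtain ⟨V, hV, hspeed⟩ := hx.exists_speed
  have hdist : ∀ s ∈ Ioo a b, ∀ t ∈ Ioo a b, dist (x s) (x t) ≤ V * |t - s| := by
    intro s hs t ht
    rcases le_total s t with h | h
    · rw [abs_of_nonneg (by linarith)]
      exact dist_le_of_speed hx.1 hV hspeed h fun r hr => ⟨hs.1.trans_le hr.1, hr.2.trans_lt ht.2⟩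
    · rw [abs_of_nonpos (by linarith), dist_comm, neg_sub]
      exact dist_le_of_speed hx.1 hV hspeed h fun r hr => ⟨ht.1.trans_le hr.1, hr.2.trans_lt hs.2⟩
  -- a sequence of times converging to `b`
  obtain ⟨u, -, huI, hulim⟩ := exists_seq_strictMono_tendsto' hab
  have hcau : CauchySeq fun k => x (u k) := by
    rw [Metric.cauchySeq_iff]
    intro ε hε
    -- The denominator V + 1 covers geodesics of speed V = 0.
    obtain ⟨K, hK⟩ := Metric.cauchySeq_iff.1 hulim.cauchySeq (ε / (V + 1)) (by positivity)
    refine ⟨K, fun k hk l hl => (hdist _ (huI k) _ (huI l)).trans_lt ?_⟩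
    have h1 := hK l hl k hk
    rw [Real.dist_eq, lt_div_iff₀ (by positivity)] at h1
    nlinarith [abs_nonneg (u l - u k)]
  obtain ⟨p, hp⟩ := cauchySeq_tendsto_of_complete hcau
  set e := chartAt 𝔼 p
  have he : e ∈ IsManifold.maximalAtlas (𝓡 n) ∞ N := IsManifold.chart_mem_maximalAtlas p
  have hpe : p ∈ e.source := mem_chart_source 𝔼 p
  obtain ⟨c, hc, hlow⟩ := exists_metricForm_lower_bound he (e.map_source hpe)
  have hz : Tendsto (fun k => e (x (u k))) atTop (𝓝 (e p)) :=
    (e.continuousAt hpe).tendsto.comp hp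
  have hsrc : ∀ᶠ k in atTop, x (u k) ∈ e.source := hp.eventually (e.open_source.mem_nhds hpe)
  have hw : ∀ᶠ k in atTop, deriv (fun s => e (x s)) (u k) ∈ Metric.closedBall (0 : 𝔼) (V / √c) := by
    filter_upwards [hsrc, hz.eventually hlow] with k hk1 hk2
    have h1 := hk2 (deriv (fun s => e (x s)) (u k))
    have h2 := hspeed (u k) (huI k)
    rw [velocity_eq_chartLift he (hx.1.contMDiffAt (isOpen_Ioo.mem_nhds (huI k))) hk1] at h2
    rw [metricForm_eq_tangentInner, e.left_inv hk1, h2] at h1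
    rw [mem_closedBall_zero_iff, le_div_iff₀ (by positivity)]
    refine abs_le_of_sq_le_sq' ?_ hV |>.2
    rw [mul_pow, Real.sq_sqrt hc.le]
    linarith
  -- Only a subsequence of the velocities needs to converge. The flow box around the limit (e p, w)
  -- has a uniform lifetime η, so a geodesic entering it at a time later than b - η survives beyond
  -- b.
  obtain ⟨w, -, hclus⟩ := (isCompact_closedBall (0 : 𝔼) (V / √c)).exists_mapClusterPt
    (f := atTop) (u := fun k => deriv (fun s => e (x s)) (u k)) (by simpa using hw)
  obtain ⟨ψ, hψ, hψw⟩ := hclus.tendsto_subseq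
  obtain ⟨r, hr, η, hη, φ, -, hsol⟩ := exists_geodesic_box he (c := (e p, w)) (e.map_source hpe)
  have hph : Tendsto (fun k => phase e x (u (ψ k))) atTop (𝓝 (e p, w)) :=
    (hz.comp hψ.tendsto_atTop).prodMk_nhds hψw
  obtain ⟨k, hk1, hk2, hk3⟩ := ((hph.eventually (Metric.ball_mem_nhds _ hr)).and
    ((hψ.tendsto_atTop.eventually hsrc).and ((hulim.comp hψ.tendsto_atTop).eventually
      (lt_mem_nhds (show b - η < b by linarith))))).exists
  set m := u (ψ k) with hm
  simp only [Function.comp] at hk3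
  obtain ⟨h1, h2, h3⟩ := hsol _ hk1
  have hmI : m ∈ Ioo a b := huI _
  have h4 := h2.comp_add_const (-m)
  have hset : (fun t => t + -m) ⁻¹' Ioo (-η) η = Ioo (m - η) (m + η) := by
    rw [preimage_add_const_Ioo]
    congr 1 <;> ring
  rw [hset] at h4
  set y : ℝ → N := fun t => e.symm (φ (t + -m, phase e x m)).1
  have hI : Ioo (max a (m - η)) b ⊆ Ioo (m - η) (m + η) := fun t ht =>
    ⟨(le_max_right _ _).trans_lt ht.1, by have := ht.2; linarith⟩
  have hI' : Ioo (max a (m - η)) b ⊆ Ioo a b := Ioo_subset_Ioo_left (le_max_left _ _)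
  have hmI' : m ∈ Ioo (max a (m - η)) b := ⟨max_lt hmI.1 (by linarith), hmI.2⟩
  have hxy : EqOn x y (Ioo (max a (m - η)) b) := by
    refine (hx.mono hI').eqOn_of_phase isOpen_Ioo isPreconnected_Ioo (h4.mono hI) hmI' he hk2 ?_ ?_
    · simp only [y, add_neg_cancel]
      exact e.map_target (h1 0 ⟨by linarith, hη⟩)
    · simp only [y]
      rw [phase_comp_add_const e (fun t => e.symm (φ (t, phase e x m)).1), add_neg_cancel, h3]
  refine ⟨m + η, by linarith, fun t => if t ≤ m then x t else y t, ?_, ?_⟩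
  · exact IsSol.glue isOpen_Ioo isOpen_Ioo hx h4 (hxy.eventuallyEq_of_mem (isOpen_Ioo.mem_nhds hmI'))
      (fun t ht htm => ⟨ht.1, htm.trans_lt hmI.2⟩) fun t ht htm => ⟨by linarith, ht.2⟩
  · intro t ht
    simp only
    split_ifs with h
    · rfl
    · exact hxy ⟨max_lt ht.1 (by linarith), ht.2⟩

/-- A geodesic of a complete manifold can be extended to all later times. -/
theorem IsGeod.exists_forward [IsRiemannianManifold (𝓡 n) N] [CompleteSpace N] {x : ℝ → N}
    {a b : ℝ} (hab : a < b) (hx : IsGeod (n := n) x (Ioo a b)) :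
    ∃ y, IsGeod (n := n) y (Ioi a) ∧ EqOn x y (Ioo a b) := by
  set S : Set ℝ := {b' | b ≤ b' ∧ ∃ y, IsGeod (n := n) y (Ioo a b') ∧ EqOn x y (Ioo a b)} with hS
  have hbS : b ∈ S := ⟨le_rfl, x, hx, fun _ _ => rfl⟩
  have : Nonempty N := ⟨x 0⟩
  choose! Y hY using fun b' (h : b' ∈ S) => h.2
  have hcomp : ∀ b₁ ∈ S, ∀ b₂ ∈ S, EqOn (Y b₁) (Y b₂) (Ioo a (min b₁ b₂)) := by
    intro b₁ h₁ b₂ h₂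
    have hm : (a + b) / 2 ∈ Ioo a b := ⟨by linarith, by linarith⟩
    refine ((hY b₁ h₁).1.mono (Ioo_subset_Ioo_right (min_le_left _ _))).eqOn isOpen_Ioo
      isPreconnected_Ioo ((hY b₂ h₂).1.mono (Ioo_subset_Ioo_right (min_le_right _ _)))
      (t := (a + b) / 2) ⟨hm.1, hm.2.trans_le (le_min h₁.1 h₂.1)⟩ ?_
    filter_upwards [isOpen_Ioo.mem_nhds hm] with t ht
    rw [← (hY b₁ h₁).2 ht, (hY b₂ h₂).2 ht]
  -- Extensions to different end times agree on their common domain, so choosing one of them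
  -- separately at each time still gives a geodesic.
  have hglue : ∀ J : Set ℝ, (∀ t ∈ J, a < t ∧ ∃ b' ∈ S, t < b') →
      ∃ y, IsGeod (n := n) y J ∧ ∀ t ∈ J, t ∈ Ioo a b → x t = y t := by
    intro J hJ
    choose! β hβ using fun t (ht : t ∈ J) => (hJ t ht).2
    choose! β' hβ' using fun t (ht : a < t ∧ ∃ b' ∈ S, t < b') => ht.2
    refine ⟨fun t => Y (β' t) t, isSol_of_locally fun t ht => ?_, fun t ht htb => ?_⟩
    · refine ⟨Y (β t), Ioo a (β t), Ioo_mem_nhds (hJ t ht).1 (hβ t ht).2, (hY _ (hβ t ht).1).1, ?_⟩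
      filter_upwards [Ioo_mem_nhds (hJ t ht).1 (hβ t ht).2] with s hs
      have h1 := hβ' s ⟨hs.1, β t, (hβ t ht).1, hs.2⟩
      exact hcomp _ (hβ t ht).1 _ h1.1 ⟨hs.1, lt_min hs.2 h1.2⟩
    · exact (hY _ (hβ' t (hJ t ht)).1).2 htb
  have hunb : ¬ BddAbove S := by
    intro hbdd
    have hsup : b ≤ sSup S := le_csSup hbdd hbS
    -- If the end times were bounded, the glued geodesic would live up to their supremum and could
    -- be extended past it.
    obtain ⟨y, hy, hxy⟩ := hglue (Ioo a (sSup S)) fun t ht =>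
      ⟨ht.1, (lt_csSup_iff hbdd ⟨b, hbS⟩).1 ht.2⟩
    obtain ⟨b', hb', y', hy', hyy'⟩ := hy.exists_extension (hab.trans_le hsup)
    have : b' ∈ S := ⟨hsup.trans hb'.le, y', hy', fun t ht => by
      rw [hxy t ⟨ht.1, ht.2.trans_le hsup⟩ ht, hyy' ⟨ht.1, ht.2.trans_le hsup⟩]⟩
    exact absurd (le_csSup hbdd this) (not_le.2 hb')
  obtain ⟨y, hy, hxy⟩ := hglue (Ioi a) fun t ht => ⟨ht, by
    rw [bddAbove_def] at hunb
    push Not at hunb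
    obtain ⟨b', h1, h2⟩ := hunb t
    exact ⟨b', h1, h2⟩⟩
  exact ⟨y, hy, fun t ht => hxy t ht.1 ht⟩

/-- Hopf–Rinow: geodesics of a complete manifold with arbitrary initial data exist for all times. -/
theorem exists_geodesic [IsRiemannianManifold (𝓡 n) N] [CompleteSpace N]
    {e : OpenPartialHomeomorph N 𝔼} (he : e ∈ IsManifold.maximalAtlas (𝓡 n) ∞ N) {c : 𝔼 × 𝔼}
    (hc : c.1 ∈ e.target) (t₀ : ℝ) :
    ∃ x : ℝ → N, IsGeod (n := n) x univ ∧ x t₀ ∈ e.source ∧ phase e x t₀ = c := by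
  suffices h : ∃ x : ℝ → N, IsGeod (n := n) x univ ∧ x 0 ∈ e.source ∧ phase e x 0 = c by
    obtain ⟨x, h1, h2, h3⟩ := h
    refine ⟨fun t => x (t + -t₀), h1.comp_add_const (-t₀), by simpa using h2, ?_⟩
    rw [phase_comp_add_const, add_neg_cancel, h3]
  obtain ⟨r, hr, η, hη, φ, -, hsol⟩ := exists_geodesic_box he hc
  obtain ⟨h1, h2, h3⟩ := hsol c (Metric.mem_ball_self hr)
  set x : ℝ → N := fun t => e.symm (φ (t, c)).1
  have hη0 : (0 : ℝ) ∈ Ioo (-η) η := ⟨by linarith, hη⟩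
  obtain ⟨y₁, hy₁, hxy₁⟩ := h2.exists_forward (by linarith)
  -- Extension to the past is extension to the future of the reflected geodesic.
  have h2' := h2.comp_neg
  have hneg : Neg.neg ⁻¹' Ioo (-η) η = Ioo (-η) η := by ext t; simp [and_comm]
  rw [hneg] at h2'
  obtain ⟨y₂, hy₂, hxy₂⟩ := h2'.exists_forward (by linarith)
  have hy₂' := hy₂.comp_neg
  have hneg₂ : Neg.neg ⁻¹' Ioi (-η) = Iio η := by ext t; simp
  rw [hneg₂] at hy₂'
  have e₁ : x =ᶠ[𝓝 0] y₁ := hxy₁.eventuallyEq_of_mem (isOpen_Ioo.mem_nhds hη0)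
  have e₂ : x =ᶠ[𝓝 0] fun t => y₂ (-t) := by
    filter_upwards [isOpen_Ioo.mem_nhds hη0] with t ht
    have := hxy₂ (x := -t) (by simpa using ⟨ht.2, neg_lt.1 ht.1⟩)
    simpa using this
  have e₃ : (fun t => if t ≤ 0 then y₂ (-t) else y₁ t) =ᶠ[𝓝 0] x := by
    filter_upwards [e₁, e₂] with t h₁ h₂
    split_ifs
    exacts [h₂.symm, h₁.symm]
  refine ⟨fun t => if t ≤ 0 then y₂ (-t) else y₁ t, ?_, ?_, ?_⟩
  · exact IsSol.glue isOpen_Iio isOpen_Ioi hy₂' hy₁ (e₂.symm.trans e₁)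
      (fun t _ ht => lt_of_le_of_lt ht hη) fun t _ ht => lt_of_lt_of_le (by linarith) ht
  · refine (congrArg (· ∈ e.source) e₃.eq_of_nhds).mpr ?_
    exact e.map_target (h1 0 hη0)
  · rw [phase_congr e₃, h3]

end Complete

/-! ### The reference net of curves -/

/-- The increment of u is compared with the primitive of the bound on u'. Only the L¹ norm of d
enters, which stays bounded for delta nets while the supremum does not. -/
theorem norm_sub_le_of_forced {V : Type*} [NormedAddCommGroup V] [NormedSpace ℝ V]
    {u u' : ℝ → V} {d : ℝ → ℝ} (hd : Continuous d) {M₀ M₁ : ℝ} {s t : ℝ} (hst : s ≤ t)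
    (hu : ∀ r ∈ Icc s t, HasDerivAt u (u' r) r)
    (hb : ∀ r ∈ Icc s t, ‖u' r‖ ≤ M₀ + M₁ * |d r|) :
    ‖u t - u s‖ ≤ M₀ * (t - s) + M₁ * ∫ r in s..t, |d r| := by
  have hB : ∀ x, HasDerivAt (fun t => M₀ * (t - s) + M₁ * ∫ r in s..t, |d r|)
      (M₀ + M₁ * |d x|) x := by
    intro x
    have h1 := (intervalIntegral.integral_hasDerivAt_right
      (hd.abs.intervalIntegrable s x) (hd.abs.stronglyMeasurableAtFilter _ _)
      hd.abs.continuousAt).const_mul M₁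
    exact ((((hasDerivAt_id x).sub_const s).const_mul M₀).add h1).congr_deriv (by simp)
  refine image_norm_le_of_norm_deriv_right_le_deriv_boundary' (f := fun r => u r - u s)
    (f' := u') (a := s) (b := t) (B' := fun x => M₀ + M₁ * |d x|)
    (fun r hr => ((hu r hr).sub_const (u s)).continuousAt.continuousWithinAt)
    (fun r hr => ((hu r ⟨hr.1, hr.2.le⟩).sub_const (u s)).hasDerivWithinAt) (by simp)
    (fun r _ => (hB r).continuousAt.continuousWithinAt) (fun r _ => (hB r).hasDerivWithinAt)
    (fun r hr => hb r ⟨hr.1, hr.2.le⟩) ⟨hst, le_rfl⟩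

theorem exists_cutoff {V : Type*} [NormedAddCommGroup V] [NormedSpace ℝ V] [FiniteDimensional ℝ V]
    {Ω K : Set V} (hΩ : IsOpen Ω) (hK : IsCompact K) (hKΩ : K ⊆ Ω) :
    ∃ χ : V → ℝ, ContDiff ℝ ∞ χ ∧ HasCompactSupport χ ∧ tsupport χ ⊆ Ω ∧ ∀ x ∈ K, χ x = 1 := by
  have : ProperSpace V := FiniteDimensional.proper_real V
  obtain ⟨L, hL, hKL, hLΩ⟩ := exists_compact_between hK hΩ hKΩ
  obtain ⟨χ, h1, h2, -⟩ := exists_contMDiffMap_one_nhds_of_subset_interior (n := ⊤) 𝓘(ℝ, V)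
    hK.isClosed hKL
  have hs : tsupport χ ⊆ L := closure_minimal
    (fun x hx => by_contra fun hxL => hx (h2 x hxL)) hL.isClosed
  exact ⟨χ, χ.contMDiff.contDiff, HasCompactSupport.intro hL h2, hs.trans hLΩ,
    fun x hx => h1.self_of_nhdsSet x hx⟩

theorem exists_compactSupport_extension {V W : Type*} [NormedAddCommGroup V] [NormedSpace ℝ V]
    [FiniteDimensional ℝ V] [NormedAddCommGroup W] [NormedSpace ℝ W] {F : V → W} {Ω K : Set V}
    (hΩ : IsOpen Ω) (hF : ContDiffOn ℝ ∞ F Ω) (hK : IsCompact K) (hKΩ : K ⊆ Ω) :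
    ∃ G : V → W, ContDiff ℝ ∞ G ∧ HasCompactSupport G ∧ EqOn G F K := by
  obtain ⟨χ, hχ, hχc, hχs, hχ1⟩ := exists_cutoff hΩ hK hKΩ
  refine ⟨fun x => χ x • F x, ?_, hχc.smul_right, fun x hx => by simp [hχ1 x hx]⟩
  rw [contDiff_iff_contDiffAt]
  intro x
  by_cases hx : x ∈ tsupport χ
  · exact hχ.contDiffAt.smul (hF.contDiffAt (hΩ.mem_nhds (hχs hx)))
  · refine (contDiffAt_const (c := (0 : W))).congr_of_eventuallyEq ?_
    filter_upwards [notMem_tsupport_iff_eventuallyEq.1 hx] with y hy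
    simp [hy]

section ForcedNet

variable {n : ℕ} {N : Type*} [MetricSpace N] [ChartedSpace (EuclideanSpace ℝ (Fin n)) N]
  [RiemannianBundle (fun p : N => TangentSpace (𝓡 n) p)] [IsManifold (𝓡 n) ∞ N]
  [IsContMDiffRiemannianBundle (𝓡 n) ∞ (EuclideanSpace ℝ (Fin n))
      (fun p : N => TangentSpace (𝓡 n) p)]

local notation "𝔼" => EuclideanSpace ℝ (Fin n)

theorem phaseField_eq (f : N → ℝ) (e : OpenPartialHomeomorph N 𝔼) (a : ℝ) (c : 𝔼 × 𝔼) :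
    phaseField f e a c = geodField e c + a • ((0 : 𝔼), chartHalfGrad e f c.1) := by
  simp [phaseField, geodField]

/-- Solutions in a chart of the forced equation, for forcing terms with small support and bounded
`L¹` norm, on a common interval around `0`. -/
theorem exists_forced_family_in_chart {f : N → ℝ} (hf : ContMDiff (𝓡 n) 𝓘(ℝ, ℝ) ∞ f)
    {e : OpenPartialHomeomorph N 𝔼} (he : e ∈ IsManifold.maximalAtlas (𝓡 n) ∞ N)
    {δ : ℝ → ℝ → ℝ} (hδ : ContDiffOn ℝ ∞ (fun q : ℝ × ℝ => δ q.1 q.2) (Ioo 0 1 ×ˢ univ)) {C : ℝ}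
    (hC : ∀ ε ∈ Ioo (0 : ℝ) 1, ∀ s t, s ≤ t → ∫ r in s..t, |δ ε r| ≤ C)
    {c : ℝ → 𝔼 × 𝔼} (hc : ContinuousAt c 0) (hce : (c 0).1 ∈ e.target) {ρ : ℝ}
    (hρ : 0 < ρ) :
    ∃ K : Set (𝔼 × 𝔼), IsCompact K ∧ K ⊆ e.target ×ˢ univ ∧ ∃ τ ∈ Ioo (0 : ℝ) 1, τ < ρ ∧
      ∃ α : ℝ → ℝ → 𝔼 × 𝔼,
        (∀ ε ∈ Ioo (0 : ℝ) 1, α ε (-(τ / 2)) = c (-(τ / 2)) ∧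
          ∀ t ∈ Ioo (-τ) τ, α ε t ∈ K ∧ HasDerivAt (α ε) (phaseField f e (δ ε t) (α ε t)) t) ∧
        ContDiffOn ℝ ∞ (fun q : ℝ × ℝ => α q.1 q.2) (Ioo 0 1 ×ˢ Ioo (-τ) τ) := by
  obtain ⟨r, hr, hrb⟩ := Metric.nhds_basis_closedBall.mem_iff.1 (e.open_target.mem_nhds hce)
  -- The gradient is cut off in position only. Its bound MB is thus available before the velocity
  -- radius R is chosen.
  obtain ⟨B, hB, hBc, hBeq⟩ := exists_compactSupport_extension e.open_target
    (contDiffOn_chartHalfGrad he hf) (isCompact_closedBall (c 0).1 r) hrb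
  obtain ⟨MB, hMB⟩ := hBc.exists_bound_of_continuous hB.continuous
  have hMB0 : 0 ≤ MB := (norm_nonneg _).trans (hMB 0)
  have hC0 : 0 ≤ C := by simpa using hC (1 / 2) (by norm_num) 0 0 le_rfl
  -- The speed at 0, plus 1 for the change of c between the starting time and 0, 1 for the unforced
  -- acceleration, and MB * C for the total impulse.
  set R : ℝ := ‖(c 0).2‖ + 2 + MB * C with hR
  have hR0 : 0 < R := by positivity
  set K : Set (𝔼 × 𝔼) := Metric.closedBall (c 0).1 r ×ˢ Metric.closedBall 0 R with hKdef
  have hK : IsCompact K := (isCompact_closedBall _ _).prod (isCompact_closedBall _ _)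
  have hKe : K ⊆ e.target ×ˢ univ := prod_mono hrb (subset_univ _)
  obtain ⟨G₀, hG₀, hG₀c, hG₀eq⟩ := exists_compactSupport_extension
    (e.open_target.prod isOpen_univ) (contDiffOn_geodField he) hK hKe
  obtain ⟨M₀, hM₀⟩ := hG₀c.exists_bound_of_continuous hG₀.continuous
  have hM₀0 : 0 ≤ M₀ := (norm_nonneg _).trans (hM₀ 0)
  let χ : ContDiffBump (0 : 𝔼) := ⟨R, R + 1, hR0, by linarith⟩
  set G₁ : 𝔼 × 𝔼 → 𝔼 × 𝔼 := fun p => (0, χ p.2 • B p.1) with hG₁def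
  have hG₁ : ContDiff ℝ ∞ G₁ :=
    contDiff_const.prodMk ((χ.contDiff.comp contDiff_snd).smul (hB.comp contDiff_fst))
  have hG₁c : HasCompactSupport G₁ := by
    refine HasCompactSupport.intro (hBc.isCompact.prod χ.hasCompactSupport.isCompact) fun p hp => ?_
    by_cases h1 : p.1 ∈ tsupport B
    · have h2 : p.2 ∉ tsupport χ := fun h => hp ⟨h1, h⟩
      simp [hG₁def, image_eq_zero_of_notMem_tsupport h2]
    · simp [hG₁def, image_eq_zero_of_notMem_tsupport h1]
  have hG₁b : ∀ p, ‖(G₁ p).2‖ ≤ MB := by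
    intro p
    simp only [hG₁def, norm_smul, Real.norm_eq_abs, abs_of_nonneg χ.nonneg]
    calc χ p.2 * ‖B p.1‖ ≤ 1 * MB := mul_le_mul χ.le_one (hMB _) (norm_nonneg _) zero_le_one
      _ = MB := one_mul _
  obtain ⟨κ₀, hκ₀, hκc⟩ := Metric.continuousAt_iff.1 hc (min (r / 2) 1) (by positivity)
  set κ := min κ₀ ρ
  have hκ : 0 < κ := lt_min hκ₀ hρ
  -- The bound M₀ depends on K and hence on R, so τ is chosen last. During a time 2τ the unforced
  -- field moves the position by at most r / 2 and the velocity by at most 1.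
  obtain ⟨τ, hτ0, hτ⟩ : ∃ τ > 0, τ < min (min 1 κ) (min (r / (4 * (M₀ + 1))) (1 / (2 * (M₀ + 1)))) :=
    exists_between (by positivity)
  have hτ1 : τ < 1 := hτ.trans_le ((min_le_left _ _).trans (min_le_left _ _))
  have hτκ : τ < κ := hτ.trans_le ((min_le_left _ _).trans (min_le_right _ _))
  have hτr : 2 * τ * M₀ ≤ r / 2 := by
    have := hτ.trans_le ((min_le_right _ _).trans (min_le_left _ _))
    rw [lt_div_iff₀ (by positivity)] at this
    nlinarith
  have hτ2 : 2 * τ * M₀ ≤ 1 := by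
    have := hτ.trans_le ((min_le_right _ _).trans (min_le_right _ _))
    rw [lt_div_iff₀ (by positivity)] at this
    nlinarith
  obtain ⟨α, hα, hαs⟩ := exists_smooth_family_of_compactSupport hG₀ hG₁ hG₀c hG₁c hδ
    (t₀ := -(τ / 2)) ⟨by linarith, by linarith⟩ (c (-(τ / 2)))
  have hsub : Ioo (-τ) τ ⊆ Ioo (-1) 1 := Ioo_subset_Ioo (by linarith) hτ1.le
  have hstart : ‖c (-(τ / 2)) - c 0‖ < min (r / 2) 1 := by
    rw [← dist_eq_norm]
    refine hκc ?_
    rw [dist_zero_right, norm_neg, Real.norm_eq_abs, abs_of_pos (by linarith)]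
    have : κ ≤ κ₀ := min_le_left _ _
    linarith
  have hδc : ∀ ε ∈ Ioo (0 : ℝ) 1, Continuous (δ ε) := fun ε hε =>
    continuousOn_univ.1 ((hδ.continuousOn.comp (f := fun t => (ε, t)) (by fun_prop)
      (s := univ) fun t _ => ⟨hε, mem_univ _⟩))
  -- No continuation argument is required: the bounds M₀ and MB hold for the cut-off fields
  -- everywhere, so the estimates apply on the whole interval. They place the solution in K, where
  -- the cutoffs are inactive.
  have hmem : ∀ ε ∈ Ioo (0 : ℝ) 1, ∀ t ∈ Ioo (-τ) τ, α ε t ∈ K := by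
    intro ε hε t ht
    have hz : ∀ t ∈ Ioo (-τ) τ, HasDerivAt (fun t => (α ε t).1)
        (G₀ (α ε t)).1 t := fun t ht => by
      simpa [hG₁def] using hasDerivAt_fst_comp ((hα ε hε).2 t (hsub ht))
    have hw : ∀ t ∈ Ioo (-τ) τ, HasDerivAt (fun t => (α ε t).2)
        ((G₀ (α ε t)).2 + δ ε t • (G₁ (α ε t)).2) t := fun t ht =>
      hasDerivAt_snd_comp ((hα ε hε).2 t (hsub ht))
    have hest : ∀ s ∈ Ioo (-τ) τ, ∀ t ∈ Ioo (-τ) τ, s ≤ t →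
        ‖(α ε t).1 - (α ε s).1‖ ≤ r / 2 ∧ ‖(α ε t).2 - (α ε s).2‖ ≤ 1 + MB * C := by
      intro s hs t ht hst
      have hI : Icc s t ⊆ Ioo (-τ) τ := fun r hr => ⟨hs.1.trans_le hr.1, hr.2.trans_lt ht.2⟩
      have hlen : M₀ * (t - s) ≤ 2 * τ * M₀ := by nlinarith [hs.1, ht.2]
      constructor
      -- The forcing does not act on the position, so its L¹ norm is absent from this estimate.
      · have := norm_sub_le_of_forced (hδc ε hε) (M₀ := M₀) (M₁ := 0) hst (fun r hr => hz r (hI hr))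
          (fun r _ => by simpa using (norm_fst_le (G₀ (α ε r))).trans (hM₀ _))
        linarith
      · have := norm_sub_le_of_forced (hδc ε hε) (M₀ := M₀) (M₁ := MB) hst (fun r hr => hw r (hI hr))
          (fun r _ => by
            refine (norm_add_le _ _).trans
              (add_le_add ((norm_snd_le (G₀ (α ε r))).trans (hM₀ _)) ?_)
            rw [norm_smul, Real.norm_eq_abs, mul_comm]
            exact mul_le_mul_of_nonneg_right (hG₁b _) (abs_nonneg _))
        have h2 : MB * ∫ r in s..t, |δ ε r| ≤ MB * C :=
          mul_le_mul_of_nonneg_left (hC ε hε s t hst) hMB0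
        linarith
    have hm : -(τ / 2) ∈ Ioo (-τ) τ := ⟨by linarith, by linarith⟩
    have hest' : ‖(α ε t).1 - (c (-(τ / 2))).1‖ ≤ r / 2 ∧
        ‖(α ε t).2 - (c (-(τ / 2))).2‖ ≤ 1 + MB * C := by
      rw [← (hα ε hε).1]
      rcases le_total (-(τ / 2)) t with h | h
      · exact hest _ hm _ ht h
      · rw [norm_sub_rev, norm_sub_rev (α ε t).2]
        exact hest _ ht _ hm h
    have h1 : ‖(c (-(τ / 2))).1 - (c 0).1‖ ≤ r / 2 :=
      (norm_fst_le (c (-(τ / 2)) - c 0)).trans (hstart.le.trans (min_le_left _ _))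
    have h2 : ‖(c (-(τ / 2))).2 - (c 0).2‖ ≤ 1 :=
      (norm_snd_le (c (-(τ / 2)) - c 0)).trans (hstart.le.trans (min_le_right _ _))
    refine ⟨?_, ?_⟩
    · rw [mem_closedBall_iff_norm]
      linarith [norm_sub_le_norm_sub_add_norm_sub (α ε t).1 (c (-(τ / 2))).1 (c 0).1, hest'.1]
    · rw [mem_closedBall_zero_iff]
      have h3 := norm_sub_le_norm_sub_add_norm_sub (α ε t).2 (c (-(τ / 2))).2 (c 0).2
      have h4 := norm_le_norm_add_norm_sub' (α ε t).2 (c 0).2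
      linarith [hest'.2]
  refine ⟨K, hK, hKe, τ, ⟨hτ0, hτ1⟩, hτκ.trans_le (min_le_right _ _), α, fun ε hε => ⟨(hα ε hε).1, fun t ht => ?_⟩,
    hαs.mono (prod_mono subset_rfl hsub)⟩
  have hKt := hmem ε hε t ht
  refine ⟨hKt, ?_⟩
  have h := (hα ε hε).2 t (hsub ht)
  rw [hG₀eq hKt] at h
  have h1 : G₁ (α ε t) = (0, chartHalfGrad e f (α ε t).1) := by
    have h2 : χ (α ε t).2 = 1 := χ.one_of_mem_closedBall hKt.2
    simp only [hG₁def, h2, one_smul, hBeq hKt.1]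
  rw [h1] at h
  rwa [phaseField_eq]

end ForcedNet

section ForcedNet

variable {n : ℕ} {N : Type*} [MetricSpace N] [ChartedSpace (EuclideanSpace ℝ (Fin n)) N]
  [RiemannianBundle (fun p : N => TangentSpace (𝓡 n) p)] [IsManifold (𝓡 n) ∞ N]
  [IsContMDiffRiemannianBundle (𝓡 n) ∞ (EuclideanSpace ℝ (Fin n))
      (fun p : N => TangentSpace (𝓡 n) p)]

local notation "𝔼" => EuclideanSpace ℝ (Fin n)

theorem exists_geodesic_of_velocity [IsRiemannianManifold (𝓡 n) N] [CompleteSpace N] (x₀ : N)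
    (x₁ : 𝔼) (t₀ : ℝ) :
    ∃ γ : ℝ → N, IsGeod (n := n) γ univ ∧ γ t₀ = x₀ ∧ (velocity (n := n) γ t₀ : 𝔼) = x₁ := by
  set e := chartAt 𝔼 x₀
  have he : e ∈ IsManifold.maximalAtlas (𝓡 n) ∞ N := IsManifold.chart_mem_maximalAtlas x₀
  have hxe : x₀ ∈ e.source := mem_chart_source 𝔼 x₀
  have hxT := e.map_source hxe
  obtain ⟨w, hw⟩ : ∃ w, chartLift e (e x₀) w = x₁ :=
    (LinearMap.injective_iff_surjective (f := (chartLift e (e x₀)).toLinearMap)).1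
      (chartLift_injective he hxT) x₁
  obtain ⟨γ, h1, h2, h3⟩ := exists_geodesic he (c := (e x₀, w)) hxT t₀
  have h4 : γ t₀ = x₀ := e.injOn h2 hxe (congrArg Prod.fst h3)
  refine ⟨γ, h1, h4, ?_⟩
  rw [velocity_eq_chartLift he (h1.1.contMDiffAt univ_mem) h2, h4, ← hw]
  exact congrArg _ (congrArg Prod.snd h3)

theorem hasDerivAt_comp_chart {g : N → ℝ} (hg : ContMDiff (𝓡 n) 𝓘(ℝ, ℝ) ∞ g)
    {e : OpenPartialHomeomorph N 𝔼} (he : e ∈ IsManifold.maximalAtlas (𝓡 n) ∞ N) {c : ℝ → 𝔼 × 𝔼}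
    {c' : 𝔼 × 𝔼} {t : ℝ} (hc : HasDerivAt c c' t) (ht : (c t).1 ∈ e.target) :
    HasDerivAt (fun s => g (e.symm (c s).1)) (fderiv ℝ (fun z => g (e.symm z)) (c t).1 c'.1) t :=
  (((contDiffOn_comp_chart_symm he hg).contDiffAt (e.open_target.mem_nhds ht)).differentiableAt
    (by simp)).hasFDerivAt.comp_hasDerivAt (f := fun s => (c s).1) t (hasDerivAt_fst_comp hc)

/-- Three pieces are glued: the incoming geodesic γ, the forced solution in a chart around γ(0), and
the outgoing geodesic. They overlap where the forcing vanishes, and there uniqueness of geodesics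
makes them agree. Since the outgoing data lie in a compact set, all bounds are uniform in ε. -/
theorem exists_forced_net [IsRiemannianManifold (𝓡 n) N] [CompleteSpace N] {f : N → ℝ}
    (hf : ContMDiff (𝓡 n) 𝓘(ℝ, ℝ) ∞ f) {δ : ℝ → ℝ → ℝ}
    (hδ : ContDiffOn ℝ ∞ (fun q : ℝ × ℝ => δ q.1 q.2) (Ioo 0 1 ×ˢ univ))
    (hsupp : ∀ ε ∈ Ioo (0 : ℝ) 1, ∀ t ∉ Ioo (-ε) ε, δ ε t = 0) {C : ℝ}
    (hC : ∀ ε ∈ Ioo (0 : ℝ) 1, ∀ s t, s ≤ t → ∫ r in s..t, |δ ε r| ≤ C) (x₀ : N) (x₁ : 𝔼) :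
    ∃ κ ∈ Ioo (0 : ℝ) 1, ∃ (y : ℝ → ℝ → N) (γ : ℝ → N), IsGeod (n := n) γ univ ∧ γ (-1) = x₀ ∧
      (velocity (n := n) γ (-1) : 𝔼) = x₁ ∧
      (∀ ε ∈ Ioo 0 κ, IsSol (n := n) f (δ ε) (y ε) univ ∧ y ε =ᶠ[𝓝 (-1)] γ) ∧
      ContMDiffOn 𝓘(ℝ, ℝ × ℝ) (𝓡 n) ∞ (fun q : ℝ × ℝ => y q.1 q.2) (Ioo 0 κ ×ˢ univ) ∧
      ∀ T : ℝ, (∃ L : Set N, IsCompact L ∧ ∀ ε ∈ Ioo 0 κ, ∀ t ∈ Icc (-T) T, y ε t ∈ L) ∧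
        ∀ g : N → ℝ, ContMDiff (𝓡 n) 𝓘(ℝ, ℝ) ∞ g →
          ∃ B, ∀ ε ∈ Ioo 0 κ, ∀ t ∈ Icc (-T) T, |deriv (fun t => g (y ε t)) t| ≤ B := by
  obtain ⟨γ, hγ, hγ0, hγ1⟩ := exists_geodesic_of_velocity x₀ x₁ (-1)
  set e := chartAt 𝔼 (γ 0) with he_def
  have he : e ∈ IsManifold.maximalAtlas (𝓡 n) ∞ N := IsManifold.chart_mem_maximalAtlas _
  have hγe : γ 0 ∈ e.source := mem_chart_source 𝔼 _
  have hγs : ∀ t, ContMDiffAt 𝓘(ℝ, ℝ) (𝓡 n) ∞ γ t := fun t => hγ.1.contMDiffAt univ_mem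
  obtain ⟨ρ, hρ, hρb⟩ := Metric.mem_nhds_iff.1
    ((hγs 0).continuousAt.preimage_mem_nhds (e.open_source.mem_nhds hγe))
  obtain ⟨K, hK, hKe, τ, hτ, hτρ, α, hα, hαs⟩ := exists_forced_family_in_chart hf he hδ hC
    (contDiffAt_phase he (hγs 0) hγe).continuousAt (e.map_source hγe) hρ
  set κ := τ / 2 with hκ
  have hκ0 : 0 < κ := half_pos hτ.1
  have hκτ : κ < τ := half_lt_self hτ.1
  have hκ1 : κ < 1 / 2 := by have := hτ.2; linarith
  have hε1 : ∀ ε ∈ Ioo 0 κ, ε ∈ Ioo (0 : ℝ) 1 := fun ε hε => ⟨hε.1, hε.2.trans (by linarith)⟩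
  have hmK : ∀ ε ∈ Ioo (0 : ℝ) 1, ∀ t ∈ Ioo (-τ) τ, α ε t ∈ K := fun ε hε t ht =>
    ((hα ε hε).2 t ht).1
  have hmT : ∀ ε ∈ Ioo (0 : ℝ) 1, ∀ t ∈ Ioo (-τ) τ, (α ε t).1 ∈ e.target := fun ε hε t ht =>
    (hKe (hmK ε hε t ht)).1
  have hcut : ∀ ε ∈ Ioo 0 κ, ∀ t ∉ Ioo (-ε) ε, δ ε t = 0 := fun ε hε => hsupp ε (hε1 ε hε)
  -- the middle piece
  set x : ℝ → ℝ → N := fun ε t => e.symm (α ε t).1 with hx_def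
  have hx : ∀ ε ∈ Ioo 0 κ, IsSol (n := n) f (δ ε) (x ε) (Ioo (-τ) τ) := fun ε hε =>
    isSol_of_phase hf he isOpen_Ioo (hαs.comp (f := fun t => (ε, t))
      (contDiff_const.prodMk contDiff_id).contDiffOn fun t ht => ⟨hε1 ε hε, ht⟩)
      (hmT ε (hε1 ε hε)) fun t ht => ((hα ε (hε1 ε hε)).2 t ht).2
  have hxph : ∀ ε ∈ Ioo 0 κ, ∀ t ∈ Ioo (-τ) τ, phase e (x ε) t = α ε t := by
    intro ε hε t ht
    have h2 : (fun s => e (e.symm (α ε s).1)) =ᶠ[𝓝 t] fun s => (α ε s).1 := by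
      filter_upwards [isOpen_Ioo.mem_nhds ht] with s hs using e.right_inv (hmT ε (hε1 ε hε) s hs)
    simp only [phase, hx_def]
    rw [h2.eq_of_nhds, h2.deriv_eq,
      (hasDerivAt_fst_comp ((hα ε (hε1 ε hε)).2 t ht).2).deriv]
    rfl
  -- the final piece
  have : Nonempty N := ⟨x₀⟩
  -- One geodesic is chosen for every phase c at time κ. Uniqueness makes the choice harmless, and
  -- `contMDiffOn_geodesic_family` makes the family smooth in c.
  choose! G hG using fun (c : 𝔼 × 𝔼) (hc : c ∈ e.target ×ˢ (univ : Set 𝔼)) =>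
    exists_geodesic he hc.1 κ
  have hGs : ContMDiffOn 𝓘(ℝ, (𝔼 × 𝔼) × ℝ) (𝓡 n) ∞ (fun q : (𝔼 × 𝔼) × ℝ => G q.1 q.2)
      ((e.target ×ˢ univ) ×ˢ univ) :=
    contMDiffOn_geodesic_family (e.open_target.prod isOpen_univ) (fun c hc => (hG c hc).1) he
      (fun c hc => (hG c hc).2.1) (contDiffOn_id.congr fun c hc => (hG c hc).2.2)
  have hκI : κ ∈ Ioo (-τ) τ := ⟨by linarith, hκτ⟩
  have hκI' : -κ ∈ Ioo (-τ) τ := ⟨by linarith, by linarith⟩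
  have hαK : ∀ ε ∈ Ioo 0 κ, α ε κ ∈ K := fun ε hε => hmK ε (hε1 ε hε) κ hκI
  -- Both curves are geodesics before -ε and have the same phase at -κ = -(τ / 2), the starting time
  -- of α.
  have hE1 : ∀ ε ∈ Ioo 0 κ, EqOn γ (x ε) (Ioo (-τ) (-ε)) := by
    intro ε hε
    have hsub : Ioo (-τ) (-ε) ⊆ Ioo (-τ) τ := Ioo_subset_Ioo_right (by linarith [hε.1])
    have hmI : -κ ∈ Ioo (-τ) (-ε) := ⟨by linarith, by linarith [hε.2]⟩
    refine (hγ.mono (subset_univ _)).eqOn_of_phase isOpen_Ioo isPreconnected_Ioo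
      ((isSol_iff_isGeod fun t ht => hcut ε hε t fun h => ?_).1 ((hx ε hε).mono hsub)) hmI he
      (hρb ?_) (e.map_target (hmT ε (hε1 ε hε) _ hκI')) ?_
    · linarith [h.1, ht.2]
    · rw [mem_ball_zero_iff, norm_neg, Real.norm_eq_abs, abs_of_pos hκ0]
      linarith
    · rw [hxph ε hε _ hκI', (hα ε (hε1 ε hε)).1]
  have hE3 : ∀ ε ∈ Ioo 0 κ, EqOn (x ε) (G (α ε κ)) (Ioo ε τ) := by
    intro ε hε
    have hsub : Ioo ε τ ⊆ Ioo (-τ) τ := Ioo_subset_Ioo_left (by linarith [hε.1])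
    have hmI : κ ∈ Ioo ε τ := ⟨hε.2, hκτ⟩
    obtain ⟨h1, h2, h3⟩ := hG _ (hKe (hαK ε hε))
    refine IsGeod.eqOn_of_phase isOpen_Ioo isPreconnected_Ioo
      ((isSol_iff_isGeod fun t ht => hcut ε hε t fun h => ?_).1 ((hx ε hε).mono hsub))
      (h1.mono (subset_univ _)) hmI he (e.map_target (hmT ε (hε1 ε hε) _ hκI)) h2 ?_
    · linarith [h.2, ht.1]
    · rw [hxph ε hε _ hκI, h3]
  -- the glued net
  set y : ℝ → ℝ → N := fun ε t =>
    if t ≤ -κ then γ t else if t ≤ κ then x ε t else G (α ε κ) t with hy_def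
  have hY1 : ∀ ε ∈ Ioo 0 κ, EqOn γ (y ε) (Iio (-ε)) := by
    intro ε hε t ht
    simp only [hy_def]
    split_ifs with h1 h2
    · rfl
    · exact hE1 ε hε ⟨by linarith, ht⟩
    · linarith [hε.1, show t < -ε from ht]
  have hY2 : ∀ ε ∈ Ioo 0 κ, EqOn (x ε) (y ε) (Ioo (-τ) τ) := by
    intro ε hε t ht
    simp only [hy_def]
    split_ifs with h1 h2
    · exact (hE1 ε hε ⟨ht.1, by linarith [hε.2]⟩).symm
    · rfl
    · exact hE3 ε hε ⟨by linarith [hε.2], ht.2⟩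
  have hY3 : ∀ ε ∈ Ioo 0 κ, EqOn (G (α ε κ)) (y ε) (Ioi ε) := by
    intro ε hε t ht
    simp only [hy_def]
    split_ifs with h1 h2
    · linarith [hε.1, show ε < t from ht]
    · exact (hE3 ε hε ⟨ht, by linarith⟩).symm
    · rfl
  have hcover : ∀ ε ∈ Ioo 0 κ, ∀ t : ℝ, t ∈ Iio (-ε) ∨ t ∈ Ioo (-τ) τ ∨ t ∈ Ioi ε := by
    intro ε hε t
    by_cases h1 : t < -ε
    · exact Or.inl h1
    · by_cases h2 : t < τ
      · exact Or.inr (Or.inl ⟨by linarith [hε.2], h2⟩)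
      · exact Or.inr (Or.inr (show ε < t by linarith [hε.2]))
  refine ⟨κ, ⟨hκ0, by linarith⟩, y, γ, hγ, hγ0, hγ1, fun ε hε => ⟨?_, ?_⟩, ?_, fun T => ⟨?_, ?_⟩⟩
  · refine isSol_of_locally fun t _ => ?_
    rcases hcover ε hε t with h | h | h
    · exact ⟨γ, Iio (-ε), isOpen_Iio.mem_nhds h, (isSol_iff_isGeod fun t ht => hcut ε hε t fun h' =>
        (not_lt.2 h'.1.le ht)).2 (hγ.mono (subset_univ _)),
        (hY1 ε hε).eventuallyEq_of_mem (isOpen_Iio.mem_nhds h)⟩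
    · exact ⟨x ε, _, isOpen_Ioo.mem_nhds h, hx ε hε,
        (hY2 ε hε).eventuallyEq_of_mem (isOpen_Ioo.mem_nhds h)⟩
    · exact ⟨G (α ε κ), Ioi ε, isOpen_Ioi.mem_nhds h, (isSol_iff_isGeod fun t ht => hcut ε hε t
        fun h' => (not_lt.2 h'.2.le ht)).2 ((hG _ (hKe (hαK ε hε))).1.mono (subset_univ _)),
        (hY3 ε hε).eventuallyEq_of_mem (isOpen_Ioi.mem_nhds h)⟩
  · exact ((hY1 ε hε).eventuallyEq_of_mem
      (Iio_mem_nhds (show (-1 : ℝ) < -ε by linarith [hε.2]))).symm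
  · rintro ⟨ε, t⟩ ⟨hε, -⟩
    refine ContMDiffAt.contMDiffWithinAt ?_
    have hεn : ∀ᶠ q : ℝ × ℝ in 𝓝 (ε, t), q.1 ∈ Ioo 0 κ :=
      continuousAt_fst.preimage_mem_nhds (isOpen_Ioo.mem_nhds hε)
    have hαs1 : ContDiffOn ℝ ∞ (fun ε => α ε κ) (Ioo 0 κ) :=
      hαs.comp (f := fun ε => (ε, κ)) (contDiff_id.prodMk contDiff_const).contDiffOn
        fun ε hε => ⟨hε1 ε hε, hκI⟩
    rcases hcover ε hε t with h | h | h
    · refine (ContMDiffAt.comp (g := γ) (f := Prod.snd) (ε, t) (hγs t)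
        (contMDiffAt_iff_contDiffAt.2 contDiffAt_snd)).congr_of_eventuallyEq ?_
      filter_upwards [hεn, (isOpen_lt continuous_snd continuous_fst.neg).mem_nhds
        (show (ε, t).2 < -(ε, t).1 from h)] with q hq1 hq2
      exact (hY1 _ hq1 hq2).symm
    · have h1 : ContMDiffAt 𝓘(ℝ, ℝ × ℝ) (𝓡 n) ∞ (fun q : ℝ × ℝ => x q.1 q.2) (ε, t) := by
        refine ContMDiffAt.comp (ε, t) (g := e.symm) (f := fun q : ℝ × ℝ => (α q.1 q.2).1)
          ((contMDiffOn_symm_of_mem_maximalAtlas he).contMDiffAt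
          (e.open_target.mem_nhds (hmT ε (hε1 ε hε) t h))) ?_
        rw [contMDiffAt_iff_contDiffAt]
        exact (hαs.contDiffAt ((isOpen_Ioo.prod isOpen_Ioo).mem_nhds ⟨hε1 ε hε, h⟩)).fst
      refine h1.congr_of_eventuallyEq ?_
      filter_upwards [hεn, continuousAt_snd.preimage_mem_nhds (isOpen_Ioo.mem_nhds h)] with q hq1 hq2
      exact (hY2 _ hq1 hq2).symm
    · have h1 : ContMDiffAt 𝓘(ℝ, ℝ × ℝ) (𝓡 n) ∞ (fun q : ℝ × ℝ => G (α q.1 κ) q.2) (ε, t) := by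
        refine ContMDiffAt.comp (ε, t) (g := fun q : (𝔼 × 𝔼) × ℝ => G q.1 q.2)
          (f := fun q : ℝ × ℝ => (α q.1 κ, q.2)) (hGs.contMDiffAt
          (((e.open_target.prod isOpen_univ).prod isOpen_univ).mem_nhds
            ⟨hKe (hαK ε hε), mem_univ _⟩)) ?_
        rw [contMDiffAt_iff_contDiffAt]
        exact ((hαs1.contDiffAt (isOpen_Ioo.mem_nhds hε)).comp (ε, t) contDiffAt_fst).prodMk
          contDiffAt_snd
      refine h1.congr_of_eventuallyEq ?_
      filter_upwards [hεn, (isOpen_lt continuous_fst continuous_snd).mem_nhds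
        (show (ε, t).1 < (ε, t).2 from h)] with q hq1 hq2
      exact (hY3 _ hq1 hq2).symm
  -- The compact set is the union of the regions visited by the three pieces; for the last one, all
  -- data in K are admitted at once.
  · refine ⟨γ '' Icc (-T) T ∪ (e.symm '' (Prod.fst '' K) ∪
      (fun q : (𝔼 × 𝔼) × ℝ => G q.1 q.2) '' (K ×ˢ Icc (-T) T)), ?_, fun ε hε t ht => ?_⟩
    · refine (isCompact_Icc.image_of_continuousOn fun t _ =>
        (hγs t).continuousAt.continuousWithinAt).union
        (((hK.image continuous_fst).image_of_continuousOn (e.continuousOn_symm.mono ?_)).union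
        ((hK.prod isCompact_Icc).image_of_continuousOn
          (hGs.continuousOn.mono (prod_mono hKe (subset_univ _)))))
      rintro _ ⟨p, hp, rfl⟩
      exact (hKe hp).1
    · rcases hcover ε hε t with h | h | h
      · exact Or.inl ⟨t, ht, hY1 ε hε h⟩
      · exact Or.inr (Or.inl ⟨_, ⟨_, hmK ε (hε1 ε hε) t h, rfl⟩, hY2 ε hε h⟩)
      · exact Or.inr (Or.inr ⟨(α ε κ, t), ⟨hαK ε hε, ht⟩, hY3 ε hε h⟩)
  · intro g hg
    -- bounds on the three pieces
    have hd1 : ContinuousOn (deriv fun t => g (γ t)) (Icc (-T) T) := by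
      have : ContDiff ℝ ∞ fun t => g (γ t) := by
        rw [← contMDiff_iff_contDiff]
        exact hg.comp fun t => hγs t
      exact (this.continuous_deriv (by simp)).continuousOn
    obtain ⟨B₁, hB₁⟩ := isCompact_Icc.exists_bound_of_continuousOn hd1
    have hd2 : ContinuousOn (fun p : 𝔼 × 𝔼 => fderiv ℝ (fun z => g (e.symm z)) p.1 p.2) K := by
      have h1 := (contDiffOn_comp_chart_symm he hg).continuousOn_fderiv_of_isOpen e.open_target
        (by simp)
      exact (h1.comp continuousOn_fst fun p hp => (hKe hp).1).clm_apply continuousOn_snd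
    obtain ⟨B₂, hB₂⟩ := hK.exists_bound_of_continuousOn hd2
    have hgG : ContDiffOn ℝ ∞ (fun q : (𝔼 × 𝔼) × ℝ => g (G q.1 q.2))
        ((e.target ×ˢ univ) ×ˢ univ) := by
      rw [← contMDiffOn_iff_contDiffOn]
      exact hg.comp_contMDiffOn hGs
    have hopen : IsOpen ((e.target ×ˢ (univ : Set 𝔼)) ×ˢ (univ : Set ℝ)) :=
      (e.open_target.prod isOpen_univ).prod isOpen_univ
    have hd3 : ContinuousOn (fun q : (𝔼 × 𝔼) × ℝ =>
        fderiv ℝ (fun q : (𝔼 × 𝔼) × ℝ => g (G q.1 q.2)) q (0, 1)) (K ×ˢ Icc (-T) T) :=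
      ((hgG.continuousOn_fderiv_of_isOpen hopen (by simp)).mono
        (prod_mono hKe (subset_univ _))).clm_apply continuousOn_const
    obtain ⟨B₃, hB₃⟩ := (hK.prod isCompact_Icc).exists_bound_of_continuousOn hd3
    refine ⟨max B₁ (max B₂ B₃), fun ε hε t ht => ?_⟩
    rcases hcover ε hε t with h | h | h
    · have h1 : (fun t => g (γ t)) =ᶠ[𝓝 t] fun t => g (y ε t) :=
        ((hY1 ε hε).eventuallyEq_of_mem (isOpen_Iio.mem_nhds h)).fun_comp g
      rw [← h1.deriv_eq]
      exact (hB₁ t ht).trans (le_max_left _ _)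
    · have h1 : (fun t => g (x ε t)) =ᶠ[𝓝 t] fun t => g (y ε t) :=
        ((hY2 ε hε).eventuallyEq_of_mem (isOpen_Ioo.mem_nhds h)).fun_comp g
      rw [← h1.deriv_eq, (hasDerivAt_comp_chart hg he ((hα ε (hε1 ε hε)).2 t h).2
        (hmT ε (hε1 ε hε) t h)).deriv]
      exact (hB₂ _ (hmK ε (hε1 ε hε) t h)).trans ((le_max_left _ _).trans (le_max_right _ _))
    · have h1 : (fun t => g (G (α ε κ) t)) =ᶠ[𝓝 t] fun t => g (y ε t) :=
        ((hY3 ε hε).eventuallyEq_of_mem (isOpen_Ioi.mem_nhds h)).fun_comp g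
      have h2 := (hgG.contDiffAt (hopen.mem_nhds (x := (α ε κ, t))
        ⟨hKe (hαK ε hε), mem_univ _⟩)).differentiableAt (by simp)
      have h3 : HasDerivAt (fun t : ℝ => (α ε κ, t)) ((0 : 𝔼 × 𝔼), (1 : ℝ)) t :=
        (hasDerivAt_const _ _).prodMk (hasDerivAt_id _)
      have h4 : deriv (fun t => g (G (α ε κ) t)) t = _ :=
        (h2.hasFDerivAt.comp_hasDerivAt t h3).deriv
      rw [← h1.deriv_eq, h4]
      exact (hB₃ (α ε κ, t) ⟨hαK ε hε, ht⟩).trans ((le_max_right _ _).trans (le_max_right _ _))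

end ForcedNet

/-! ### The component `v` -/

/-- The primitive solves an ordinary differential equation in (ε, t, value), so its joint smoothness
is a case of smooth dependence on parameters. -/
theorem contDiffOn_primitive {U : Set ℝ} (hU : IsOpen U) {F : ℝ → ℝ → ℝ}
    (hF : ContDiffOn ℝ ∞ (fun q : ℝ × ℝ => F q.1 q.2) (U ×ˢ univ)) (t₀ : ℝ) :
    ContDiffOn ℝ ∞ (fun q : ℝ × ℝ => ∫ s in t₀..q.2, F q.1 s) (U ×ˢ univ) := by
  have hc : ∀ ε ∈ U, Continuous (F ε) := fun ε hε =>
    continuousOn_univ.1 ((hF.continuousOn.comp (f := fun t => (ε, t)) (by fun_prop)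
      (s := univ) fun t _ => ⟨hε, mem_univ _⟩))
  rintro ⟨ε, t⟩ ⟨hε, -⟩
  have hI : t₀ ∈ Ioo (min t₀ t - 1) (max t₀ t + 1) :=
    ⟨by linarith [min_le_left t₀ t], by linarith [le_max_left t₀ t]⟩
  have hI' : t ∈ Ioo (min t₀ t - 1) (max t₀ t + 1) :=
    ⟨by linarith [min_le_right t₀ t], by linarith [le_max_right t₀ t]⟩
  have hfield : ContDiffOn ℝ ∞ (fun c : ℝ × ℝ × ℝ => ((0 : ℝ), (1 : ℝ), F c.1 c.2.1))
      (U ×ˢ (univ : Set (ℝ × ℝ))) :=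
    contDiffOn_const.prodMk (contDiffOn_const.prodMk (hF.comp
      (contDiff_fst.prodMk (contDiff_fst.comp contDiff_snd)).contDiffOn
      fun c hc => ⟨hc.1, mem_univ _⟩))
  have h := contDiffOn_family_of_solves (hU.prod isOpen_univ) hfield hU hI
    (α := fun ε t => (ε, t, ∫ s in t₀..t, F ε s)) (fun ε hε t _ => ⟨⟨hε, mem_univ _⟩,
      (hasDerivAt_const _ _).prodMk ((hasDerivAt_id _).prodMk
        (intervalIntegral.integral_hasDerivAt_right ((hc ε hε).intervalIntegrable _ _)
          ((hc ε hε).stronglyMeasurableAtFilter _ _) (hc ε hε).continuousAt))⟩)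
    (by simpa using (contDiff_id.prodMk contDiff_const).contDiffOn)
  exact ((h.contDiffAt ((hU.prod isOpen_Ioo).mem_nhds ⟨hε, hI'⟩)).snd.snd).contDiffWithinAt

theorem contDiffOn_deriv_snd {U : Set ℝ} (hU : IsOpen U) {F : ℝ → ℝ → ℝ}
    (hF : ContDiffOn ℝ ∞ (fun q : ℝ × ℝ => F q.1 q.2) (U ×ˢ univ)) :
    ContDiffOn ℝ ∞ (fun q : ℝ × ℝ => deriv (F q.1) q.2) (U ×ˢ univ) := by
  have ho : IsOpen (U ×ˢ (univ : Set ℝ)) := hU.prod isOpen_univ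
  have h1 : ContDiffOn ℝ ∞ (fun q : ℝ × ℝ =>
      fderiv ℝ (fun q : ℝ × ℝ => F q.1 q.2) q (0, 1)) (U ×ˢ univ) :=
    (hF.fderiv_of_isOpen (m := ∞) ho (by simp)).clm_apply contDiffOn_const
  refine h1.congr fun q hq => ?_
  have h2 := (hF.contDiffAt (ho.mem_nhds hq)).differentiableAt (by simp)
  have h3 : HasDerivAt (fun t : ℝ => (q.1, t)) ((0 : ℝ), (1 : ℝ)) q.2 :=
    (hasDerivAt_const _ _).prodMk (hasDerivAt_id _)
  exact (h2.hasFDerivAt.comp_hasDerivAt q.2 h3).deriv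

theorem contDiff_of_net {U : Set ℝ} {F : ℝ → ℝ → ℝ}
    (hF : ContDiffOn ℝ ∞ (fun q : ℝ × ℝ => F q.1 q.2) (U ×ˢ univ)) {ε : ℝ} (hε : ε ∈ U) :
    ContDiff ℝ ∞ (F ε) :=
  contDiffOn_univ.1 (hF.comp (f := fun t => (ε, t)) (contDiff_const.prodMk contDiff_id).contDiffOn
    fun _ _ => ⟨hε, mem_univ _⟩)

/-- Solutions of `v' = p - ½ g δ`, `p' = - ½ g' δ`, with bounds. -/
theorem exists_driven_net {U : Set ℝ} (hU : IsOpen U) {g δ : ℝ → ℝ → ℝ}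
    (hg : ContDiffOn ℝ ∞ (fun q : ℝ × ℝ => g q.1 q.2) (U ×ˢ univ))
    (hδ : ContDiffOn ℝ ∞ (fun q : ℝ × ℝ => δ q.1 q.2) (U ×ˢ univ)) {C : ℝ}
    (hC : ∀ ε ∈ U, ∀ s t, s ≤ t → ∫ r in s..t, |δ ε r| ≤ C)
    (hgb : ∀ T : ℝ, ∃ B, ∀ ε ∈ U, ∀ t ∈ Icc (-T) T, |g ε t| ≤ B)
    (hgb' : ∀ T : ℝ, ∃ B, ∀ ε ∈ U, ∀ t ∈ Icc (-T) T, |deriv (g ε) t| ≤ B) (v₀ v₁ : ℝ) :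
    ∃ v p : ℝ → ℝ → ℝ, ContDiffOn ℝ ∞ (fun q : ℝ × ℝ => v q.1 q.2) (U ×ˢ univ) ∧
      ContDiffOn ℝ ∞ (fun q : ℝ × ℝ => p q.1 q.2) (U ×ˢ univ) ∧
      (∀ ε ∈ U, v ε (-1) = v₀ ∧ p ε (-1) = v₁ ∧ ∀ t,
        HasDerivAt (v ε) (p ε t - 1 / 2 * g ε t * δ ε t) t ∧
        HasDerivAt (p ε) (-(1 / 2) * deriv (g ε) t * δ ε t) t) ∧
      ∀ T : ℝ, ∃ B, ∀ ε ∈ U, ∀ t ∈ Icc (-T) T, |v ε t| ≤ B ∧ |p ε t| ≤ B := by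
  -- The auxiliary unknown is p = v' + ½ g δ. It absorbs the singular term, so both integrands
  -- contain δ itself but not its derivative.
  set p : ℝ → ℝ → ℝ := fun ε t => v₁ + ∫ s in (-1)..t, -(1 / 2) * deriv (g ε) s * δ ε s with hp
  set v : ℝ → ℝ → ℝ := fun ε t => v₀ + ∫ s in (-1)..t, (p ε s - 1 / 2 * g ε s * δ ε s) with hv
  have hps : ContDiffOn ℝ ∞ (fun q : ℝ × ℝ => p q.1 q.2) (U ×ˢ univ) :=
    contDiffOn_const.add (contDiffOn_primitive hU
      (F := fun ε s => -(1 / 2) * deriv (g ε) s * δ ε s)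
      ((contDiffOn_const.mul (contDiffOn_deriv_snd hU hg)).mul hδ) (-1))
  have hvs : ContDiffOn ℝ ∞ (fun q : ℝ × ℝ => v q.1 q.2) (U ×ˢ univ) :=
    contDiffOn_const.add (contDiffOn_primitive hU
      (F := fun ε s => p ε s - 1 / 2 * g ε s * δ ε s)
      (hps.sub ((contDiffOn_const.mul hg).mul hδ)) (-1))
  have hint : ∀ {F : ℝ → ℝ} (a : ℝ), Continuous F → ∀ t,
      HasDerivAt (fun t => a + ∫ s in (-1)..t, F s) (F t) t := fun a hF t =>
    (intervalIntegral.integral_hasDerivAt_right (hF.intervalIntegrable _ _)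
      (hF.stronglyMeasurableAtFilter _ _) hF.continuousAt).const_add a
  have hδc : ∀ ε ∈ U, Continuous (δ ε) := fun ε hε => (contDiff_of_net hδ hε).continuous
  have hgc : ∀ ε ∈ U, Continuous (g ε) := fun ε hε => (contDiff_of_net hg hε).continuous
  have hg'c : ∀ ε ∈ U, Continuous (deriv (g ε)) := fun ε hε =>
    (contDiff_of_net hg hε).continuous_deriv (by simp)
  have hpc : ∀ ε ∈ U, Continuous (p ε) := fun ε hε => (contDiff_of_net hps hε).continuous
  have hpd : ∀ ε ∈ U, ∀ t, HasDerivAt (p ε) (-(1 / 2) * deriv (g ε) t * δ ε t) t := fun ε hε =>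
    hint v₁ ((continuous_const.mul (hg'c ε hε)).mul (hδc ε hε))
  have hvd : ∀ ε ∈ U, ∀ t, HasDerivAt (v ε) (p ε t - 1 / 2 * g ε t * δ ε t) t := fun ε hε =>
    hint v₀ ((hpc ε hε).sub ((continuous_const.mul (hgc ε hε)).mul (hδc ε hε)))
  refine ⟨v, p, hvs, hps, fun ε hε => ⟨by simp [hv], by simp [hp], fun t =>
    ⟨hvd ε hε t, hpd ε hε t⟩⟩, fun T => ?_⟩
  -- bounds
  set T' := max T 1 with hT'
  have hT1 : 1 ≤ T' := le_max_right _ _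
  have hm : (-1 : ℝ) ∈ Icc (-T') T' := ⟨by linarith, by linarith⟩
  obtain ⟨B, hB⟩ := hgb T'
  obtain ⟨B', hB'⟩ := hgb' T'
  have key : ∀ ε ∈ U, ∀ {u u' : ℝ → ℝ} {M₀ M₁ : ℝ}, 0 ≤ M₀ → 0 ≤ M₁ →
      (∀ t, HasDerivAt u (u' t) t) →
      (∀ t ∈ Icc (-T') T', |u' t| ≤ M₀ + M₁ * |δ ε t|) → ∀ t ∈ Icc (-T') T',
      |u t| ≤ |u (-1)| + (M₀ * (2 * T') + M₁ * C) := by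
    intro ε hε u u' M₀ M₁ h0 h1 hu hb t ht
    have hest : ∀ s ∈ Icc (-T') T', ∀ t ∈ Icc (-T') T', s ≤ t →
        ‖u t - u s‖ ≤ M₀ * (2 * T') + M₁ * C := by
      intro s hs t ht hst
      have h2 := norm_sub_le_of_forced (hδc ε hε) hst (fun r _ => hu r)
        fun r hr => hb r ⟨hs.1.trans hr.1, hr.2.trans ht.2⟩
      have h3 := mul_le_mul_of_nonneg_left (hC ε hε s t hst) h1
      have h4 : M₀ * (t - s) ≤ M₀ * (2 * T') :=
        mul_le_mul_of_nonneg_left (by linarith [hs.1, ht.2]) h0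
      linarith
    have h5 : ‖u t - u (-1)‖ ≤ M₀ * (2 * T') + M₁ * C := by
      rcases le_total (-1) t with h | h
      · exact hest _ hm _ ht h
      · rw [norm_sub_rev]
        exact hest _ ht _ hm h
    have h6 := norm_le_norm_add_norm_sub' (u t) (u (-1))
    simp only [Real.norm_eq_abs] at h5 h6
    linarith
  set Bp := |v₁| + (0 * (2 * T') + |B'| * C) with hBp
  have hpb : ∀ ε ∈ U, ∀ t ∈ Icc (-T') T', |p ε t| ≤ Bp := by
    intro ε hε t ht
    have := key ε hε (M₀ := 0) (M₁ := |B'|) le_rfl (abs_nonneg _) (hpd ε hε) (fun s hs => ?_) t ht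
    · simpa [hp, hBp] using this
    · have h1 := (hB' ε hε s hs).trans (le_abs_self B')
      rw [abs_mul, abs_mul, zero_add]
      refine mul_le_mul_of_nonneg_right ?_ (abs_nonneg _)
      rw [abs_neg, abs_of_pos (by norm_num : (0 : ℝ) < 1 / 2)]
      linarith [abs_nonneg (deriv (g ε) s)]
  have hvb : ∀ ε ∈ U, ∀ t ∈ Icc (-T') T', |v ε t| ≤ |v₀| + (|Bp| * (2 * T') + |B| * C) := by
    intro ε hε t ht
    have := key ε hε (M₀ := |Bp|) (M₁ := |B|) (abs_nonneg _) (abs_nonneg _) (hvd ε hε)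
      (fun s hs => ?_) t ht
    · simpa [hv] using this
    · refine (abs_sub _ _).trans (add_le_add ((hpb ε hε s hs).trans (le_abs_self _)) ?_)
      have h1 := (hB ε hε s hs).trans (le_abs_self B)
      rw [abs_mul, abs_mul]
      refine mul_le_mul_of_nonneg_right ?_ (abs_nonneg _)
      rw [abs_of_pos (by norm_num : (0 : ℝ) < 1 / 2)]
      linarith [abs_nonneg (g ε s)]
  refine ⟨max (|v₀| + (|Bp| * (2 * T') + |B| * C)) Bp, fun ε hε t ht => ?_⟩
  have ht' : t ∈ Icc (-T') T' :=
    ⟨(neg_le_neg (le_max_left _ _)).trans ht.1, ht.2.trans (le_max_left _ _)⟩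
  exact ⟨(hvb ε hε t ht').trans (le_max_left _ _), (hpb ε hε t ht').trans (le_max_right _ _)⟩

/-! ### Calculus of moderate and negligible nets -/

/-- The net `a` is moderate, uniformly for parameters in the sets `J ε`. -/
def ModerateOn (J : ℝ → Set ℝ) (a : ℝ → ℝ → ℝ) : Prop :=
  ∃ N : ℕ, ∀ᶠ ε in 𝓝[>] (0 : ℝ), ∀ t ∈ J ε, |a ε t| ≤ (ε⁻¹) ^ N

/-- The net `a` is negligible, uniformly for parameters in the sets `J ε`. -/
def NegligibleOn (J : ℝ → Set ℝ) (a : ℝ → ℝ → ℝ) : Prop :=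
  ∀ m : ℕ, ∀ᶠ ε in 𝓝[>] (0 : ℝ), ∀ t ∈ J ε, |a ε t| ≤ ε ^ m

theorem eventually_le_inv (C : ℝ) : ∀ᶠ ε in 𝓝[>] (0 : ℝ), C ≤ ε⁻¹ :=
  tendsto_inv_nhdsGT_zero.eventually (eventually_ge_atTop C)

theorem eventually_small {κ : ℝ} (hκ : 0 < κ) : ∀ᶠ ε in 𝓝[>] (0 : ℝ), ε ∈ Ioo 0 κ :=
  Ioo_mem_nhdsGT hκ

/-- A constant factor is absorbed by one further power of ε⁻¹, and for negligible nets by one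
further power of ε. -/
theorem moderateOn_iff {J : ℝ → Set ℝ} {a : ℝ → ℝ → ℝ} :
    ModerateOn J a ↔
      ∃ (N : ℕ) (C : ℝ), ∀ᶠ ε in 𝓝[>] (0 : ℝ), ∀ t ∈ J ε, |a ε t| ≤ C * (ε⁻¹) ^ N := by
  refine ⟨fun ⟨N, h⟩ => ⟨N, 1, by simpa using h⟩, fun ⟨N, C, h⟩ => ⟨N + 1, ?_⟩⟩
  filter_upwards [h, eventually_le_inv C, self_mem_nhdsWithin] with ε h1 h2 (h3 : 0 < ε) t ht
  rw [pow_succ']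
  exact (h1 t ht).trans (by gcongr)

theorem negligibleOn_iff {J : ℝ → Set ℝ} {a : ℝ → ℝ → ℝ} :
    NegligibleOn J a ↔
      ∀ m : ℕ, ∃ C : ℝ, ∀ᶠ ε in 𝓝[>] (0 : ℝ), ∀ t ∈ J ε, |a ε t| ≤ C * ε ^ m := by
  refine ⟨fun h m => ⟨1, by simpa using h m⟩, fun h m => ?_⟩
  obtain ⟨C, hC⟩ := h (m + 1)
  filter_upwards [hC, eventually_le_inv C, self_mem_nhdsWithin] with ε h1 h2 (h3 : 0 < ε) t ht
  refine (h1 t ht).trans ?_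
  rw [pow_succ', ← mul_assoc]
  have : C * ε ≤ 1 := by
    have := mul_le_mul_of_nonneg_right h2 h3.le
    rwa [inv_mul_cancel₀ h3.ne'] at this
  calc C * ε * ε ^ m ≤ 1 * ε ^ m := by gcongr
    _ = ε ^ m := one_mul _

section Calculus

variable {J J' : ℝ → Set ℝ} {a b : ℝ → ℝ → ℝ}

theorem ModerateOn.of_le (hb : ModerateOn J b)
    (h : ∀ᶠ ε in 𝓝[>] (0 : ℝ), ∀ t ∈ J' ε, t ∈ J ε ∧ |a ε t| ≤ |b ε t|) : ModerateOn J' a := by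
  obtain ⟨N, hN⟩ := hb
  refine ⟨N, ?_⟩
  filter_upwards [hN, h] with ε h1 h2 t ht
  exact (h2 t ht).2.trans (h1 t (h2 t ht).1)

theorem ModerateOn.of_bounded {B : ℝ} (h : ∀ᶠ ε in 𝓝[>] (0 : ℝ), ∀ t ∈ J ε, |a ε t| ≤ B) :
    ModerateOn J a :=
  moderateOn_iff.2 ⟨0, B, by simpa using h⟩

theorem ModerateOn.add (ha : ModerateOn J a) (hb : ModerateOn J b) :
    ModerateOn J fun ε t => a ε t + b ε t := by
  obtain ⟨N, hN⟩ := ha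
  obtain ⟨M, hM⟩ := hb
  refine moderateOn_iff.2 ⟨N + M, 2, ?_⟩
  filter_upwards [hN, hM, eventually_le_inv 1] with ε h1 h2 h3 t ht
  have h4 : ε⁻¹ ^ N ≤ ε⁻¹ ^ (N + M) := pow_le_pow_right₀ h3 (by omega)
  have h5 : ε⁻¹ ^ M ≤ ε⁻¹ ^ (N + M) := pow_le_pow_right₀ h3 (by omega)
  linarith [abs_add_le (a ε t) (b ε t), h1 t ht, h2 t ht]

theorem ModerateOn.mul (ha : ModerateOn J a) (hb : ModerateOn J b) :
    ModerateOn J fun ε t => a ε t * b ε t := by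
  obtain ⟨N, hN⟩ := ha
  obtain ⟨M, hM⟩ := hb
  refine ⟨N + M, ?_⟩
  filter_upwards [hN, hM, eventually_le_inv 1] with ε h1 h2 h3 t ht
  rw [abs_mul, pow_add]
  exact mul_le_mul (h1 t ht) (h2 t ht) (abs_nonneg _) (by positivity)

theorem ModerateOn.sum {ι : Type*} {s : Finset ι} {a : ι → ℝ → ℝ → ℝ}
    (h : ∀ i ∈ s, ModerateOn J (a i)) : ModerateOn J fun ε t => ∑ i ∈ s, a i ε t := by
  classical
  induction s using Finset.induction_on with
  | empty => exact ModerateOn.of_bounded (B := 0) (by simp)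
  | insert i s hi ih =>
    simp only [Finset.sum_insert hi]
    exact (h i (Finset.mem_insert_self i s)).add
      (ih fun j hj => h j (Finset.mem_insert_of_mem hj))

theorem NegligibleOn.of_le (hb : NegligibleOn J b)
    (h : ∀ᶠ ε in 𝓝[>] (0 : ℝ), ∀ t ∈ J' ε, t ∈ J ε ∧ |a ε t| ≤ |b ε t|) : NegligibleOn J' a := by
  intro m
  filter_upwards [hb m, h] with ε h1 h2 t ht
  exact (h2 t ht).2.trans (h1 t (h2 t ht).1)

theorem NegligibleOn.mono (ha : NegligibleOn J a) (h : ∀ ε, J' ε ⊆ J ε) : NegligibleOn J' a :=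
  ha.of_le (Eventually.of_forall fun ε _ ht => ⟨h ε ht, le_rfl⟩)

theorem NegligibleOn.add (ha : NegligibleOn J a) (hb : NegligibleOn J b) :
    NegligibleOn J fun ε t => a ε t + b ε t := by
  refine negligibleOn_iff.2 fun m => ⟨2, ?_⟩
  filter_upwards [ha m, hb m] with ε h1 h2 t ht
  linarith [abs_add_le (a ε t) (b ε t), h1 t ht, h2 t ht]

theorem NegligibleOn.sum {ι : Type*} {s : Finset ι} {a : ι → ℝ → ℝ → ℝ}
    (h : ∀ i ∈ s, NegligibleOn J (a i)) : NegligibleOn J fun ε t => ∑ i ∈ s, a i ε t := by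
  classical
  induction s using Finset.induction_on with
  | empty =>
    intro m
    filter_upwards [self_mem_nhdsWithin] with ε (hε : 0 < ε) t _
    simp only [Finset.sum_empty, abs_zero]
    positivity
  | insert i s hi ih =>
    simp only [Finset.sum_insert hi]
    exact (h i (Finset.mem_insert_self i s)).add
      (ih fun j hj => h j (Finset.mem_insert_of_mem hj))

theorem NegligibleOn.mul_moderate (ha : NegligibleOn J a) (hb : ModerateOn J b) :
    NegligibleOn J fun ε t => a ε t * b ε t := by
  obtain ⟨N, hN⟩ := hb
  intro m
  filter_upwards [ha (m + N), hN, self_mem_nhdsWithin] with ε h1 h2 (h3 : 0 < ε) t ht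
  rw [abs_mul]
  calc |a ε t| * |b ε t| ≤ ε ^ (m + N) * ε⁻¹ ^ N :=
        mul_le_mul (h1 t ht) (h2 t ht) (abs_nonneg _) (by positivity)
    _ = ε ^ m := by rw [pow_add, mul_assoc, ← mul_pow, mul_inv_cancel₀ h3.ne', one_pow, mul_one]

theorem NegligibleOn.const_mul (ha : NegligibleOn J a) (c : ℝ) :
    NegligibleOn J fun ε t => c * a ε t := by
  have := ha.mul_moderate (ModerateOn.of_bounded (J := J) (a := fun _ _ => c) (B := |c|) (by simp))
  exact this.of_le (Eventually.of_forall fun ε t ht => ⟨ht, by rw [mul_comm]⟩)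

theorem NegligibleOn.abs (ha : NegligibleOn J a) : NegligibleOn J fun ε t => |a ε t| :=
  ha.of_le (Eventually.of_forall fun ε t ht => ⟨ht, by simp⟩)

end Calculus

theorem HasModerateGrowth.moderateOn {u : ℝ → ℝ → ℝ} (h : HasModerateGrowth u) {K : Set ℝ}
    (hK : IsCompact K) (k : ℕ) : ModerateOn (fun _ => K) fun ε t => iteratedDeriv k (u ε) t :=
  moderateOn_iff.2 (h K hK k)

theorem hasModerateGrowth_of {u : ℝ → ℝ → ℝ} (h : ∀ K : Set ℝ, IsCompact K → ∀ k,
    ModerateOn (fun _ => K) fun ε t => iteratedDeriv k (u ε) t) : HasModerateGrowth u :=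
  fun K hK k => moderateOn_iff.1 (h K hK k)

theorem isNegligible_iff {u : ℝ → ℝ → ℝ} :
    IsNegligible u ↔ ∀ K : Set ℝ, IsCompact K → NegligibleOn (fun _ => K) u :=
  forall₂_congr fun _ _ => negligibleOn_iff.symm

/-- A net of numbers is regarded as a net of functions on a dummy one-point set. -/
theorem isNegligibleNumber_iff {a : ℝ → ℝ} :
    IsNegligibleNumber a ↔ NegligibleOn (fun _ => {0}) fun ε _ => a ε := by
  rw [negligibleOn_iff]
  simp [IsNegligibleNumber]

/-- Functions of the state of a system `σ' = X₀(σ) + δ X₁(σ)` with moderate `δ` are moderate, as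
long as the state remains in a compact set. -/
theorem moderateOn_iteratedDeriv_of_forced {V : Type*} [NormedAddCommGroup V] [NormedSpace ℝ V]
    {Ω : Set V} (hΩ : IsOpen Ω) {X₀ X₁ : V → V} (hX₀ : ContDiffOn ℝ ∞ X₀ Ω)
    (hX₁ : ContDiffOn ℝ ∞ X₁ Ω) {Kc : Set V} (hKc : IsCompact Kc) (hKΩ : Kc ⊆ Ω)
    {σ : ℝ → ℝ → V} {δ : ℝ → ℝ → ℝ} {J : ℝ → Set ℝ}
    (hσ : ∀ᶠ ε in 𝓝[>] (0 : ℝ), ∀ t ∈ J ε, σ ε t ∈ Kc ∧ ContDiffAt ℝ ∞ (σ ε) t ∧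
      ContDiffAt ℝ ∞ (δ ε) t ∧
      ∀ᶠ s in 𝓝 t, HasDerivAt (σ ε) (X₀ (σ ε s) + δ ε s • X₁ (σ ε s)) s)
    (hδ : ∀ k, ModerateOn J fun ε t => iteratedDeriv k (δ ε) t) (k : ℕ) :
    ∀ h : V → ℝ, ContDiffOn ℝ ∞ h Ω →
      ModerateOn J fun ε t => iteratedDeriv k (fun s => h (σ ε s)) t := by
  -- The statement is proved for all h at once, since differentiating h(σ) yields the functions
  -- dh(X₀) and dh(X₁) of σ. All smaller orders occur because of the Leibniz rule for the product
  -- with δ.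
  induction k using Nat.strong_induction_on with
  | _ k ih =>
  intro h hh
  rcases k with - | k
  · obtain ⟨B, hB⟩ := hKc.exists_bound_of_continuousOn (hh.continuousOn.mono hKΩ)
    refine ModerateOn.of_bounded (B := B) ?_
    filter_upwards [hσ] with ε hε t ht
    simpa using hB _ (hε t ht).1
  · have hfd : ContDiffOn ℝ ∞ (fderiv ℝ h) Ω := hh.fderiv_of_isOpen hΩ (by simp)
    have hh₀ : ContDiffOn ℝ ∞ (fun p => fderiv ℝ h p (X₀ p)) Ω := hfd.clm_apply hX₀
    have hh₁ : ContDiffOn ℝ ∞ (fun p => fderiv ℝ h p (X₁ p)) Ω := hfd.clm_apply hX₁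
    have hmod : ModerateOn J fun ε t =>
        iteratedDeriv k (fun s => fderiv ℝ h (σ ε s) (X₀ (σ ε s))) t +
        ∑ i ∈ Finset.range (k + 1), (k.choose i : ℝ) * iteratedDeriv i (δ ε) t *
          iteratedDeriv (k - i) (fun s => fderiv ℝ h (σ ε s) (X₁ (σ ε s))) t := by
      refine (ih k k.lt_succ_self _ hh₀).add (ModerateOn.sum fun i _ => ?_)
      exact ((ModerateOn.of_bounded (B := k.choose i) (by simp)).mul (hδ i)).mul
        (ih (k - i) (by omega) _ hh₁)
    refine hmod.of_le ?_
    filter_upwards [hσ] with ε hε t ht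
    refine ⟨ht, le_of_eq ?_⟩
    obtain ⟨h1, h2, h3, h4⟩ := hε t ht
    have hΩt : Ω ∈ 𝓝 (σ ε t) := hΩ.mem_nhds (hKΩ h1)
    have hev : deriv (fun s => h (σ ε s)) =ᶠ[𝓝 t] fun s =>
        fderiv ℝ h (σ ε s) (X₀ (σ ε s)) + δ ε s * fderiv ℝ h (σ ε s) (X₁ (σ ε s)) := by
      filter_upwards [h4, h2.continuousAt.preimage_mem_nhds hΩt] with s hs hsΩ
      have h5 := (hh.contDiffAt (hΩ.mem_nhds hsΩ)).differentiableAt (by simp)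
      have h6 : deriv (fun s => h (σ ε s)) s = _ := (h5.hasFDerivAt.comp_hasDerivAt s hs).deriv
      rw [h6, map_add, map_smul, smul_eq_mul]
    have hc₀ : ContDiffAt ℝ k (fun s => fderiv ℝ h (σ ε s) (X₀ (σ ε s))) t :=
      ((hh₀.contDiffAt hΩt).comp t h2).of_le (mod_cast le_top)
    have hc₁ : ContDiffAt ℝ k (fun s => fderiv ℝ h (σ ε s) (X₁ (σ ε s))) t :=
      ((hh₁.contDiffAt hΩt).comp t h2).of_le (mod_cast le_top)
    have hcδ : ContDiffAt ℝ k (δ ε) t := h3.of_le (mod_cast le_top)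
    rw [iteratedDeriv_succ', hev.iteratedDeriv_eq, iteratedDeriv_fun_add hc₀ (hcδ.mul hc₁),
      iteratedDeriv_fun_mul hcδ hc₁]

/-! ### Moderateness of the reference net -/

/-- Compactness reduces L to finitely many of the sets W, and the exponents are added up. The set of
times at which y is in W may depend on ε. -/
theorem ModerateOn.of_cover {X : Type*} [TopologicalSpace X] {y : ℝ → ℝ → X} {L : Set X}
    (hL : IsCompact L) {J : ℝ → Set ℝ} (hy : ∀ᶠ ε in 𝓝[>] (0 : ℝ), ∀ t ∈ J ε, y ε t ∈ L)
    {a : ℝ → ℝ → ℝ}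
    (h : ∀ p ∈ L, ∃ W ∈ 𝓝 p, ModerateOn (fun ε => {t ∈ J ε | y ε t ∈ W}) a) : ModerateOn J a := by
  have key : ModerateOn (fun ε => {t ∈ J ε | y ε t ∈ L}) a := by
    refine hL.induction_on (p := fun s => ModerateOn (fun ε => {t ∈ J ε | y ε t ∈ s}) a) ?_ ?_ ?_ ?_
    · exact ⟨0, by simp⟩
    · intro s t hst ht
      exact ht.of_le (Eventually.of_forall fun ε r hr => ⟨⟨hr.1, hst hr.2⟩, le_rfl⟩)
    · rintro s t ⟨N, hN⟩ ⟨M, hM⟩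
      refine ⟨N + M, ?_⟩
      filter_upwards [hN, hM, eventually_le_inv 1] with ε h1 h2 h3 r hr
      rcases hr.2 with h4 | h4
      · exact (h1 r ⟨hr.1, h4⟩).trans (pow_le_pow_right₀ h3 (by omega))
      · exact (h2 r ⟨hr.1, h4⟩).trans (pow_le_pow_right₀ h3 (by omega))
    · intro p hp
      obtain ⟨W, hW, h1⟩ := h p hp
      exact ⟨W, mem_nhdsWithin_of_mem_nhds hW, h1⟩
  refine key.of_le ?_
  filter_upwards [hy] with ε h1 t ht using ⟨⟨ht, h1 t ht⟩, le_rfl⟩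

theorem NegligibleOn.of_cover {X : Type*} [TopologicalSpace X] {y : ℝ → ℝ → X} {L : Set X}
    (hL : IsCompact L) {J : ℝ → Set ℝ} (hy : ∀ᶠ ε in 𝓝[>] (0 : ℝ), ∀ t ∈ J ε, y ε t ∈ L)
    {a : ℝ → ℝ → ℝ}
    (h : ∀ p ∈ L, ∃ W ∈ 𝓝 p, NegligibleOn (fun ε => {t ∈ J ε | y ε t ∈ W}) a) :
    NegligibleOn J a := by
  have key : NegligibleOn (fun ε => {t ∈ J ε | y ε t ∈ L}) a := by
    refine hL.induction_on
      (p := fun s => NegligibleOn (fun ε => {t ∈ J ε | y ε t ∈ s}) a) ?_ ?_ ?_ ?_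
    · intro m
      simp
    · intro s t hst ht
      exact ht.of_le (Eventually.of_forall fun ε r hr => ⟨⟨hr.1, hst hr.2⟩, le_rfl⟩)
    · intro s t hs ht m
      filter_upwards [hs m, ht m] with ε h1 h2 r hr
      rcases hr.2 with h4 | h4
      · exact h1 r ⟨hr.1, h4⟩
      · exact h2 r ⟨hr.1, h4⟩
    · intro p hp
      obtain ⟨W, hW, h1⟩ := h p hp
      exact ⟨W, mem_nhdsWithin_of_mem_nhds hW, h1⟩
  refine key.of_le ?_
  filter_upwards [hy] with ε h1 t ht using ⟨⟨ht, h1 t ht⟩, le_rfl⟩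

section Charts

variable {n : ℕ} {N : Type*} [TopologicalSpace N] [ChartedSpace (EuclideanSpace ℝ (Fin n)) N]

local notation "𝔼" => EuclideanSpace ℝ (Fin n)

theorem norm_le_sum_abs (w : 𝔼) : ‖w‖ ≤ ∑ i, |w i| := by
  conv_lhs => rw [sum_coord_smul_single w]
  refine (norm_sum_le _ _).trans (Finset.sum_le_sum fun i _ => ?_)
  rw [norm_smul, PiLp.norm_single, norm_one, mul_one, Real.norm_eq_abs]

theorem deriv_coord {z : ℝ → 𝔼} {t : ℝ} (hz : DifferentiableAt ℝ z t) (i : Fin n) :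
    deriv (fun s => z s i) t = deriv z t i :=
  ((EuclideanSpace.proj i : 𝔼 →L[ℝ] ℝ).hasFDerivAt.comp_hasDerivAt t hz.hasDerivAt).deriv

variable [IsManifold (𝓡 n) ∞ N]

/-- Smooth functions of the coordinates extend from a compact set to the manifold. -/
theorem exists_global_extension [T2Space N] {e : OpenPartialHomeomorph N 𝔼}
    (he : e ∈ IsManifold.maximalAtlas (𝓡 n) ∞ N) {K U : Set 𝔼} (hK : IsCompact K) (hU : IsOpen U)
    (hKU : K ⊆ U) (hUe : U ⊆ e.target) {h : 𝔼 → ℝ} (hh : ContDiffOn ℝ ∞ h e.target) :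
    ∃ g : N → ℝ, ContMDiff (𝓡 n) 𝓘(ℝ, ℝ) ∞ g ∧ (∀ x ∈ e.source, e x ∈ K → g x = h (e x)) ∧
      ∀ x, g x ≠ 0 → x ∈ e.source ∧ e x ∈ U := by
  classical
  obtain ⟨χ, hχ, hχc, hχs, hχ1⟩ := exists_cutoff hU hK hKU
  refine ⟨fun x => if x ∈ e.source then χ (e x) * h (e x) else 0, fun x => ?_,
    fun x hx hxK => by simp [hx, hχ1 _ hxK], fun x hx => ?_⟩
  · by_cases hx : x ∈ e.source
    · have h1 : ContMDiffAt (𝓡 n) 𝓘(ℝ, ℝ) ∞ (fun x => χ (e x) * h (e x)) x := by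
        have h2 : ContDiffAt ℝ ∞ (fun z => χ z * h z) (e x) :=
          hχ.contDiffAt.mul (hh.contDiffAt (e.open_target.mem_nhds (e.map_source hx)))
        exact (contMDiffAt_iff_contDiffAt.2 h2).comp x (contMDiffAt_of_mem_maximalAtlas he hx)
      refine h1.congr_of_eventuallyEq ?_
      filter_upwards [e.open_source.mem_nhds hx] with y hy
      simp [hy]
    -- The image of the support is compact, hence closed in the Hausdorff space N. Off the chart
    -- domain the function vanishes near each point.
    · have hcl : IsClosed (e.symm '' tsupport χ) :=
        (hχc.isCompact.image_of_continuousOn (e.continuousOn_symm.mono (hχs.trans hUe))).isClosed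
      refine (contMDiffAt_const (c := (0 : ℝ))).congr_of_eventuallyEq ?_
      have hxn : x ∉ e.symm '' tsupport χ := by
        rintro ⟨z, hz, rfl⟩
        exact hx (e.map_target (hUe (hχs hz)))
      filter_upwards [hcl.isOpen_compl.mem_nhds hxn] with y hy
      split_ifs with hys
      · have : e y ∉ tsupport χ := fun h1 => hy ⟨e y, h1, e.left_inv hys⟩
        rw [image_eq_zero_of_notMem_tsupport this, zero_mul]
      · rfl
  · simp only [ne_eq, ite_eq_right_iff, Classical.not_imp] at hx
    exact ⟨hx.1, hχs (subset_tsupport χ (left_ne_zero_of_mul hx.2))⟩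

theorem deriv_comp_eq_fderiv_chart {g : N → ℝ} (hg : ContMDiff (𝓡 n) 𝓘(ℝ, ℝ) ∞ g)
    {e : OpenPartialHomeomorph N 𝔼} (he : e ∈ IsManifold.maximalAtlas (𝓡 n) ∞ N) {x : ℝ → N} {t : ℝ}
    (hx : ContMDiffAt 𝓘(ℝ, ℝ) (𝓡 n) ∞ x t) (ht : x t ∈ e.source) :
    deriv (fun s => g (x s)) t =
      fderiv ℝ (fun z => g (e.symm z)) (e (x t)) (deriv (fun s => e (x s)) t) := by
  have h1 : (fun s => g (x s)) =ᶠ[𝓝 t] fun s => g (e.symm (e (x s))) := by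
    filter_upwards [hx.continuousAt.preimage_mem_nhds (e.open_source.mem_nhds ht)] with s hs
    rw [e.left_inv hs]
  have h2 := ((contDiffOn_comp_chart_symm he hg).contDiffAt
    (e.open_target.mem_nhds (e.map_source ht))).differentiableAt (by simp)
  have h3 := ((contDiffAt_chart_comp he hx ht).differentiableAt (by simp)).hasDerivAt
  rw [h1.deriv_eq]
  exact (h2.hasFDerivAt.comp_hasDerivAt (f := fun s => e (x s)) t h3).deriv

theorem diffAlong_eq_deriv {g : N → ℝ} (hg : ContMDiff (𝓡 n) 𝓘(ℝ, ℝ) ∞ g) {x : ℝ → N} {t : ℝ}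
    (hx : ContMDiffAt 𝓘(ℝ, ℝ) (𝓡 n) ∞ x t) :
    diffAlong (n := n) g x t = deriv (fun s => g (x s)) t := by
  have h1 := ((hg (x t)).mdifferentiableAt (by simp)).hasMFDerivAt.comp t
    (hx.mdifferentiableAt (by simp)).hasMFDerivAt
  have h2 := h1.mfderiv
  rw [mfderiv_eq_fderiv] at h2
  change _ = fderiv ℝ (g ∘ x) t 1
  rw [h2]
  rfl

/-- Bounds for the derivatives of smooth functions along a net of curves give bounds for its
velocities in charts. -/
theorem exists_velocity_bound [T2Space N] {y : ℝ → ℝ → N} {U : Set ℝ} {K : Set ℝ}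
    (hy : ∀ ε ∈ U, ∀ t, ContMDiffAt 𝓘(ℝ, ℝ) (𝓡 n) ∞ (y ε) t)
    (hb : ∀ g : N → ℝ, ContMDiff (𝓡 n) 𝓘(ℝ, ℝ) ∞ g →
          ∃ B, ∀ ε ∈ U, ∀ t ∈ K, |deriv (fun t => g (y ε t)) t| ≤ B)
    {e : OpenPartialHomeomorph N 𝔼} (he : e ∈ IsManifold.maximalAtlas (𝓡 n) ∞ N) {Kz : Set 𝔼}
    (hKz : IsCompact Kz) (hKe : Kz ⊆ e.target) :
    ∃ B, ∀ ε ∈ U, ∀ t ∈ K, y ε t ∈ e.source → e (y ε t) ∈ Kz →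
      ‖deriv (fun s => e (y ε s)) t‖ ≤ B := by
  -- A slightly larger compact set is used so that the global function equals the coordinate near
  -- the point, and not just at it. Only then do the derivatives agree.
  obtain ⟨K', hK', hKK', hK'e⟩ := exists_compact_between hKz e.open_target hKe
  have h : ∀ i : Fin n, ∃ B, ∀ ε ∈ U, ∀ t ∈ K, y ε t ∈ e.source → e (y ε t) ∈ Kz →
      |deriv (fun s => e (y ε s)) t i| ≤ B := by
    intro i
    obtain ⟨g, hg, hge, -⟩ := exists_global_extension he hK' e.open_target hK'e subset_rfl
      (h := fun z => z i) (EuclideanSpace.proj i : 𝔼 →L[ℝ] ℝ).contDiff.contDiffOn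
    obtain ⟨B, hB⟩ := hb g hg
    refine ⟨B, fun ε hε t ht hte htK => ?_⟩
    have hc := contDiffAt_chart_comp he (hy ε hε t) hte
    rw [← deriv_coord (hc.differentiableAt (by simp))]
    have hev : (fun s => g (y ε s)) =ᶠ[𝓝 t] fun s => e (y ε s) i := by
      filter_upwards [(hy ε hε t).continuousAt.preimage_mem_nhds (e.open_source.mem_nhds hte),
        hc.continuousAt.preimage_mem_nhds (isOpen_interior.mem_nhds (hKK' htK))] with s hs1 hs2
      exact hge _ hs1 (interior_subset hs2)
    rw [← hev.deriv_eq]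
    exact hB ε hε t ht
  choose B hB using h
  exact ⟨∑ i, B i, fun ε hε t ht h1 h2 => (norm_le_sum_abs _).trans
    (Finset.sum_le_sum fun i _ => hB i ε hε t ht h1 h2)⟩

variable [RiemannianBundle (fun p : N => TangentSpace (𝓡 n) p)]
  [IsContMDiffRiemannianBundle (𝓡 n) ∞ (EuclideanSpace ℝ (Fin n))
      (fun p : N => TangentSpace (𝓡 n) p)]

/-- In a chart, (v, p, position, velocity) solves a first order system affine in δ and stays in a
compact set, so `moderateOn_iteratedDeriv_of_forced` applies to ψ. The compact set L permits the
passage from charts to the manifold. -/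
theorem moderateOn_reference_net [T2Space N] {f : N → ℝ}
    (hf : ContMDiff (𝓡 n) 𝓘(ℝ, ℝ) ∞ f) {δ : ℝ → ℝ → ℝ} {κ : ℝ} (hκ : 0 < κ)
    (hδs : ∀ ε ∈ Ioo 0 κ, ContDiff ℝ ∞ (δ ε)) (hδ : HasModerateGrowth δ) {y : ℝ → ℝ → N}
    (hy : ∀ ε ∈ Ioo 0 κ, IsSol (n := n) f (δ ε) (y ε) univ) {v p : ℝ → ℝ → ℝ}
    (hvs : ∀ ε ∈ Ioo 0 κ, ContDiff ℝ ∞ (v ε)) (hps : ∀ ε ∈ Ioo 0 κ, ContDiff ℝ ∞ (p ε))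
    (hvp : ∀ ε ∈ Ioo 0 κ, ∀ t, HasDerivAt (v ε) (p ε t - 1 / 2 * f (y ε t) * δ ε t) t ∧
      HasDerivAt (p ε) (-(1 / 2) * deriv (fun s => f (y ε s)) t * δ ε t) t)
    {K : Set ℝ} (hK : IsCompact K) {L : Set N} (hL : IsCompact L)
    (hyL : ∀ ε ∈ Ioo 0 κ, ∀ t ∈ K, y ε t ∈ L)
    (hb : ∀ g : N → ℝ, ContMDiff (𝓡 n) 𝓘(ℝ, ℝ) ∞ g →
      ∃ B, ∀ ε ∈ Ioo 0 κ, ∀ t ∈ K, |deriv (fun t => g (y ε t)) t| ≤ B)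
    (hvpb : ∃ B, ∀ ε ∈ Ioo 0 κ, ∀ t ∈ K, |v ε t| ≤ B ∧ |p ε t| ≤ B) {ψ : ℝ × N → ℝ}
    (hψ : ContMDiff (𝓘(ℝ, ℝ).prod (𝓡 n)) 𝓘(ℝ, ℝ) ∞ ψ) (k : ℕ) :
    ModerateOn (fun _ => K) fun ε t => iteratedDeriv k (fun s => ψ (v ε s, y ε s)) t := by
  have hys : ∀ ε ∈ Ioo 0 κ, ∀ t, ContMDiffAt 𝓘(ℝ, ℝ) (𝓡 n) ∞ (y ε) t := fun ε hε t =>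
    (hy ε hε).1.contMDiffAt univ_mem
  refine ModerateOn.of_cover hL (y := y) ?_ fun q hq => ?_
  · filter_upwards [eventually_small hκ] with ε hε using hyL ε hε
  set e := chartAt 𝔼 q
  have he : e ∈ IsManifold.maximalAtlas (𝓡 n) ∞ N := IsManifold.chart_mem_maximalAtlas _
  have hqe : q ∈ e.source := mem_chart_source 𝔼 _
  obtain ⟨r, hr, hrb⟩ := Metric.nhds_basis_closedBall.mem_iff.1
    (e.open_target.mem_nhds (e.map_source hqe))
  refine ⟨e.source ∩ e ⁻¹' Metric.closedBall (e q) r, inter_mem (e.open_source.mem_nhds hqe)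
    ((e.continuousAt hqe).preimage_mem_nhds (Metric.closedBall_mem_nhds _ hr)), ?_⟩
  obtain ⟨Bw, hBw⟩ := exists_velocity_bound hys hb he (isCompact_closedBall (e q) r) hrb
  obtain ⟨B, hB⟩ := hvpb
  set Ω : Set (ℝ × ℝ × 𝔼 × 𝔼) := univ ×ˢ univ ×ˢ e.target ×ˢ univ with hΩdef
  have hΩ : IsOpen Ω := isOpen_univ.prod (isOpen_univ.prod (e.open_target.prod isOpen_univ))
  set Kc : Set (ℝ × ℝ × 𝔼 × 𝔼) := Metric.closedBall 0 B ×ˢ Metric.closedBall 0 B ×ˢ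
    Metric.closedBall (e q) r ×ˢ Metric.closedBall 0 Bw with hKcdef
  have hKc : IsCompact Kc := (isCompact_closedBall _ _).prod ((isCompact_closedBall _ _).prod
    ((isCompact_closedBall _ _).prod (isCompact_closedBall _ _)))
  have hKcΩ : Kc ⊆ Ω := prod_mono (subset_univ _) (prod_mono (subset_univ _)
    (prod_mono hrb (subset_univ _)))
  set X₀ : ℝ × ℝ × 𝔼 × 𝔼 → ℝ × ℝ × 𝔼 × 𝔼 := fun c =>
    (c.2.1, 0, c.2.2.2, chartAccel e c.2.2.1 c.2.2.2) with hX₀def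
  set X₁ : ℝ × ℝ × 𝔼 × 𝔼 → ℝ × ℝ × 𝔼 × 𝔼 := fun c =>
    (-(1 / 2) * f (e.symm c.2.2.1),
      -(1 / 2) * fderiv ℝ (fun z => f (e.symm z)) c.2.2.1 c.2.2.2, 0,
      chartHalfGrad e f c.2.2.1) with hX₁def
  have hzs : ContDiffOn ℝ ∞ (fun c : ℝ × ℝ × 𝔼 × 𝔼 => c.2.2.1) Ω :=
    (contDiff_fst.comp (contDiff_snd.comp contDiff_snd)).contDiffOn
  have hws : ContDiffOn ℝ ∞ (fun c : ℝ × ℝ × 𝔼 × 𝔼 => c.2.2.2) Ω :=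
    (contDiff_snd.comp (contDiff_snd.comp contDiff_snd)).contDiffOn
  have hzm : MapsTo (fun c : ℝ × ℝ × 𝔼 × 𝔼 => c.2.2.1) Ω e.target := fun c hc => hc.2.2.1
  have hfe := contDiffOn_comp_chart_symm he hf
  have hX₀ : ContDiffOn ℝ ∞ X₀ Ω := by
    refine (contDiff_fst.comp contDiff_snd).contDiffOn.prodMk (contDiffOn_const.prodMk
      (hws.prodMk ?_))
    exact (contDiffOn_chartAccel he).comp (hzs.prodMk hws) fun c hc => ⟨hzm hc, mem_univ _⟩
  have hX₁ : ContDiffOn ℝ ∞ X₁ Ω := by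
    refine (contDiffOn_const.mul (hfe.comp hzs hzm)).prodMk ((contDiffOn_const.mul ?_).prodMk
      (contDiffOn_const.prodMk ((contDiffOn_chartHalfGrad he hf).comp hzs hzm)))
    exact ((hfe.fderiv_of_isOpen (m := ∞) e.open_target (by simp)).comp hzs hzm).clm_apply hws
  set σ : ℝ → ℝ → ℝ × ℝ × 𝔼 × 𝔼 := fun ε t => (v ε t, p ε t, phase e (y ε) t) with hσdef
  have hh : ContDiffOn ℝ ∞ (fun c : ℝ × ℝ × 𝔼 × 𝔼 => ψ (c.1, e.symm c.2.2.1)) Ω := by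
    rw [← contMDiffOn_iff_contDiffOn]
    refine hψ.comp_contMDiffOn (ContMDiffOn.prodMk ?_ ?_)
    · exact contMDiffOn_iff_contDiffOn.2 contDiff_fst.contDiffOn
    · exact (contMDiffOn_symm_of_mem_maximalAtlas he).comp
        (contMDiffOn_iff_contDiffOn.2 hzs) hzm
  set J : ℝ → Set ℝ := fun ε =>
    {t ∈ K | y ε t ∈ e.source ∩ e ⁻¹' Metric.closedBall (e q) r} with hJ
  have hσ : ∀ᶠ ε in 𝓝[>] (0 : ℝ), ∀ t ∈ J ε, σ ε t ∈ Kc ∧ ContDiffAt ℝ ∞ (σ ε) t ∧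
      ContDiffAt ℝ ∞ (δ ε) t ∧
      ∀ᶠ s in 𝓝 t, HasDerivAt (σ ε) (X₀ (σ ε s) + δ ε s • X₁ (σ ε s)) s := by
    filter_upwards [eventually_small hκ] with ε hε t ht
    obtain ⟨htK, hte, htz⟩ := ht
    refine ⟨⟨?_, ?_, htz, ?_⟩, ?_, (hδs ε hε).contDiffAt, ?_⟩
    · simpa using (hB ε hε t htK).1
    · simpa using (hB ε hε t htK).2
    · exact mem_closedBall_zero_iff.2 (hBw ε hε t htK hte htz)
    · exact (hvs ε hε).contDiffAt.prodMk ((hps ε hε).contDiffAt.prodMk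
        (contDiffAt_phase he (hys ε hε t) hte))
    · filter_upwards [(hys ε hε t).continuousAt.preimage_mem_nhds
        (e.open_source.mem_nhds hte)] with s hs
      have h1 := hasDerivAt_phase isOpen_univ (hy ε hε) he (mem_univ s) hs
      refine ((hvp ε hε s).1.prodMk ((hvp ε hε s).2.prodMk h1)).congr_deriv ?_
      rw [deriv_comp_eq_fderiv_chart hf he (hys ε hε s) hs]
      simp only [hX₀def, hX₁def, hσdef, phase, phaseField, Prod.smul_mk, Prod.mk_add_mk,
        e.left_inv hs, smul_eq_mul, smul_zero, add_zero, zero_add, Prod.mk.injEq, and_true]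
      constructor <;> ring
  have key := moderateOn_iteratedDeriv_of_forced hΩ hX₀ hX₁ hKc hKcΩ hσ (fun k =>
    (hδ.moderateOn hK k).of_le (Eventually.of_forall fun ε t ht => ⟨ht.1, le_rfl⟩)) k _ hh
  refine key.of_le ?_
  filter_upwards [eventually_small hκ] with ε hε t ht
  refine ⟨ht, le_of_eq (congrArg _root_.abs (Filter.EventuallyEq.iteratedDeriv_eq k ?_))⟩
  filter_upwards [(hys ε hε t).continuousAt.preimage_mem_nhds
    (e.open_source.mem_nhds ht.2.1)] with s hs
  simp only [hσdef, phase]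
  rw [e.left_inv hs]

end Charts

/-! ### Existence of a solution -/

/-- A smooth cutoff of the parameter: the identity near `0`, with values in `(0, κ)`. -/
theorem exists_reparametrization {κ : ℝ} (hκ : 0 < κ) :
    ∃ χ : ℝ → ℝ, ContDiff ℝ ∞ χ ∧ (∀ ε, 0 < ε → χ ε ∈ Ioo 0 κ) ∧
      ∀ᶠ ε in 𝓝[>] (0 : ℝ), χ ε = ε := by
  let θ : ContDiffBump (0 : ℝ) := ⟨κ / 4, κ / 2, by positivity, by linarith⟩
  -- A convex combination of ε and κ / 4; the weight of ε is nonzero only for ε < κ / 2, so the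
  -- value lies in (0, κ).
  refine ⟨fun ε => ε * θ ε + κ / 4 * (1 - θ ε), ?_, fun ε hε => ?_, ?_⟩
  · exact (contDiff_id.mul θ.contDiff).add (contDiff_const.mul (contDiff_const.sub θ.contDiff))
  · by_cases h : ε < κ / 2
    · have h0 := θ.nonneg (x := ε)
      have h1 := θ.le_one (x := ε)
      constructor
      · rcases h0.eq_or_lt with h2 | h2
        · simp only [← h2]
          linarith
        · nlinarith [mul_pos hε h2, mul_nonneg hκ.le (sub_nonneg.2 h1)]
      · nlinarith [mul_nonneg h0 (sub_nonneg.2 h.le), mul_nonneg hκ.le (sub_nonneg.2 h1)]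
    · have h0 : θ ε = 0 := θ.zero_of_le_dist (by
        rw [Real.dist_eq, sub_zero, abs_of_pos hε]
        exact not_lt.1 h)
      simp only [h0]
      constructor <;> linarith
  · filter_upwards [eventually_small (show 0 < κ / 4 by positivity)] with ε hε
    have h1 : θ ε = 1 := θ.one_of_mem_closedBall (by
      rw [mem_closedBall_zero_iff, Real.norm_eq_abs, abs_of_pos hε.1]
      exact hε.2.le)
    simp [h1]

theorem IsStrictDeltaNet.eq_zero {δ : ℝ → ℝ → ℝ} (h : IsStrictDeltaNet δ) {ε : ℝ}
    (hε : ε ∈ Ioc (0 : ℝ) 1) {t : ℝ} (ht : t ∉ Ioo (-ε) ε) : δ ε t = 0 :=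
  image_eq_zero_of_notMem_tsupport fun h' => ht (h.support_subset ε hε h')

theorem IsStrictDeltaNet.exists_bound {δ : ℝ → ℝ → ℝ} (h : IsStrictDeltaNet δ)
    (hc : ∀ ε ∈ Ioc (0 : ℝ) 1, Continuous (δ ε)) :
    ∃ C, ∀ ε ∈ Ioc (0 : ℝ) 1, ∀ s t, s ≤ t → ∫ r in s..t, |δ ε r| ≤ C := by
  obtain ⟨C, -, hC⟩ := h.bounded_L1
  refine ⟨C, fun ε hε s t hst => le_trans ?_ (hC ε hε)⟩
  rw [intervalIntegral.integral_of_le hst]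
  refine setIntegral_le_integral ?_ (Eventually.of_forall fun r => abs_nonneg _)
  refine (hc ε hε).abs.integrable_of_hasCompactSupport ?_
  refine HasCompactSupport.intro (isCompact_Icc (a := -ε) (b := ε)) fun t ht => ?_
  rw [h.eq_zero hε fun h' => ht (Ioo_subset_Icc_self h'), abs_zero]

theorem IsSmoothNet.contDiffOn {u : ℝ → ℝ → ℝ} (h : IsSmoothNet 𝓘(ℝ, ℝ) u) :
    ContDiffOn ℝ ∞ (fun q : ℝ × ℝ => u q.1 q.2) (Ioc (0 : ℝ) 1 ×ˢ univ) :=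
  contMDiffOn_iff_contDiffOn.1 h

section Existence

variable {n : ℕ} {N : Type*} [MetricSpace N] [ChartedSpace (EuclideanSpace ℝ (Fin n)) N]
  [RiemannianBundle (fun p : N => TangentSpace (𝓡 n) p)]

local notation "𝔼" => EuclideanSpace ℝ (Fin n)

/-- Exact solutions of the geodesic system for the parameters `ε < κ`, with uniform bounds. -/
structure IsReferenceNet (f : N → ℝ) (δ : ℝ → ℝ → ℝ) (v₀ v₁ : ℝ) (x₀ : N) (x₁ : 𝔼) (κ : ℝ)
    (v p : ℝ → ℝ → ℝ) (y : ℝ → ℝ → N) : Prop where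
  isSol : ∀ ε ∈ Ioo 0 κ, IsSol (n := n) f (δ ε) (y ε) univ
  hasDerivAt : ∀ ε ∈ Ioo 0 κ, ∀ t, HasDerivAt (v ε) (p ε t - 1 / 2 * f (y ε t) * δ ε t) t ∧
      HasDerivAt (p ε) (-(1 / 2) * deriv (fun s => f (y ε s)) t * δ ε t) t
  init_v : ∀ ε ∈ Ioo 0 κ, v ε (-1) = v₀ ∧ p ε (-1) = v₁ ∧ δ ε (-1) = 0
  init_x : ∀ ε ∈ Ioo 0 κ, y ε (-1) = x₀ ∧ (velocity (n := n) (y ε) (-1) : 𝔼) = x₁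
  smooth_y : ContMDiffOn 𝓘(ℝ, ℝ × ℝ) (𝓡 n) ∞ (fun q : ℝ × ℝ => y q.1 q.2) (Ioo 0 κ ×ˢ univ)
  smooth_v : ContDiffOn ℝ ∞ (fun q : ℝ × ℝ => v q.1 q.2) (Ioo 0 κ ×ˢ univ)
  smooth_p : ContDiffOn ℝ ∞ (fun q : ℝ × ℝ => p q.1 q.2) (Ioo 0 κ ×ˢ univ)
  compact : ∀ T : ℝ, ∃ L : Set N, IsCompact L ∧ ∀ ε ∈ Ioo 0 κ, ∀ t ∈ Icc (-T) T, y ε t ∈ L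
  bound_y : ∀ T : ℝ, ∀ g : N → ℝ, ContMDiff (𝓡 n) 𝓘(ℝ, ℝ) ∞ g →
      ∃ B, ∀ ε ∈ Ioo 0 κ, ∀ t ∈ Icc (-T) T, |deriv (fun t => g (y ε t)) t| ≤ B
  bound_v : ∀ T : ℝ, ∃ B, ∀ ε ∈ Ioo 0 κ, ∀ t ∈ Icc (-T) T, |v ε t| ≤ B ∧ |p ε t| ≤ B

theorem IsReferenceNet.contMDiffAt {f : N → ℝ} {δ : ℝ → ℝ → ℝ} {v₀ v₁ : ℝ} {x₀ : N} {x₁ : 𝔼}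
    {κ : ℝ} {v p : ℝ → ℝ → ℝ} {y : ℝ → ℝ → N} (h : IsReferenceNet f δ v₀ v₁ x₀ x₁ κ v p y) {ε : ℝ}
    (hε : ε ∈ Ioo 0 κ) (t : ℝ) : ContMDiffAt 𝓘(ℝ, ℝ) (𝓡 n) ∞ (y ε) t :=
  (h.isSol ε hε).1.contMDiffAt univ_mem

theorem contDiff_comp_curve {g : N → ℝ} (hg : ContMDiff (𝓡 n) 𝓘(ℝ, ℝ) ∞ g) {x : ℝ → N}
    (hx : ∀ t, ContMDiffAt 𝓘(ℝ, ℝ) (𝓡 n) ∞ x t) : ContDiff ℝ ∞ fun t => g (x t) := by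
  rw [← contMDiff_iff_contDiff]
  exact hg.comp hx

theorem totalSpace_eq {p q : N} {u : TangentSpace (𝓡 n) p} {w : TangentSpace (𝓡 n) q} (h : p = q)
    (h' : (u : 𝔼) = (w : 𝔼)) : (⟨p, u⟩ : TangentBundle (𝓡 n) N) = ⟨q, w⟩ := by
  subst h
  exact congrArg _ h'

variable [IsManifold (𝓡 n) ∞ N]
  [IsContMDiffRiemannianBundle (𝓡 n) ∞ (EuclideanSpace ℝ (Fin n))
      (fun p : N => TangentSpace (𝓡 n) p)]

theorem velocity_congr {x y : ℝ → N} {t : ℝ} (hx : ContMDiffAt 𝓘(ℝ, ℝ) (𝓡 n) ∞ x t)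
    (hy : ContMDiffAt 𝓘(ℝ, ℝ) (𝓡 n) ∞ y t) (h : x =ᶠ[𝓝 t] y) :
    (velocity (n := n) x t : 𝔼) = (velocity (n := n) y t : 𝔼) := by
  have he : chartAt 𝔼 (x t) ∈ IsManifold.maximalAtlas (𝓡 n) ∞ N :=
    IsManifold.chart_mem_maximalAtlas _
  have hxe := mem_chart_source 𝔼 (x t)
  have h1 := phase_congr (e := chartAt 𝔼 (x t)) h
  rw [velocity_eq_chartLift he hx hxe, velocity_eq_chartLift he hy (h.eq_of_nhds ▸ hxe)]
  rw [phase, phase, Prod.mk.injEq] at h1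
  rw [h1.1, h1.2]

theorem exists_referenceNet [IsRiemannianManifold (𝓡 n) N] [CompleteSpace N] {f : N → ℝ}
    (hf : ContMDiff (𝓡 n) 𝓘(ℝ, ℝ) ∞ f) {δ : ModerateNet} (hδ : IsStrictDeltaNet δ.1)
    (v₀ v₁ : ℝ) (x₀ : N) (x₁ : 𝔼) :
    ∃ κ ∈ Ioo (0 : ℝ) 1, ∃ v p y, IsReferenceNet f δ.1 v₀ v₁ x₀ x₁ κ v p y := by
  have hδs := δ.2.1.contDiffOn
  obtain ⟨C, hC⟩ := hδ.exists_bound fun ε hε => (contDiff_of_net hδs hε).continuous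
  have hsub : Ioo (0 : ℝ) 1 ⊆ Ioc 0 1 := Ioo_subset_Ioc_self
  obtain ⟨κ, hκ, y, γ, hγ, hγ0, hγ1, hy, hys, hyb⟩ := exists_forced_net hf
    (hδs.mono (prod_mono hsub subset_rfl)) (fun ε hε t ht => hδ.eq_zero (hsub hε) ht)
    (fun ε hε => hC ε (hsub hε)) x₀ x₁
  have hκsub : Ioo 0 κ ⊆ Ioc (0 : ℝ) 1 := fun ε hε => ⟨hε.1, hε.2.le.trans hκ.2.le⟩
  obtain ⟨v, p, hv, hp, hvp, hvpb⟩ := exists_driven_net isOpen_Ioo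
    (g := fun ε t => f (y ε t)) (δ := δ.1) (U := Ioo 0 κ)
    (contMDiffOn_iff_contDiffOn.1 (hf.comp_contMDiffOn hys))
    (hδs.mono (prod_mono hκsub subset_rfl)) (fun ε hε => hC ε (hκsub hε)) (fun T => by
      obtain ⟨L, hL, hyL⟩ := (hyb T).1
      obtain ⟨B, hB⟩ := hL.exists_bound_of_continuousOn hf.continuous.continuousOn
      exact ⟨B, fun ε hε t ht => hB _ (hyL ε hε t ht)⟩) (fun T => (hyb T).2 f hf) v₀ v₁
  refine ⟨κ, hκ, v, p, y, fun ε hε => (hy ε hε).1, fun ε hε => (hvp ε hε).2.2, fun ε hε =>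
    ⟨(hvp ε hε).1, (hvp ε hε).2.1, hδ.eq_zero (hκsub hε) fun h => ?_⟩, fun ε hε => ⟨?_, ?_⟩, hys,
    hv, hp, fun T => (hyb T).1, fun T => (hyb T).2, hvpb⟩
  · linarith [h.1, hε.2, hκ.2]
  · rw [(hy ε hε).2.eq_of_nhds, hγ0]
  · rw [← hγ1]
    exact velocity_congr ((hy ε hε).1.1.contMDiffAt univ_mem) (hγ.1.contMDiffAt univ_mem)
      (hy ε hε).2

/-- The reference net, reparametrized so as to be defined for all `ε ∈ (0, 1]`, is a solution. -/
theorem IsReferenceNet.exists_solution {f : N → ℝ} (hf : ContMDiff (𝓡 n) 𝓘(ℝ, ℝ) ∞ f)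
    {δ : ModerateNet} {v₀ v₁ : ℝ} {x₀ : N} {x₁ : TangentSpace (𝓡 n) x₀} {κ : ℝ} (hκ : κ ∈ Ioo (0 : ℝ) 1)
    {v p : ℝ → ℝ → ℝ} {y : ℝ → ℝ → N} (h : IsReferenceNet f δ.1 v₀ v₁ x₀ x₁ κ v p y) :
    ∃ w : ModerateMapNet (𝓘(ℝ, ℝ).prod (𝓡 n)) (ℝ × N),
      (∀ᶠ ε in 𝓝[>] (0 : ℝ), w.1 ε = fun t => (v ε t, y ε t)) ∧
      IsGeodesicSolution f ⟦δ⟧ v₀ v₁ x₀ x₁ (⟦w⟧ : GenMap (𝓘(ℝ, ℝ).prod (𝓡 n)) (ℝ × N)) := by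
  obtain ⟨χ, hχ, hχκ, hχid⟩ := exists_reparametrization hκ.1
  set u : ℝ → ℝ → ℝ × N := fun ε t => (v (χ ε) t, y (χ ε) t) with hu
  have hev : ∀ᶠ ε in 𝓝[>] (0 : ℝ), u ε = fun t => (v ε t, y ε t) := by
    filter_upwards [hχid] with ε hε
    simp only [hu, hε]
  have hδs := δ.2.1.contDiffOn
  have hδε : ∀ ε ∈ Ioo 0 κ, ContDiff ℝ ∞ (δ.1 ε) := fun ε hε =>
    contDiff_of_net hδs ⟨hε.1, hε.2.le.trans hκ.2.le⟩
  have hvε : ∀ ε ∈ Ioo 0 κ, ContDiff ℝ ∞ (v ε) := fun ε hε => contDiff_of_net h.smooth_v hε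
  have hpε : ∀ ε ∈ Ioo 0 κ, ContDiff ℝ ∞ (p ε) := fun ε hε => contDiff_of_net h.smooth_p hε
  have hsmall := eventually_small hκ.1
  have hsm : IsSmoothNet (𝓘(ℝ, ℝ).prod (𝓡 n)) u := by
    have hc : ContDiffOn ℝ ∞ (fun q : ℝ × ℝ => (χ q.1, q.2)) (Ioc 0 1 ×ˢ univ) :=
      ((hχ.comp contDiff_fst).prodMk contDiff_snd).contDiffOn
    have hm : MapsTo (fun q : ℝ × ℝ => (χ q.1, q.2)) (Ioc 0 1 ×ˢ univ) (Ioo 0 κ ×ˢ univ) :=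
      fun q hq => ⟨hχκ q.1 hq.1.1, mem_univ _⟩
    refine ContMDiffOn.prodMk ?_ ?_
    · exact contMDiffOn_iff_contDiffOn.2 (h.smooth_v.comp hc hm)
    · exact h.smooth_y.comp (contMDiffOn_iff_contDiffOn.2 hc) hm
  have hmod : ∀ ψ : ℝ × N → ℝ, ContMDiff (𝓘(ℝ, ℝ).prod (𝓡 n)) 𝓘(ℝ, ℝ) ∞ ψ →
      HasModerateGrowth fun ε t => ψ (u ε t) := by
    intro ψ hψ
    refine hasModerateGrowth_of fun K hK k => ?_
    obtain ⟨T, hT⟩ := hK.isBounded.subset_closedBall 0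
    rw [Real.closedBall_eq_Icc, zero_sub, zero_add] at hT
    obtain ⟨L, hL, hyL⟩ := h.compact T
    have := moderateOn_reference_net hf hκ.1 hδε δ.2.2 h.isSol hvε hpε h.hasDerivAt
      (isCompact_Icc (a := -T) (b := T)) hL hyL (h.bound_y T) (h.bound_v T) hψ k
    refine this.of_le ?_
    filter_upwards [hev] with ε hε t ht
    exact ⟨hT ht, by rw [hε]⟩
  refine ⟨⟨u, hsm, hmod⟩, hev, δ, ⟨u, hsm, hmod⟩, rfl, rfl, ?_, ?_, ?_, ?_, ?_⟩
  · intro K _ m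
    refine ⟨0, ?_⟩
    filter_upwards [hev, hsmall] with ε hε hεκ t _
    simp only [hε]
    rw [diffAlong_eq_deriv hf (h.contMDiffAt hεκ t)]
    have h1 : deriv (v ε) = fun t => p ε t - 1 / 2 * f (y ε t) * δ.1 ε t :=
      funext fun t => (h.hasDerivAt ε hεκ t).1.deriv
    have h2 : DifferentiableAt ℝ (fun s => f (y ε s)) t :=
      (contDiff_comp_curve hf (h.contMDiffAt hεκ)).differentiable (by simp) t
    have h3 : DifferentiableAt ℝ (δ.1 ε) t := (hδε ε hεκ).differentiable (by simp) t
    -- Differentiating v' = p - ½ f(y) δ returns the right-hand side of the second order equation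
    -- exactly. The defect is 0 for small ε, which is why the constant in the estimate is 0.
    have h4 := (h.hasDerivAt ε hεκ t).2.sub ((h2.hasDerivAt.const_mul (1 / 2)).mul h3.hasDerivAt)
    have h5 : deriv (fun t => p ε t - 1 / 2 * f (y ε t) * δ.1 ε t) t = _ := h4.deriv
    rw [h1, h5]
    refine le_of_eq ?_
    rw [zero_mul, abs_eq_zero]
    ring
  · intro e he L _ hLe k K _ m
    refine ⟨0, ?_⟩
    filter_upwards [hev, hsmall] with ε hε hεκ t _ htL
    simp only [hε] at htL ⊢
    have hs : y ε t ∈ e.source := hLe htL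
    have h1 := (h.isSol ε hεκ).2 t (mem_univ t) e he hs
    rw [chartEqAt_iff_covAccel (contDiffAt_chart_comp he (h.contMDiffAt hεκ t) hs)] at h1
    rw [h1 k]
    simp
  · intro m
    refine ⟨0, ?_⟩
    filter_upwards [hev, hsmall] with ε hε hεκ
    simp [hε, (h.init_v ε hεκ).1]
  · intro m
    refine ⟨0, ?_⟩
    filter_upwards [hev, hsmall] with ε hε hεκ
    simp only [hε]
    obtain ⟨-, h2, h3⟩ := h.init_v ε hεκ
    rw [(h.hasDerivAt ε hεκ (-1)).1.deriv, h2, h3]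
    simp
  · intro ψ _ m
    refine ⟨0, ?_⟩
    filter_upwards [hev, hsmall] with ε hε hεκ
    rw [hε, totalSpace_eq (h.init_x ε hεκ).1 (h.init_x ε hεκ).2]
    simp

end Existence

/-! ### Estimates for the uniqueness proof -/

/-- Gronwall's inequality for a differential inequality that holds only below the threshold `1`. -/
theorem gronwall_of_lt_one {f f' k : ℝ → ℝ} {a b η I : ℝ} (hab : a ≤ b) (hk : Continuous k)
    (hk0 : ∀ t, 0 ≤ k t) (hη : 0 < η) (hf : ∀ t ∈ Icc a b, HasDerivAt f (f' t) t) (ha : f a ≤ η)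
    (hf' : ∀ t ∈ Ico a b, f t < 1 → f' t ≤ k t * f t + η) (hI : ∫ t in a..b, k t ≤ I)
    (hsmall : 2 * η * (1 + (b - a)) * Real.exp I < 1) :
    ∀ t ∈ Icc a b, f t ≤ 2 * η * (1 + (b - a)) * Real.exp I := by
  have hK : ∀ t, HasDerivAt (fun t => ∫ s in a..t, k s) (k t) t := fun t =>
    intervalIntegral.integral_hasDerivAt_right (hk.intervalIntegrable _ _)
      (hk.stronglyMeasurableAtFilter _ _) hk.continuousAt
  -- The barrier solves B' = k B + 2η exp(∫ k). The factor 2 makes it strictly steeper than f can be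
  -- where the two meet, and since B < 1 the differential inequality is available there.
  set B : ℝ → ℝ := fun t => 2 * η * (1 + (t - a)) * Real.exp (∫ s in a..t, k s) with hBdef
  have hB : ∀ t, HasDerivAt B (2 * η * Real.exp (∫ s in a..t, k s) + k t * B t) t := by
    intro t
    have h1 := ((((hasDerivAt_id t).sub_const a).const_add 1).const_mul (2 * η)).mul (hK t).exp
    refine h1.congr_deriv ?_
    simp only [hBdef, id]
    ring
  have hBle : ∀ t ∈ Icc a b, B t ≤ 2 * η * (1 + (b - a)) * Real.exp I := by
    intro t ht
    have h1 : ∫ s in a..t, k s ≤ I := by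
      refine le_trans ?_ hI
      rw [← intervalIntegral.integral_add_adjacent_intervals (hk.intervalIntegrable a t)
        (hk.intervalIntegrable t b)]
      linarith [intervalIntegral.integral_nonneg (μ := volume) ht.2 fun s _ => hk0 s]
    have h2 : 0 ≤ 1 + (t - a) := by linarith [ht.1]
    exact mul_le_mul (mul_le_mul_of_nonneg_left (by linarith [ht.2]) (by positivity))
      (Real.exp_le_exp.2 h1) (Real.exp_pos _).le
      (mul_nonneg (by positivity) (by linarith [ht.1, ht.2]))
  have key : ∀ ⦃t⦄, t ∈ Icc a b → f t ≤ B t := by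
    refine image_le_of_deriv_right_lt_deriv_boundary'
      (fun t ht => (hf t ht).continuousAt.continuousWithinAt)
      (fun t ht => (hf t ⟨ht.1, ht.2.le⟩).hasDerivWithinAt) ?_
      (fun t _ => (hB t).continuousAt.continuousWithinAt) (fun t _ => (hB t).hasDerivWithinAt) ?_
    · simp only [hBdef, sub_self, add_zero, mul_one, intervalIntegral.integral_same, Real.exp_zero]
      linarith
    · intro t ht hft
      have h1 : f t < 1 := by
        rw [hft]
        exact (hBle t ⟨ht.1, ht.2.le⟩).trans_lt hsmall
      have h2 : 1 ≤ Real.exp (∫ s in a..t, k s) :=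
        Real.one_le_exp (intervalIntegral.integral_nonneg ht.1 fun s _ => hk0 s)
      have h3 := hf' t ht h1
      rw [hft] at h3
      nlinarith
  exact fun t ht => (key ht).trans (hBle t ht)

/-- A two-sided version of Gronwall's inequality, starting from `-1`. -/
theorem gronwall_two_sided {f f' k : ℝ → ℝ} {T η I : ℝ} (hT : 1 ≤ T) (hk : Continuous k)
    (hk0 : ∀ t, 0 ≤ k t) (hη : 0 < η) (hf : ∀ t ∈ Icc (-T) T, HasDerivAt f (f' t) t)
    (h0 : f (-1) ≤ η) (hf' : ∀ t ∈ Icc (-T) T, f t < 1 → |f' t| ≤ k t * f t + η)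
    (hI : ∫ t in (-T)..T, k t ≤ I) (hsmall : 2 * η * (1 + 2 * T) * Real.exp I < 1) :
    ∀ t ∈ Icc (-T) T, f t ≤ 2 * η * (1 + 2 * T) * Real.exp I := by
  have hsplit : (∫ t in (-T)..(-1), k t) + ∫ t in (-1)..T, k t = ∫ t in (-T)..T, k t :=
    intervalIntegral.integral_add_adjacent_intervals (hk.intervalIntegrable _ _)
      (hk.intervalIntegrable _ _)
  have hn1 : 0 ≤ ∫ t in (-T)..(-1), k t :=
    intervalIntegral.integral_nonneg (by linarith) fun s _ => hk0 s
  have hn2 : 0 ≤ ∫ t in (-1)..T, k t :=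
    intervalIntegral.integral_nonneg (by linarith) fun s _ => hk0 s
  have hle : ∀ l, 0 ≤ l → l ≤ 2 * T →
      2 * η * (1 + l) * Real.exp I ≤ 2 * η * (1 + 2 * T) * Real.exp I := fun l h1 h2 => by gcongr
  intro t ht
  rcases le_total (-1) t with h | h
  · have hle1 := hle (T - -1) (by linarith) (by linarith)
    refine (gronwall_of_lt_one (a := -1) (b := T) (by linarith) hk hk0 hη
      (fun s hs => hf s ⟨by linarith [hs.1], hs.2⟩) h0 (fun s hs h1 =>
        (le_abs_self _).trans (hf' s ⟨by linarith [hs.1], hs.2.le⟩ h1)) (by linarith)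
      (hle1.trans_lt hsmall) t ⟨h, ht.2⟩).trans hle1
  · have hle1 := hle (T - 1) (by linarith) (by linarith)
    have hI' : ∫ t in (1)..T, k (-t) ≤ I := by
      rw [intervalIntegral.integral_comp_neg]
      linarith
    -- Times before -1 are reached by reflection, which moves the initial time to 1.
    have := gronwall_of_lt_one (f := fun s => f (-s)) (f' := fun s => -f' (-s))
      (k := fun s => k (-s)) (a := 1) (b := T) hT (hk.comp continuous_neg) (fun s => hk0 _) hη
      (fun s hs => by
        have h1 := (hf (-s) ⟨by linarith [hs.2], by linarith [hs.1]⟩).comp s (hasDerivAt_neg s)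
        exact h1.congr_deriv (by ring)) h0 (fun s hs h1 =>
        (neg_le_abs _).trans (hf' (-s) ⟨by linarith [hs.2], by linarith [hs.1]⟩ h1)) hI'
      (hle1.trans_lt hsmall) (-t) ⟨by linarith, by linarith [ht.1]⟩
    simp only [neg_neg] at this
    exact this.trans hle1

/-! ### Lipschitz comparison of exact and approximate solutions. -/

section Lipschitz

variable {V : Type*} [NormedAddCommGroup V] [NormedSpace ℝ V]

theorem exists_lipschitz_bound {W : Type*} [NormedAddCommGroup W] [NormedSpace ℝ W] {Ω K : Set V}
    (hΩ : IsOpen Ω) {q : V → W} (hq : ContDiffOn ℝ ∞ q Ω) (hK : IsCompact K) (hKc : Convex ℝ K)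
    (hKΩ : K ⊆ Ω) : ∃ M, 0 ≤ M ∧ ∀ c ∈ K, ∀ b ∈ K, ‖q c - q b‖ ≤ M * ‖c - b‖ := by
  obtain ⟨M, hM⟩ := hK.exists_bound_of_continuousOn
    ((hq.continuousOn_fderiv_of_isOpen hΩ (by simp)).mono hKΩ)
  refine ⟨max M 0, le_max_right _ _, fun c hc b hb => ?_⟩
  exact hKc.norm_image_sub_le_of_norm_fderiv_le
    (fun x hx => (hq.contDiffAt (hΩ.mem_nhds (hKΩ hx))).differentiableAt (by simp))
    (fun x hx => (hM x hx).trans (le_max_left _ _)) hb hc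

/-- The derivatives of q along two curves are compared. Splitting off (d' - d) F₁ leaves the
Lipschitz term multiplied by |d|, the forcing of the reference curve, which is the one known to be
bounded in L¹. -/
theorem exists_derivative_bound {Ω K : Set V} (hΩ : IsOpen Ω) {F₀ F₁ : V → V}
    (hF₀ : ContDiffOn ℝ ∞ F₀ Ω) (hF₁ : ContDiffOn ℝ ∞ F₁ Ω) (hK : IsCompact K) (hKc : Convex ℝ K)
    (hKΩ : K ⊆ Ω) {q : V → ℝ} (hq : ContDiffOn ℝ ∞ q Ω) :
    ∃ M, 0 ≤ M ∧ ∀ c ∈ K, ∀ b ∈ K, ∀ (d d' : ℝ) (ρ : V),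
      |fderiv ℝ q c (F₀ c + d' • F₁ c + ρ) - fderiv ℝ q b (F₀ b + d • F₁ b)| ≤
        M * ((1 + |d|) * ‖c - b‖ + |d' - d| + ‖ρ‖) := by
  have hdq : ContDiffOn ℝ ∞ (fderiv ℝ q) Ω := hq.fderiv_of_isOpen hΩ (by simp)
  obtain ⟨M₀, h₀, hM₀⟩ := exists_lipschitz_bound hΩ (hdq.clm_apply hF₀) hK hKc hKΩ
  obtain ⟨M₁, h₁, hM₁⟩ := exists_lipschitz_bound hΩ (hdq.clm_apply hF₁) hK hKc hKΩ
  obtain ⟨M₂, hM₂⟩ := hK.exists_bound_of_continuousOn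
    ((hdq.clm_apply hF₁).continuousOn.mono hKΩ)
  obtain ⟨M₃, hM₃⟩ := hK.exists_bound_of_continuousOn (hdq.continuousOn.mono hKΩ)
  refine ⟨M₀ + M₁ + |M₂| + |M₃|, by positivity, fun c hc b hb d d' ρ => ?_⟩
  have e1 : fderiv ℝ q c (F₀ c + d' • F₁ c + ρ) - fderiv ℝ q b (F₀ b + d • F₁ b) =
      (fderiv ℝ q c (F₀ c) - fderiv ℝ q b (F₀ b)) +
      d * (fderiv ℝ q c (F₁ c) - fderiv ℝ q b (F₁ b)) + (d' - d) * fderiv ℝ q c (F₁ c) +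
      fderiv ℝ q c ρ := by
    simp only [map_add, map_smul, smul_eq_mul]
    ring
  have a0 := hM₀ c hc b hb
  have a1 : |d * (fderiv ℝ q c (F₁ c) - fderiv ℝ q b (F₁ b))| ≤ |d| * (M₁ * ‖c - b‖) := by
    rw [abs_mul]
    exact mul_le_mul_of_nonneg_left (hM₁ c hc b hb) (abs_nonneg _)
  have a2 : |(d' - d) * fderiv ℝ q c (F₁ c)| ≤ |d' - d| * |M₂| := by
    rw [abs_mul]
    exact mul_le_mul_of_nonneg_left ((hM₂ c hc).trans (le_abs_self _)) (abs_nonneg _)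
  have a3 : |fderiv ℝ q c ρ| ≤ |M₃| * ‖ρ‖ := ((fderiv ℝ q c).le_opNorm ρ).trans
    (mul_le_mul_of_nonneg_right ((hM₃ c hc).trans (le_abs_self _)) (norm_nonneg _))
  rw [Real.norm_eq_abs] at a0
  rw [e1]
  refine (abs_add_le _ _).trans ((add_le_add_left ((abs_add_le _ _).trans
    (add_le_add_left (abs_add_le _ _) _)) _).trans ?_)
  have p1 : 0 ≤ ‖c - b‖ := norm_nonneg _
  have p2 : 0 ≤ ‖ρ‖ := norm_nonneg _
  have p3 : 0 ≤ |d' - d| := abs_nonneg _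
  have p4 : 0 ≤ |d| * ‖c - b‖ := mul_nonneg (abs_nonneg _) p1
  have q2 := abs_nonneg M₂
  have q3 := abs_nonneg M₃
  have : M₀ * ‖c - b‖ + |d| * (M₁ * ‖c - b‖) + |d' - d| * |M₂| + |M₃| * ‖ρ‖ ≤
      (M₀ + M₁ + |M₂| + |M₃|) * ((1 + |d|) * ‖c - b‖ + |d' - d| + ‖ρ‖) := by
    have e2 : (M₀ + M₁ + |M₂| + |M₃|) * ((1 + |d|) * ‖c - b‖ + |d' - d| + ‖ρ‖) -
        (M₀ * ‖c - b‖ + |d| * (M₁ * ‖c - b‖) + |d' - d| * |M₂| + |M₃| * ‖ρ‖) =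
        (M₁ + |M₂| + |M₃|) * ‖c - b‖ + (M₀ + |M₂| + |M₃|) * (|d| * ‖c - b‖) +
        (M₀ + M₁ + |M₃|) * |d' - d| + (M₀ + M₁ + |M₂|) * ‖ρ‖ := by ring
    have : 0 ≤ (M₁ + |M₂| + |M₃|) * ‖c - b‖ + (M₀ + |M₂| + |M₃|) * (|d| * ‖c - b‖) +
        (M₀ + M₁ + |M₃|) * |d' - d| + (M₀ + M₁ + |M₂|) * ‖ρ‖ := by positivity
    linarith
  linarith

end Lipschitz

section Charts

variable {n : ℕ} {N : Type*} [TopologicalSpace N] [ChartedSpace (EuclideanSpace ℝ (Fin n)) N]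
  [RiemannianBundle (fun p : N => TangentSpace (𝓡 n) p)] [IsManifold (𝓡 n) ∞ N]
  [IsContMDiffRiemannianBundle (𝓡 n) ∞ (EuclideanSpace ℝ (Fin n))
      (fun p : N => TangentSpace (𝓡 n) p)]

local notation "𝔼" => EuclideanSpace ℝ (Fin n)

/-- The defect of a curve with respect to the forced geodesic equation, in a chart. -/
def chartDefect (f : N → ℝ) (e : OpenPartialHomeomorph N 𝔼) (d : ℝ) (x : ℝ → N) (t : ℝ) : 𝔼 :=
  deriv (deriv fun s => e (x s)) t - chartAccel e (e (x t)) (deriv (fun s => e (x s)) t) -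
    d • chartHalfGrad e f (e (x t))

/-- Any smooth curve follows the forced phase field up to its defect. The value d is arbitrary
because the defect compensates for it. -/
theorem deriv_phase_function {f : N → ℝ} {e : OpenPartialHomeomorph N 𝔼}
    (he : e ∈ IsManifold.maximalAtlas (𝓡 n) ∞ N) {x : ℝ → N} {t : ℝ}
    (hx : ContMDiffAt 𝓘(ℝ, ℝ) (𝓡 n) ∞ x t) (hte : x t ∈ e.source) (d : ℝ) {q : 𝔼 × 𝔼 → ℝ}
    (hq : ContDiffOn ℝ ∞ q (e.target ×ˢ univ)) {u : ℝ → ℝ}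
    (hu : u =ᶠ[𝓝 t] fun s => q (phase e x s)) :
    deriv u t = fderiv ℝ q (phase e x t) (geodField e (phase e x t) +
      d • ((0 : 𝔼), chartHalfGrad e f (e (x t))) + ((0 : 𝔼), chartDefect f e d x t)) := by
  have hz := contDiffAt_chart_comp he hx hte
  have h1 : HasDerivAt (phase e x) (deriv (fun s => e (x s)) t, deriv (deriv fun s => e (x s)) t) t :=
    (hz.differentiableAt (by simp)).hasDerivAt.prodMk
      ((contDiffAt_deriv hz).differentiableAt (by simp)).hasDerivAt
  have h2 := (hq.contDiffAt ((e.open_target.prod isOpen_univ).mem_nhds (x := phase e x t)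
    ⟨e.map_source hte, mem_univ _⟩)).differentiableAt (by simp)
  rw [hu.deriv_eq]
  have h3 : deriv (fun s => q (phase e x s)) t = _ := (h2.hasFDerivAt.comp_hasDerivAt t h1).deriv
  rw [h3]
  congr 1
  simp [geodField, phaseField, chartDefect, phase]

/-- Comparison of a solution of the forced geodesic equation with an approximate solution, in a
chart. -/
theorem exists_chart_comparison {f : N → ℝ} (hf : ContMDiff (𝓡 n) 𝓘(ℝ, ℝ) ∞ f)
    {e : OpenPartialHomeomorph N 𝔼} (he : e ∈ IsManifold.maximalAtlas (𝓡 n) ∞ N) {K : Set 𝔼}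
    (hK : IsCompact K) (hKc : Convex ℝ K) (hKe : K ⊆ e.target) (R : ℝ) {G : N → ℝ}
    (hG : ContMDiff (𝓡 n) 𝓘(ℝ, ℝ) ∞ G) :
    ∃ M, 0 ≤ M ∧ ∀ (x y : ℝ → N) (t d d' : ℝ), ContMDiffAt 𝓘(ℝ, ℝ) (𝓡 n) ∞ x t →
      ContMDiffAt 𝓘(ℝ, ℝ) (𝓡 n) ∞ y t → x t ∈ e.source → y t ∈ e.source → e (x t) ∈ K →
      e (y t) ∈ K → ‖deriv (fun s => e (x s)) t‖ ≤ R → ‖deriv (fun s => e (y s)) t‖ ≤ R →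
      ChartEqAt f e d y t →
      |deriv (fun s => G (x s)) t - deriv (fun s => G (y s)) t| ≤
        M * ((1 + |d|) * ‖phase e x t - phase e y t‖ + |d' - d| + ‖chartDefect f e d' x t‖) ∧
      |deriv (deriv fun s => G (x s)) t - deriv (deriv fun s => G (y s)) t| ≤
        M * ((1 + |d|) * ‖phase e x t - phase e y t‖ + |d' - d| + ‖chartDefect f e d' x t‖) := by
  have hGe := contDiffOn_comp_chart_symm he hG
  have hΩ : IsOpen (e.target ×ˢ (univ : Set 𝔼)) := e.open_target.prod isOpen_univ
  have hm : MapsTo (fun c : 𝔼 × 𝔼 => c.1) (e.target ×ˢ univ) e.target := fun c hc => hc.1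
  -- Along a curve, G and its first time derivative are functions q₀ and q₁ of the phase. One bound
  -- for derivatives of phase functions therefore yields the first and the second derivative of G
  -- along the curve.
  have hq₀ : ContDiffOn ℝ ∞ (fun c : 𝔼 × 𝔼 => G (e.symm c.1)) (e.target ×ˢ univ) :=
    hGe.comp contDiff_fst.contDiffOn hm
  have hq₁ : ContDiffOn ℝ ∞ (fun c : 𝔼 × 𝔼 => fderiv ℝ (fun z => G (e.symm z)) c.1 c.2)
      (e.target ×ˢ univ) :=
    ((hGe.fderiv_of_isOpen (m := ∞) e.open_target (by simp)).comp contDiff_fst.contDiffOn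
      hm).clm_apply contDiff_snd.contDiffOn
  have hF₁ : ContDiffOn ℝ ∞ (fun c : 𝔼 × 𝔼 => ((0 : 𝔼), chartHalfGrad e f c.1))
      (e.target ×ˢ univ) :=
    contDiffOn_const.prodMk ((contDiffOn_chartHalfGrad he hf).comp contDiff_fst.contDiffOn hm)
  have hKK : IsCompact (K ×ˢ Metric.closedBall (0 : 𝔼) R) := hK.prod (isCompact_closedBall _ _)
  have hKKc : Convex ℝ (K ×ˢ Metric.closedBall (0 : 𝔼) R) := hKc.prod (convex_closedBall _ _)
  have hKKe : K ×ˢ Metric.closedBall (0 : 𝔼) R ⊆ e.target ×ˢ univ :=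
    prod_mono hKe (subset_univ _)
  obtain ⟨M₀, h₀, hM₀⟩ := exists_derivative_bound hΩ (contDiffOn_geodField he) hF₁ hKK hKKc hKKe hq₀
  obtain ⟨M₁, h₁, hM₁⟩ := exists_derivative_bound hΩ (contDiffOn_geodField he) hF₁ hKK hKKc hKKe hq₁
  refine ⟨M₀ + M₁, by positivity, fun x y t d d' hx hy hxe hye hxK hyK hxR hyR hyeq => ?_⟩
  have hcx : phase e x t ∈ K ×ˢ Metric.closedBall (0 : 𝔼) R :=
    ⟨hxK, mem_closedBall_zero_iff.2 hxR⟩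
  have hcy : phase e y t ∈ K ×ˢ Metric.closedBall (0 : 𝔼) R :=
    ⟨hyK, mem_closedBall_zero_iff.2 hyR⟩
  have hdy : chartDefect f e d y t = 0 := by
    rw [chartDefect, sub_sub, sub_eq_zero]
    exact hyeq
  have hev : ∀ {x : ℝ → N}, ContMDiffAt 𝓘(ℝ, ℝ) (𝓡 n) ∞ x t → x t ∈ e.source →
      (∀ᶠ s in 𝓝 t, G (x s) = G (e.symm (phase e x s).1)) ∧
      ∀ᶠ s in 𝓝 t, deriv (fun s => G (x s)) s =
        fderiv ℝ (fun z => G (e.symm z)) (phase e x s).1 (phase e x s).2 := by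
    intro x hx hxe
    have hz := contDiffAt_chart_comp he hx hxe
    have h1 : ∀ᶠ s in 𝓝 t, x s ∈ e.source :=
      hx.continuousAt.preimage_mem_nhds (e.open_source.mem_nhds hxe)
    have h2 : ∀ᶠ s in 𝓝 t, G (x s) = G (e.symm (phase e x s).1) := by
      filter_upwards [h1] with s hs
      rw [phase, e.left_inv hs]
    refine ⟨h2, ?_⟩
    have h3 : ∀ᶠ s in 𝓝 t, ContDiffAt ℝ 1 (fun s => e (x s)) s :=
      (hz.of_le (by simp)).eventually (by simp)
    filter_upwards [h1, h3, h2.eventually_nhds] with s hs hs3 hs2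
    have h4 := (hGe.contDiffAt (e.open_target.mem_nhds (e.map_source hs))).differentiableAt
      (by simp)
    have h5 := (hs3.differentiableAt (by simp)).hasDerivAt
    rw [EventuallyEq.deriv_eq hs2]
    exact (h4.hasFDerivAt.comp_hasDerivAt (f := fun s => e (x s)) s h5).deriv
  obtain ⟨hx0, hx1⟩ := hev hx hxe
  obtain ⟨hy0, hy1⟩ := hev hy hye
  have hn : ‖((0 : 𝔼), chartDefect f e d' x t)‖ = ‖chartDefect f e d' x t‖ := by
    simp [Prod.norm_def]
  have hS : 0 ≤ (1 + |d|) * ‖phase e x t - phase e y t‖ + |d' - d| + ‖chartDefect f e d' x t‖ := by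
    positivity
  constructor
  · rw [deriv_phase_function (f := f) he hx hxe d' hq₀ hx0,
      deriv_phase_function (f := f) he hy hye d hq₀ hy0, hdy, Prod.mk_zero_zero, add_zero, ← hn]
    refine (hM₀ _ hcx _ hcy d d' _).trans ?_
    rw [hn]
    exact mul_le_mul_of_nonneg_right (by linarith) hS
  · rw [deriv_phase_function (f := f) he hx hxe d' hq₁ hx1,
      deriv_phase_function (f := f) he hy hye d hq₁ hy1, hdy, Prod.mk_zero_zero, add_zero, ← hn]
    refine (hM₁ _ hcx _ hcy d d' _).trans ?_
    rw [hn]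
    exact mul_le_mul_of_nonneg_right (by linarith) hS

end Charts

/-! ### Uniqueness of the geodesic component -/

section Charts

variable {n : ℕ} {N : Type*} [TopologicalSpace N] [ChartedSpace (EuclideanSpace ℝ (Fin n)) N]

local notation "𝔼" => EuclideanSpace ℝ (Fin n)

/-- Smooth functions on `N` which control the position relative to the chart at `p`: a cutoff
function and extensions of the coordinates. -/
structure IsChartControl (p : N) (r : ℝ) (Φ : Option (Fin n) → N → ℝ) : Prop where
  pos : 0 < r
  subset : Metric.closedBall (chartAt 𝔼 p p) (2 * r) ⊆ (chartAt 𝔼 p).target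
  smooth : ∀ j, ContMDiff (𝓡 n) 𝓘(ℝ, ℝ) ∞ (Φ j)
  eq_one : ∀ x ∈ (chartAt 𝔼 p).source, chartAt 𝔼 p x ∈ Metric.closedBall (chartAt 𝔼 p p) r →
    Φ none x = 1
  of_ne_zero : ∀ x, Φ none x ≠ 0 → x ∈ (chartAt 𝔼 p).source ∧
    chartAt 𝔼 p x ∈ Metric.ball (chartAt 𝔼 p p) (2 * r)
  coord : ∀ i, ∀ x ∈ (chartAt 𝔼 p).source,
    chartAt 𝔼 p x ∈ Metric.closedBall (chartAt 𝔼 p p) (2 * r) → Φ (some i) x = chartAt 𝔼 p x i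

/-- A neighborhood of `p` given by a ball in the chart at `p`. -/
def chartNhd (p : N) (r : ℝ) : Set N :=
  (chartAt 𝔼 p).source ∩ chartAt 𝔼 p ⁻¹' Metric.closedBall (chartAt 𝔼 p p) r

theorem chartNhd_mem_nhds (p : N) {r : ℝ} (hr : 0 < r) : chartNhd (n := n) p r ∈ 𝓝 p :=
  inter_mem ((chartAt 𝔼 p).open_source.mem_nhds (mem_chart_source 𝔼 p))
    (((chartAt 𝔼 p).continuousAt (mem_chart_source 𝔼 p)).preimage_mem_nhds
      (Metric.closedBall_mem_nhds _ hr))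

variable [IsManifold (𝓡 n) ∞ N]

theorem exists_isChartControl [T2Space N] (p : N) : ∃ r Φ, IsChartControl (n := n) p r Φ := by
  set e := chartAt 𝔼 p with hedef
  have he : e ∈ IsManifold.maximalAtlas (𝓡 n) ∞ N := IsManifold.chart_mem_maximalAtlas _
  obtain ⟨R, hR, hRe⟩ := Metric.nhds_basis_closedBall.mem_iff.1
    (e.open_target.mem_nhds (e.map_source (mem_chart_source 𝔼 p)))
  have h2 : Metric.closedBall (e p) (2 * (R / 2)) ⊆ e.target := by
    rwa [mul_div_cancel₀ R two_ne_zero]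
  obtain ⟨ρ, hρ, hρ1, hρ0⟩ := exists_global_extension he (isCompact_closedBall (e p) (R / 2))
    Metric.isOpen_ball (Metric.closedBall_subset_ball (show R / 2 < 2 * (R / 2) by linarith))
    (Metric.ball_subset_closedBall.trans h2) (h := fun _ => 1) contDiffOn_const
  choose g hg hge _ using fun i : Fin n => exists_global_extension he
    (isCompact_closedBall (e p) (2 * (R / 2))) e.open_target h2 subset_rfl
    (h := fun z => z i) (EuclideanSpace.proj i : 𝔼 →L[ℝ] ℝ).contDiff.contDiffOn
  refine ⟨R / 2, fun j => j.elim ρ g, by positivity, h2, ?_, hρ1, hρ0, hge⟩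
  rintro (_ | i)
  exacts [hρ, hg i]

theorem contMDiff_comp_proj {G : N → ℝ} (hG : ContMDiff (𝓡 n) 𝓘(ℝ, ℝ) ∞ G) :
    ContMDiff (𝓡 n).tangent 𝓘(ℝ, ℝ) ∞ (fun q : TangentBundle (𝓡 n) N => G q.1) :=
  hG.comp (Bundle.contMDiff_proj (TangentSpace (𝓡 n)))

/-- This is the test function on the tangent bundle through which the initial condition controls the
derivative of G along the curve. -/
theorem contMDiff_mfderiv_apply {G : N → ℝ} (hG : ContMDiff (𝓡 n) 𝓘(ℝ, ℝ) ∞ G) :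
    ContMDiff (𝓡 n).tangent 𝓘(ℝ, ℝ) ∞
      (fun q : TangentBundle (𝓡 n) N => (mfderiv (𝓡 n) 𝓘(ℝ, ℝ) G q.1 q.2 : ℝ)) :=
  contMDiff_snd_tangentBundle_modelSpace ℝ 𝓘(ℝ, ℝ) |>.comp (hG.contMDiff_tangentMap (m := ∞) (by simp))

/-- The cutoff equals 1 at y, so a value at x less than 1 away from it is nonzero. In this way
closeness of function values forces x into the chart of y. -/
theorem IsChartControl.mem_source {p : N} {r : ℝ} {Φ : Option (Fin n) → N → ℝ}
    (h : IsChartControl (n := n) p r Φ) {x y : N} (hy : y ∈ chartNhd (n := n) p r)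
    (hxy : |Φ none x - Φ none y| < 1) : x ∈ (chartAt 𝔼 p).source ∧
      chartAt 𝔼 p x ∈ Metric.ball (chartAt 𝔼 p p) (2 * r) := by
  refine h.of_ne_zero x fun h0 => ?_
  rw [h0, h.eq_one y hy.1 hy.2] at hxy
  norm_num at hxy

theorem IsChartControl.chartNhd_subset {p : N} {r : ℝ} {Φ : Option (Fin n) → N → ℝ}
    (h : IsChartControl (n := n) p r Φ) {y : N} (hy : y ∈ chartNhd (n := n) p r) :
    y ∈ (chartAt 𝔼 p).source ∧ chartAt 𝔼 p y ∈ Metric.ball (chartAt 𝔼 p p) (2 * r) :=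
  ⟨hy.1, Metric.closedBall_subset_ball (by linarith [h.pos]) hy.2⟩

theorem IsChartControl.deriv_coord {p : N} {r : ℝ} {Φ : Option (Fin n) → N → ℝ}
    (h : IsChartControl (n := n) p r Φ) {x : ℝ → N} {t : ℝ}
    (hx : ContMDiffAt 𝓘(ℝ, ℝ) (𝓡 n) ∞ x t) (hxe : x t ∈ (chartAt 𝔼 p).source)
    (hxb : chartAt 𝔼 p (x t) ∈ Metric.ball (chartAt 𝔼 p p) (2 * r)) (i : Fin n) :
    deriv (fun s => Φ (some i) (x s)) t = deriv (fun s => chartAt 𝔼 p (x s)) t i := by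
  have hc := contDiffAt_chart_comp (IsManifold.chart_mem_maximalAtlas p) hx hxe
  rw [← Colombeau.deriv_coord (hc.differentiableAt (by simp))]
  refine EventuallyEq.deriv_eq ?_
  filter_upwards [hx.continuousAt.preimage_mem_nhds ((chartAt 𝔼 p).open_source.mem_nhds hxe),
    hc.continuousAt.preimage_mem_nhds (Metric.isOpen_ball.mem_nhds hxb)] with s hs1 hs2
  exact h.coord i _ hs1 (Metric.ball_subset_closedBall hs2)

/-- The distance in phase space is controlled by the controlling functions. -/
theorem IsChartControl.phase_bounds {p : N} {r : ℝ} {Φ : Option (Fin n) → N → ℝ}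
    (h : IsChartControl (n := n) p r Φ) {x y : ℝ → N} {t s : ℝ}
    (hx : ContMDiffAt 𝓘(ℝ, ℝ) (𝓡 n) ∞ x t) (hy : ContMDiffAt 𝓘(ℝ, ℝ) (𝓡 n) ∞ y t)
    (hyp : y t ∈ chartNhd (n := n) p r) (h1 : |Φ none (x t) - Φ none (y t)| < 1)
    (h0 : ∀ j, |Φ j (x t) - Φ j (y t)| ≤ s)
    (h0' : ∀ j, |deriv (fun s => Φ j (x s)) t - deriv (fun s => Φ j (y s)) t| ≤ s) :
    ‖phase (chartAt 𝔼 p) x t - phase (chartAt 𝔼 p) y t‖ ≤ n * s := by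
  obtain ⟨hxe, hxb⟩ := h.mem_source hyp h1
  obtain ⟨hye, hyb⟩ := h.chartNhd_subset hyp
  have key : ∀ w : 𝔼, (∀ i, |w i| ≤ s) → ‖w‖ ≤ n * s := fun w hw =>
    (norm_le_sum_abs w).trans ((Finset.sum_le_sum fun i _ => hw i).trans (by simp))
  refine max_le (key _ fun i => ?_) (key _ fun i => ?_)
  · have := h0 (some i)
    rwa [h.coord i _ hxe (Metric.ball_subset_closedBall hxb),
      h.coord i _ hye (Metric.ball_subset_closedBall hyb)] at this
  · have := h0' (some i)
    rwa [h.deriv_coord hx hxe hxb, h.deriv_coord hy hye hyb] at this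

variable [RiemannianBundle (fun p : N => TangentSpace (𝓡 n) p)]
  [IsContMDiffRiemannianBundle (𝓡 n) ∞ (EuclideanSpace ℝ (Fin n))
      (fun p : N => TangentSpace (𝓡 n) p)]

theorem SolvesX.negligibleOn_chartDefect {f : N → ℝ} {δ : ℝ → ℝ → ℝ} {x : ℝ → ℝ → N}
    (h : SolvesX (n := n) f δ x) {κ : ℝ} (hκ : 0 < κ)
    (hx : ∀ ε ∈ Ioo 0 κ, ∀ t, ContMDiffAt 𝓘(ℝ, ℝ) (𝓡 n) ∞ (x ε) t)
    {e : OpenPartialHomeomorph N 𝔼} (he : e ∈ IsManifold.maximalAtlas (𝓡 n) ∞ N) {L : Set N}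
    (hL : IsCompact L) (hLe : L ⊆ e.source) {K : Set ℝ} (hK : IsCompact K) :
    NegligibleOn (fun ε => {t ∈ K | x ε t ∈ L})
      fun ε t => ‖chartDefect f e (δ ε t) (x ε) t‖ := by
  have h1 : ∀ k ∈ Finset.univ, NegligibleOn (fun ε => {t ∈ K | x ε t ∈ L})
      fun ε t => |chartDefect f e (δ ε t) (x ε) t k| := by
    intro k _
    refine (negligibleOn_iff.2 fun m => ?_ : NegligibleOn (fun ε => {t ∈ K | x ε t ∈ L}) (fun ε t =>
      covAccel e (x ε) k t - (1 / 2 : ℝ) * gradCoord e f k (e (x ε t)) * δ ε t)).of_le ?_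
    · obtain ⟨C, hC⟩ := h e he L hL hLe k K hK m
      exact ⟨C, hC.mono fun ε hε t ht => hε t ht.1 ht.2⟩
    · filter_upwards [eventually_small hκ] with ε hε t ht
      refine ⟨ht, le_of_eq ?_⟩
      rw [abs_abs, covAccel_eq (contDiffAt_chart_comp he (hx ε hε t) (hLe ht.2))]
      congr 1
      simp only [chartDefect, chartHalfGrad, PiLp.sub_apply, PiLp.smul_apply, smul_eq_mul]
      ring
  refine (NegligibleOn.sum h1).of_le (Eventually.of_forall fun ε t ht => ⟨ht, ?_⟩)
  rw [abs_of_nonneg (norm_nonneg _), abs_of_nonneg (Finset.sum_nonneg fun i _ => abs_nonneg _)]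
  exact norm_le_sum_abs _

/-- The second derivatives of a smooth function along the reference net and along an approximate
solution, in terms of the controlling functions. -/
theorem IsChartControl.exists_second_derivative_bound [T2Space N] {f : N → ℝ}
    (hf : ContMDiff (𝓡 n) 𝓘(ℝ, ℝ) ∞ f) {p : N} {r : ℝ} {Φ : Option (Fin n) → N → ℝ}
    (h : IsChartControl (n := n) p r Φ) {y : ℝ → ℝ → N} {U K : Set ℝ} {δ : ℝ → ℝ → ℝ}
    (hy : ∀ ε ∈ U, IsSol (n := n) f (δ ε) (y ε) univ)
    (hb : ∀ g : N → ℝ, ContMDiff (𝓡 n) 𝓘(ℝ, ℝ) ∞ g →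
          ∃ B, ∀ ε ∈ U, ∀ t ∈ K, |deriv (fun t => g (y ε t)) t| ≤ B)
    {G : N → ℝ} (hG : ContMDiff (𝓡 n) 𝓘(ℝ, ℝ) ∞ G) :
    ∃ M, 0 ≤ M ∧ ∀ ε ∈ U, ∀ t ∈ K, y ε t ∈ chartNhd (n := n) p r → ∀ (x : ℝ → N) (d s : ℝ),
      ContMDiffAt 𝓘(ℝ, ℝ) (𝓡 n) ∞ x t → |Φ none (x t) - Φ none (y ε t)| < 1 → s ≤ 1 →
      (∀ j, |Φ j (x t) - Φ j (y ε t)| ≤ s) →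
      (∀ j, |deriv (fun s => Φ j (x s)) t - deriv (fun s => Φ j (y ε s)) t| ≤ s) →
      |deriv (deriv fun s => G (x s)) t - deriv (deriv fun s => G (y ε s)) t| ≤
        M * ((1 + |δ ε t|) * s + |d - δ ε t| + ‖chartDefect f (chartAt 𝔼 p) d x t‖) := by
  set e := chartAt 𝔼 p with hedef
  have he : e ∈ IsManifold.maximalAtlas (𝓡 n) ∞ N := IsManifold.chart_mem_maximalAtlas _
  have hys : ∀ ε ∈ U, ∀ t, ContMDiffAt 𝓘(ℝ, ℝ) (𝓡 n) ∞ (y ε) t := fun ε hε t =>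
    (hy ε hε).1.contMDiffAt univ_mem
  have hKz := isCompact_closedBall (e p) (2 * r)
  obtain ⟨B, hB⟩ := exists_velocity_bound hys hb he hKz h.subset
  -- The velocity of the reference curve is at most B, and that of x differs from it by at most n s
  -- ≤ n.
  obtain ⟨M, hM0, hM⟩ := exists_chart_comparison hf he hKz (convex_closedBall _ _) h.subset
    (B + n) hG
  refine ⟨M * (n + 1), by positivity, fun ε hε t ht hyp x d s hx h1 hs h0 h0' => ?_⟩
  obtain ⟨hxe, hxb⟩ := h.mem_source hyp h1
  obtain ⟨hye, hyb⟩ := h.chartNhd_subset hyp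
  have hph := h.phase_bounds hx (hys ε hε t) hyp h1 h0 h0'
  have hs0 : 0 ≤ s := (abs_nonneg _).trans (h0 none)
  have hyB := hB ε hε t ht hye (Metric.ball_subset_closedBall hyb)
  have hxB : ‖deriv (fun s => e (x s)) t‖ ≤ B + n := by
    have h2 : ‖deriv (fun s => e (x s)) t - deriv (fun s => e (y ε s)) t‖ ≤ n * s :=
      (le_max_right _ _).trans hph
    have h3 : (n : ℝ) * s ≤ n := mul_le_of_le_one_right (Nat.cast_nonneg n) hs
    linarith [norm_sub_norm_le (deriv (fun s => e (x s)) t) (deriv (fun s => e (y ε s)) t)]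
  refine (hM x (y ε) t (δ ε t) d hx (hys ε hε t) hxe hye (Metric.ball_subset_closedBall hxb)
    (Metric.ball_subset_closedBall hyb) hxB (by linarith [Nat.cast_nonneg (α := ℝ) n])
    ((hy ε hε).2 t (mem_univ t) e he hye)).2.trans ?_
  rw [mul_assoc]
  refine mul_le_mul_of_nonneg_left ?_ hM0
  have h4 : (1 + |δ ε t|) * ‖phase e x t - phase e (y ε) t‖ ≤ (1 + |δ ε t|) * (n * s) :=
    mul_le_mul_of_nonneg_left hph (by positivity)
  have h5 : 0 ≤ (1 + |δ ε t|) * s := by positivity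
  have h6 := abs_nonneg (d - δ ε t)
  have h7 := norm_nonneg (chartDefect f e d x t)
  have h8 := Nat.cast_nonneg (α := ℝ) n
  nlinarith [mul_nonneg h8 h6, mul_nonneg h8 h7]

end Charts

/-! ### Negligibility from second order differential inequalities. -/

/-- The differential inequality for a sum of squares. -/
theorem abs_deriv_sum_sq_le {ι : Type*} [Fintype ι] {u u' u'' : ι → ℝ} {M d η : ℝ} (hM : 0 ≤ M)
    (hη : 0 ≤ η) (hd : 0 ≤ d) (h1 : ∑ j, (u j ^ 2 + u' j ^ 2) < 1)
    (h : ∀ s ≤ 1, 0 ≤ s → (∀ j, |u j| ≤ s) → (∀ j, |u' j| ≤ s) →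
      ∀ j, |u'' j| ≤ M * ((1 + d) * s + η)) :
    |∑ j, (2 * u j * u' j + 2 * u' j * u'' j)| ≤
      Fintype.card ι * (2 * (1 + M)) * (1 + d) * ∑ j, (u j ^ 2 + u' j ^ 2) +
        Fintype.card ι * (2 * M) * η := by
  set D := ∑ j, (u j ^ 2 + u' j ^ 2) with hD
  have hD0 : 0 ≤ D := Finset.sum_nonneg fun j _ => by positivity
  -- The root of D dominates every u j and u' j, and s ≤ 1 because D < 1. The hypothesis at this s
  -- thus makes u' u'' linear in D, up to the inhomogeneity.
  set s := √D with hsdef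
  have hs0 : 0 ≤ s := Real.sqrt_nonneg _
  have hsD : s ^ 2 = D := Real.sq_sqrt hD0
  have hs1 : s ≤ 1 := by nlinarith
  have hle : ∀ j, u j ^ 2 + u' j ^ 2 ≤ D := fun j =>
    Finset.single_le_sum (f := fun j => u j ^ 2 + u' j ^ 2) (fun j _ => by positivity)
      (Finset.mem_univ j)
  have hu : ∀ j, |u j| ≤ s := fun j => Real.abs_le_sqrt (by nlinarith [hle j, sq_nonneg (u' j)])
  have hu' : ∀ j, |u' j| ≤ s := fun j => Real.abs_le_sqrt (by nlinarith [hle j, sq_nonneg (u j)])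
  have hu'' := h s hs1 hs0 hu hu'
  have hterm : ∀ j, |2 * u j * u' j + 2 * u' j * u'' j| ≤
      2 * (1 + M) * (1 + d) * D + 2 * M * η := by
    intro j
    have e1 : |2 * u j * u' j| ≤ 2 * D := by
      rw [abs_mul, abs_mul, abs_two, ← hsD]
      nlinarith [mul_le_mul (hu j) (hu' j) (abs_nonneg _) hs0]
    have e2 : |2 * u' j * u'' j| ≤ 2 * M * (1 + d) * D + 2 * M * η := by
      rw [abs_mul, abs_mul, abs_two, ← hsD]
      have := mul_le_mul (hu' j) (hu'' j) (abs_nonneg _) hs0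
      have h3 : s * (M * η) ≤ M * η := mul_le_of_le_one_left (by positivity) hs1
      nlinarith
    have e3 : 0 ≤ d * D := mul_nonneg hd hD0
    nlinarith [abs_add_le (2 * u j * u' j) (2 * u' j * u'' j)]
  refine (Finset.abs_sum_le_sum_abs _ _).trans ((Finset.sum_le_sum fun j _ => hterm j).trans ?_)
  rw [Finset.sum_const, Finset.card_univ, nsmul_eq_mul]
  exact le_of_eq (by ring)

/-- A finite family of nets satisfying, as long as it is small, a second order linear differential
inequality with an `L¹`-bounded coefficient is negligible if its initial data are. -/
theorem negligibleOn_of_second_order {ι : Type*} [Fintype ι] {u : ι → ℝ → ℝ → ℝ} {κ : ℝ}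
    (hκ : 0 < κ) (hu : ∀ ε ∈ Ioo 0 κ, ∀ j, ContDiff ℝ ∞ (u j ε)) {d : ℝ → ℝ → ℝ}
    (hd : ∀ ε ∈ Ioo 0 κ, Continuous (d ε)) {T C M : ℝ} (hT : 1 ≤ T) (hM : 0 ≤ M)
    (hC : ∀ ε ∈ Ioo 0 κ, ∫ t in (-T)..T, |d ε t| ≤ C)
    (h0 : ∀ j, IsNegligibleNumber fun ε => u j ε (-1))
    (h0' : ∀ j, IsNegligibleNumber fun ε => deriv (u j ε) (-1))
    (h : ∀ m : ℕ, ∀ᶠ ε in 𝓝[>] (0 : ℝ), ∀ t ∈ Icc (-T) T,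
      ∑ j, (u j ε t ^ 2 + deriv (u j ε) t ^ 2) < 1 → ∀ s ≤ 1, 0 ≤ s → (∀ j, |u j ε t| ≤ s) →
        (∀ j, |deriv (u j ε) t| ≤ s) →
        ∀ j, |deriv (deriv (u j ε)) t| ≤ M * ((1 + |d ε t|) * s + ε ^ m)) (j : ι) :
    NegligibleOn (fun _ => Icc (-T) T) (u j) ∧
      NegligibleOn (fun _ => Icc (-T) T) fun ε t => deriv (u j ε) t := by
  suffices hD : ∀ m : ℕ, ∀ᶠ ε in 𝓝[>] (0 : ℝ), ∀ t ∈ Icc (-T) T,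
      ∑ j, (u j ε t ^ 2 + deriv (u j ε) t ^ 2) ≤ (ε ^ m) ^ 2 by
    constructor <;> intro m <;> filter_upwards [hD m, self_mem_nhdsWithin] with ε h1 (h2 : 0 < ε) t ht
    all_goals
      have h3 := Finset.single_le_sum (f := fun j => u j ε t ^ 2 + deriv (u j ε) t ^ 2)
        (fun j _ => by positivity) (Finset.mem_univ j)
      have h4 := h1 t ht
      refine abs_le_of_sq_le_sq ?_ (by positivity)
      nlinarith [sq_nonneg (u j ε t), sq_nonneg (deriv (u j ε) t)]
  intro m
  set c : ℝ := (Fintype.card ι : ℝ) with hc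
  have hc0 : 0 ≤ c := Nat.cast_nonneg _
  set L : ℝ := c * (2 * (1 + M)) with hL
  have hL0 : 0 ≤ L := by positivity
  set C' : ℝ := 2 * (c * (2 * M) + 2 * c + 1) * (1 + 2 * T) * Real.exp (L * (2 * T + C)) with hC'
  have hC'0 : 0 < C' := by positivity
  have h0e : ∀ᶠ ε in 𝓝[>] (0 : ℝ), ∀ j, |u j ε (-1)| ≤ ε ^ (2 * m + 1) ∧
      |deriv (u j ε) (-1)| ≤ ε ^ (2 * m + 1) := by
    refine Filter.eventually_all.2 fun j => ?_
    filter_upwards [isNegligibleNumber_iff.1 (h0 j) (2 * m + 1),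
      isNegligibleNumber_iff.1 (h0' j) (2 * m + 1)] with ε h1 h2
    exact ⟨h1 0 rfl, h2 0 rfl⟩
  -- The order 2m appears because D is a sum of squares; the additional power of ε absorbs the
  -- constant C' and gives the smallness that Gronwall requires.
  filter_upwards [h0e, h (2 * m + 1), eventually_small hκ, eventually_small one_pos,
    eventually_small (inv_pos.2 hC'0)] with ε h0e he hεκ hε1 hεC
  have hε0 : 0 < ε := hε1.1
  have hεC' : C' * ε < 1 := by
    have := mul_lt_mul_of_pos_left hεC.2 hC'0
    rwa [mul_inv_cancel₀ hC'0.ne'] at this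
  set q := ε ^ (2 * m + 1) with hq
  have hq0 : 0 < q := by positivity
  have hq1 : q ≤ 1 := pow_le_one₀ hε0.le hε1.2.le
  have hqε : q = ε * (ε ^ m) ^ 2 := by rw [hq]; ring
  have hp1 : (ε ^ m) ^ 2 ≤ 1 := pow_le_one₀ (by positivity) (pow_le_one₀ hε0.le hε1.2.le)
  have hp0 : 0 < (ε ^ m) ^ 2 := by positivity
  -- The first summand covers the inhomogeneity, the second the initial values, and the last keeps η
  -- positive when the family is empty.
  set η := (c * (2 * M) + 2 * c + 1) * q with hη
  have hfin : 2 * η * (1 + 2 * T) * Real.exp (L * (2 * T + C)) = C' * ε * (ε ^ m) ^ 2 := by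
    rw [hη, hC', hqε]
    ring
  have hdu : ∀ j t, HasDerivAt (u j ε) (deriv (u j ε) t) t := fun j t =>
    ((hu ε hεκ j).differentiable (by simp) t).hasDerivAt
  have hddu : ∀ j t, HasDerivAt (deriv (u j ε)) (deriv (deriv (u j ε)) t) t := fun j t =>
    (((contDiff_infty_iff_deriv.1 (hu ε hεκ j)).2).differentiable (by simp) t).hasDerivAt
  have hdc := hd ε hεκ
  have key := gronwall_two_sided (f := fun t => ∑ j, (u j ε t ^ 2 + deriv (u j ε) t ^ 2))
    (f' := fun t => ∑ j, (2 * u j ε t * deriv (u j ε) t +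
      2 * deriv (u j ε) t * deriv (deriv (u j ε)) t)) (k := fun t => L * (1 + |d ε t|))
    (T := T) (η := η) (I := L * (2 * T + C)) hT (by fun_prop) (fun t => by positivity)
    (by positivity) ?_ ?_ ?_ ?_ ?_
  · intro t ht
    refine (key t ht).trans ?_
    rw [hfin]
    nlinarith
  · intro t _
    refine HasDerivAt.fun_sum fun j _ => ?_
    refine (((hdu j t).pow 2).add ((hddu j t).pow 2)).congr_deriv ?_
    ring
  · have h1 : ∀ j, u j ε (-1) ^ 2 + deriv (u j ε) (-1) ^ 2 ≤ 2 * q := fun j => by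
      have h2 := abs_nonneg (u j ε (-1))
      have h3 := abs_nonneg (deriv (u j ε) (-1))
      rw [← sq_abs, ← sq_abs (deriv (u j ε) (-1))]
      nlinarith [(h0e j).1, (h0e j).2]
    refine (Finset.sum_le_sum fun j _ => h1 j).trans ?_
    rw [Finset.sum_const, Finset.card_univ, nsmul_eq_mul]
    have : 0 ≤ c * (2 * M) * q := by positivity
    rw [← hc, hη]
    nlinarith
  · intro t ht hlt
    refine (abs_deriv_sum_sq_le hM hq0.le (abs_nonneg (d ε t)) hlt (he t ht hlt)).trans ?_
    rw [← hc, ← hL, hη]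
    have : 0 ≤ c * q := by positivity
    nlinarith
  · have h1 : ∫ t in (-T)..T, L * (1 + |d ε t|) = L * (2 * T + ∫ t in (-T)..T, |d ε t|) := by
      rw [intervalIntegral.integral_const_mul, intervalIntegral.integral_add
        intervalIntegrable_const (hdc.abs.intervalIntegrable _ _)]
      rw [intervalIntegral.integral_const, smul_eq_mul]
      ring
    rw [h1]
    exact mul_le_mul_of_nonneg_left (by linarith [hC ε hεκ]) hL0
  · rw [hfin]
    nlinarith

section Main

variable {n : ℕ} {N : Type*} [MetricSpace N] [ChartedSpace (EuclideanSpace ℝ (Fin n)) N]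
  [RiemannianBundle (fun p : N => TangentSpace (𝓡 n) p)]

local notation "𝔼" => EuclideanSpace ℝ (Fin n)

variable [IsManifold (𝓡 n) ∞ N]
  [IsContMDiffRiemannianBundle (𝓡 n) ∞ (EuclideanSpace ℝ (Fin n))
      (fun p : N => TangentSpace (𝓡 n) p)]

theorem IsReferenceNet.negligible_init {f : N → ℝ} {δ : ℝ → ℝ → ℝ} {v₀ v₁ : ℝ} {x₀ : N}
    {x₁ : TangentSpace (𝓡 n) x₀} {κ : ℝ} {v p : ℝ → ℝ → ℝ} {y : ℝ → ℝ → N} (hκ : 0 < κ)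
    (h : IsReferenceNet f δ v₀ v₁ x₀ x₁ κ v p y) {x : ℝ → ℝ → N}
    (hx : ∀ ε ∈ Ioo 0 κ, ∀ t, ContMDiffAt 𝓘(ℝ, ℝ) (𝓡 n) ∞ (x ε) t)
    (hx0 : GenPointEq (𝓡 n).tangent
      (fun ε => (⟨x ε (-1), velocity (n := n) (x ε) (-1)⟩ : TangentBundle (𝓡 n) N)) ⟨x₀, x₁⟩)
    {G : N → ℝ} (hG : ContMDiff (𝓡 n) 𝓘(ℝ, ℝ) ∞ G) :
    (IsNegligibleNumber fun ε => G (x ε (-1)) - G (y ε (-1))) ∧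
      IsNegligibleNumber fun ε =>
        deriv (fun t => G (x ε t)) (-1) - deriv (fun t => G (y ε t)) (-1) := by
  constructor
  · intro m
    obtain ⟨C, hC⟩ := hx0 _ (contMDiff_comp_proj hG) m
    refine ⟨C, ?_⟩
    filter_upwards [hC, eventually_small hκ] with ε h1 h2
    rwa [(h.init_x ε h2).1]
  · intro m
    obtain ⟨C, hC⟩ := hx0 _ (contMDiff_mfderiv_apply hG) m
    refine ⟨C, ?_⟩
    filter_upwards [hC, eventually_small hκ] with ε h1 h2
    rw [← diffAlong_eq_deriv hG (hx ε h2 _), ← diffAlong_eq_deriv hG (h.contMDiffAt h2 _)]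
    have h3 := totalSpace_eq (h.init_x ε h2).1 (h.init_x ε h2).2
    have h4 := congrArg (fun q : TangentBundle (𝓡 n) N =>
      (mfderiv (𝓡 n) 𝓘(ℝ, ℝ) G q.1 q.2 : ℝ)) h3
    change diffAlong G (y ε) (-1) = _ at h4
    rw [h4]
    exact h1

/-- The function G is adjoined, as index `none`, to the controls of a finite cover of L. The
enlarged family closes up: while all differences are small, the second derivative of each member, G
included, is governed by the controls of the chart in which y lies. -/
theorem IsReferenceNet.negligibleOn_sub {f : N → ℝ} (hf : ContMDiff (𝓡 n) 𝓘(ℝ, ℝ) ∞ f)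
    {δ δ' : ℝ → ℝ → ℝ} {v₀ v₁ : ℝ} {x₀ : N} {x₁ : TangentSpace (𝓡 n) x₀} {κ : ℝ}
    {v p : ℝ → ℝ → ℝ} {y : ℝ → ℝ → N} (hκ : 0 < κ) (h : IsReferenceNet f δ v₀ v₁ x₀ x₁ κ v p y)
    (hδ : ∀ ε ∈ Ioo 0 κ, Continuous (δ ε)) {C T : ℝ} (hT : 1 ≤ T)
    (hC : ∀ ε ∈ Ioo 0 κ, ∫ t in (-T)..T, |δ ε t| ≤ C)
    (hδδ' : IsNegligible fun ε t => δ' ε t - δ ε t) {x : ℝ → ℝ → N}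
    (hx : ∀ ε ∈ Ioo 0 κ, ∀ t, ContMDiffAt 𝓘(ℝ, ℝ) (𝓡 n) ∞ (x ε) t)
    (hxs : SolvesX (n := n) f δ' x)
    (hx0 : GenPointEq (𝓡 n).tangent
      (fun ε => (⟨x ε (-1), velocity (n := n) (x ε) (-1)⟩ : TangentBundle (𝓡 n) N)) ⟨x₀, x₁⟩)
    {G : N → ℝ} (hG : ContMDiff (𝓡 n) 𝓘(ℝ, ℝ) ∞ G) :
    NegligibleOn (fun _ => Icc (-T) T) (fun ε t => G (x ε t) - G (y ε t)) ∧
      NegligibleOn (fun _ => Icc (-T) T) fun ε t =>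
        deriv (fun t => G (x ε t)) t - deriv (fun t => G (y ε t)) t := by
  obtain ⟨L, hL, hyL⟩ := h.compact T
  choose r Φ hΦ using fun p : N => exists_isChartControl (n := n) p
  obtain ⟨A, -, hA⟩ := hL.elim_nhds_subcover (fun p => chartNhd (n := n) p (r p)) fun p _ =>
    chartNhd_mem_nhds p (hΦ p).pos
  set Ψ : Option (A × Option (Fin n)) → N → ℝ := fun j => j.elim G fun q => Φ q.1 q.2 with hΨ
  have hΨs : ∀ j, ContMDiff (𝓡 n) 𝓘(ℝ, ℝ) ∞ (Ψ j) := by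
    rintro (_ | q)
    exacts [hG, (hΦ q.1).smooth q.2]
  choose M hM0 hM using fun (a : A) j => (hΦ a).exists_second_derivative_bound hf (U := Ioo 0 κ)
    (K := Icc (-T) T) h.isSol (h.bound_y T) (hΨs j)
  -- The factor 2 collects two inhomogeneities, the difference of the two forcings and the defect of
  -- x.
  set M' : ℝ := 2 * ∑ a, ∑ j, M a j with hM'
  have hMle : ∀ a j, M a j ≤ ∑ a, ∑ j, M a j := fun a j =>
    (Finset.single_le_sum (f := fun j => M a j) (fun j _ => hM0 a j) (Finset.mem_univ j)).trans
      (Finset.single_le_sum (f := fun a => ∑ j, M a j)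
        (fun a _ => Finset.sum_nonneg fun j _ => hM0 a j) (Finset.mem_univ a))
  have hM'0 : 0 ≤ M' :=
    mul_nonneg two_pos.le (Finset.sum_nonneg fun a _ => Finset.sum_nonneg fun j _ => hM0 a j)
  have hxd : ∀ ε ∈ Ioo 0 κ, ∀ j, ContDiff ℝ ∞ fun t => Ψ j (x ε t) := fun ε hε j =>
    contDiff_comp_curve (hΨs j) (hx ε hε)
  have hyd : ∀ ε ∈ Ioo 0 κ, ∀ j, ContDiff ℝ ∞ fun t => Ψ j (y ε t) := fun ε hε j =>
    contDiff_comp_curve (hΨs j) fun t => h.contMDiffAt hε t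
  have hd1 : ∀ ε ∈ Ioo 0 κ, ∀ j, deriv (fun t => Ψ j (x ε t) - Ψ j (y ε t)) =
      fun t => deriv (fun t => Ψ j (x ε t)) t - deriv (fun t => Ψ j (y ε t)) t :=
    fun ε hε j => funext fun t => deriv_fun_sub ((hxd ε hε j).differentiable (by simp) t)
      ((hyd ε hε j).differentiable (by simp) t)
  have hd2 : ∀ ε ∈ Ioo 0 κ, ∀ j t, deriv (deriv fun t => Ψ j (x ε t) - Ψ j (y ε t)) t =
      deriv (deriv fun t => Ψ j (x ε t)) t - deriv (deriv fun t => Ψ j (y ε t)) t := by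
    intro ε hε j t
    rw [hd1 ε hε j]
    exact deriv_fun_sub ((contDiff_infty_iff_deriv.1 (hxd ε hε j)).2.differentiable (by simp) t)
      ((contDiff_infty_iff_deriv.1 (hyd ε hε j)).2.differentiable (by simp) t)
  have hdef : ∀ m : ℕ, ∀ᶠ ε in 𝓝[>] (0 : ℝ), ∀ a : A, ∀ t ∈ Icc (-T) T,
      x ε t ∈ (chartAt 𝔼 a.1).source →
      chartAt 𝔼 a.1 (x ε t) ∈ Metric.closedBall (chartAt 𝔼 a.1 a.1) (2 * r a) →
      ‖chartDefect f (chartAt 𝔼 a.1) (δ' ε t) (x ε) t‖ ≤ ε ^ m := by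
    intro m
    refine Filter.eventually_all.2 fun a => ?_
    have hLa := (isCompact_closedBall (chartAt 𝔼 a.1 a.1) (2 * r a)).image_of_continuousOn
      ((chartAt 𝔼 a.1).continuousOn_symm.mono (hΦ a).subset)
    have := hxs.negligibleOn_chartDefect hκ hx (IsManifold.chart_mem_maximalAtlas a.1) hLa
      (by
        rintro _ ⟨z, hz, rfl⟩
        exact (chartAt 𝔼 a.1).map_target ((hΦ a).subset hz)) (isCompact_Icc (a := -T) (b := T)) m
    filter_upwards [this] with ε h1 t ht hte htb
    have h2 := h1 t ⟨ht, _, htb, (chartAt 𝔼 a.1).left_inv hte⟩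
    rwa [abs_of_nonneg (norm_nonneg _)] at h2
  have key := negligibleOn_of_second_order (u := fun j ε t => Ψ j (x ε t) - Ψ j (y ε t)) hκ
    (fun ε hε j => (hxd ε hε j).sub (hyd ε hε j)) hδ hT hM'0 hC
    (fun j => (h.negligible_init hκ hx hx0 (hΨs j)).1) (fun j m => ?_) (fun m => ?_) none
  · refine ⟨key.1, key.2.of_le ?_⟩
    filter_upwards [eventually_small hκ] with ε hε t ht
    refine ⟨ht, ?_⟩
    rw [hd1 ε hε none]
    exact le_rfl
  · obtain ⟨c, hc⟩ := (h.negligible_init hκ hx hx0 (hΨs j)).2 m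
    refine ⟨c, ?_⟩
    filter_upwards [hc, eventually_small hκ] with ε h1 hε
    rwa [hd1 ε hε j]
  · filter_upwards [hdef m, eventually_small hκ, eventually_small one_pos,
      isNegligible_iff.1 hδδ' (Icc (-T) T) isCompact_Icc m] with ε h1 hε hε1 h2 t ht hlt s hs hs0
      hus hus' j
    rw [hd2 ε hε j]
    simp only [hd1 ε hε] at hus' hlt
    obtain ⟨a, ha⟩ : ∃ a : A, y ε t ∈ chartNhd (n := n) a.1 (r a) := by
      obtain ⟨a, haA, ha⟩ := mem_iUnion₂.1 (hA (hyL ε hε t ht))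
      exact ⟨⟨a, haA⟩, ha⟩
    -- The squared difference of the cutoffs is one of the terms of D < 1. This brings x into the
    -- chart in which y lies.
    have h3 : |Φ a none (x ε t) - Φ a none (y ε t)| < 1 := by
      have := Finset.single_le_sum (f := fun j => (Ψ j (x ε t) - Ψ j (y ε t)) ^ 2 +
        (deriv (fun t => Ψ j (x ε t)) t - deriv (fun t => Ψ j (y ε t)) t) ^ 2)
        (fun j _ => by positivity) (Finset.mem_univ (some (a, none)))
      rw [← sq_lt_one_iff_abs_lt_one]
      refine lt_of_le_of_lt ?_ (this.trans_lt hlt)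
      exact le_add_of_nonneg_right (sq_nonneg _)
    obtain ⟨hxe, hxb⟩ := (hΦ a).mem_source ha h3
    have h4 := hM a j ε hε t ht ha (x ε) (δ' ε t) s (hx ε hε t) h3 hs
      (fun i => hus (some (a, i))) (fun i => hus' (some (a, i)))
    refine h4.trans ?_
    have h5 := h1 a t ht hxe (Metric.ball_subset_closedBall hxb)
    have h6 := h2 t ht
    have h7 : 0 ≤ (1 + |δ ε t|) * s := by positivity
    have h8 : 0 ≤ ε ^ m := pow_nonneg hε.1.le m
    calc M a j * ((1 + |δ ε t|) * s + |δ' ε t - δ ε t| +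
          ‖chartDefect f (chartAt 𝔼 a.1) (δ' ε t) (x ε) t‖)
        ≤ M a j * (2 * ((1 + |δ ε t|) * s + ε ^ m)) :=
          mul_le_mul_of_nonneg_left (by linarith) (hM0 a j)
      _ ≤ (∑ a, ∑ j, M a j) * (2 * ((1 + |δ ε t|) * s + ε ^ m)) :=
          mul_le_mul_of_nonneg_right (hMle a j) (by positivity)
      _ = M' * ((1 + |δ ε t|) * s + ε ^ m) := by
          rw [hM']
          ring

end Main

/-! ### Uniqueness of the remaining component -/

theorem IsNegligibleNumber.negligibleOn_singleton {a : ℝ → ℝ → ℝ} {s : ℝ}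
    (h : IsNegligibleNumber fun ε => a ε s) : NegligibleOn (fun _ => {s}) a := by
  refine negligibleOn_iff.2 fun m => ?_
  simpa using h m

theorem negligibleOn_of_hasDerivAt {Z Z' : ℝ → ℝ → ℝ} {κ : ℝ} (hκ : 0 < κ)
    (hZ : ∀ ε ∈ Ioo 0 κ, ∀ t, HasDerivAt (Z ε) (Z' ε t) t) {T : ℝ} (hT : 1 ≤ T)
    (h0 : NegligibleOn (fun _ => {-1}) Z) (h : NegligibleOn (fun _ => Icc (-T) T) Z') :
    NegligibleOn (fun _ => Icc (-T) T) Z := by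
  refine negligibleOn_iff.2 fun m => ⟨1 + 2 * T, ?_⟩
  filter_upwards [h0 m, h m, eventually_small hκ] with ε h1 h2 hε t ht
  have h3 := (convex_Icc (-T) T).norm_image_sub_le_of_norm_hasDerivWithin_le
    (fun s _ => (hZ ε hε s).hasDerivWithinAt) h2 (x := -1) ⟨by linarith, by linarith⟩ ht
  have h4 : ‖t - -1‖ ≤ 2 * T := by
    rw [Real.norm_eq_abs, abs_le]
    constructor <;> linarith [ht.1, ht.2]
  have h5 := mul_le_mul_of_nonneg_left h4 (pow_nonneg hε.1.le m)
  have h6 := abs_sub_abs_le_abs_sub (Z ε t) (Z ε (-1))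
  rw [Real.norm_eq_abs] at h3
  linarith [h1 (-1) rfl]

section Main

variable {n : ℕ} {N : Type*} [MetricSpace N] [ChartedSpace (EuclideanSpace ℝ (Fin n)) N]
  [RiemannianBundle (fun p : N => TangentSpace (𝓡 n) p)]

local notation "𝔼" => EuclideanSpace ℝ (Fin n)

/-- The unknown v' is compared with p through the quantity (v')˙ + ½ f(x) δ' - p. In its derivative
the terms with the derivative of δ' cancel, and what remains are negligible factors times moderate
ones. Integrating twice from -1 gives the claim, and only moderateness of δ' is used for its size.
-/
theorem IsReferenceNet.negligibleOn_sub_fst {f : N → ℝ} (hf : ContMDiff (𝓡 n) 𝓘(ℝ, ℝ) ∞ f)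
    {δ δ' : ℝ → ℝ → ℝ} {v₀ v₁ : ℝ} {x₀ : N} {x₁ : 𝔼} {κ : ℝ}
    {v p : ℝ → ℝ → ℝ} {y : ℝ → ℝ → N} (hκ : 0 < κ) (h : IsReferenceNet f δ v₀ v₁ x₀ x₁ κ v p y)
    [IsManifold (𝓡 n) ∞ N]
    (hδ's : ∀ ε ∈ Ioo 0 κ, ContDiff ℝ ∞ (δ' ε)) (hδ'm : HasModerateGrowth δ') {T : ℝ} (hT : 1 ≤ T)
    (hδδ' : IsNegligible fun ε t => δ' ε t - δ ε t) {x : ℝ → ℝ → N} {v' : ℝ → ℝ → ℝ}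
    (hx : ∀ ε ∈ Ioo 0 κ, ∀ t, ContMDiffAt 𝓘(ℝ, ℝ) (𝓡 n) ∞ (x ε) t)
    (hv' : ∀ ε ∈ Ioo 0 κ, ContDiff ℝ ∞ (v' ε)) (hs : SolvesV n f δ' v' x)
    (hv0 : IsNegligibleNumber fun ε => v' ε (-1) - v₀)
    (hv1 : IsNegligibleNumber fun ε => deriv (v' ε) (-1) - v₁)
    (hfx : NegligibleOn (fun _ => Icc (-T) T) fun ε t => f (x ε t) - f (y ε t))
    (hfx' : NegligibleOn (fun _ => Icc (-T) T) fun ε t =>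
      deriv (fun t => f (x ε t)) t - deriv (fun t => f (y ε t)) t) :
    NegligibleOn (fun _ => Icc (-T) T) fun ε t => v' ε t - v ε t := by
  have hsub : ∀ _ε : ℝ, {(-1 : ℝ)} ⊆ Icc (-T) T := fun _ =>
    singleton_subset_iff.2 ⟨by linarith, by linarith⟩
  have hδm : ModerateOn (fun _ => Icc (-T) T) δ' := by
    simpa only [iteratedDeriv_zero] using hδ'm.moderateOn (isCompact_Icc (a := -T) (b := T)) 0
  have hδn := isNegligible_iff.1 hδδ' (Icc (-T) T) isCompact_Icc
  obtain ⟨L, hL, hyL⟩ := h.compact T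
  obtain ⟨B, hB⟩ := hL.exists_bound_of_continuousOn hf.continuous.continuousOn
  obtain ⟨B', hB'⟩ := h.bound_y T f hf
  have hfy : ModerateOn (fun _ => Icc (-T) T) fun ε t => f (y ε t) :=
    ModerateOn.of_bounded (B := B) (by
      filter_upwards [eventually_small hκ] with ε hε t ht using hB _ (hyL ε hε t ht))
  have hfy' : ModerateOn (fun _ => Icc (-T) T) fun ε t => deriv (fun t => f (y ε t)) t :=
    ModerateOn.of_bounded (B := B') (by
      filter_upwards [eventually_small hκ] with ε hε t ht using hB' ε hε t ht)
  have hE : NegligibleOn (fun _ => Icc (-T) T) fun ε t =>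
      1 / 2 * ((f (x ε t) - f (y ε t)) * δ' ε t) + 1 / 2 * ((δ' ε t - δ ε t) * f (y ε t)) :=
    ((hfx.mul_moderate hδm).const_mul _).add ((hδn.mul_moderate hfy).const_mul _)
  have hfxd : ∀ ε ∈ Ioo 0 κ, ∀ t, HasDerivAt (fun t => f (x ε t)) (deriv (fun t => f (x ε t)) t) t :=
    fun ε hε t => ((contDiff_comp_curve hf (hx ε hε)).differentiable (by simp) t).hasDerivAt
  have hZ : NegligibleOn (fun _ => Icc (-T) T) fun ε t =>
      deriv (v' ε) t - p ε t + 1 / 2 * (f (x ε t) * δ' ε t) := by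
    refine negligibleOn_of_hasDerivAt hκ (fun ε hε t =>
      ((((contDiff_infty_iff_deriv.1 (hv' ε hε)).2.differentiable (by simp) t).hasDerivAt).sub
        (h.hasDerivAt ε hε t).2).add (((hfxd ε hε t).mul
          ((hδ's ε hε).differentiable (by simp) t).hasDerivAt).const_mul (1 / 2))) hT ?_ ?_
    · refine (hv1.negligibleOn_singleton (a := fun ε t => deriv (v' ε) t - v₁)).add
        (hE.mono hsub) |>.of_le ?_
      filter_upwards [eventually_small hκ] with ε hε t ht
      rw [mem_singleton_iff] at ht
      subst ht
      refine ⟨rfl, le_of_eq (congrArg _root_.abs ?_)⟩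
      obtain ⟨-, h2, h3⟩ := h.init_v ε hε
      simp only [Pi.sub_apply, Pi.add_apply, Pi.mul_apply]
      rw [h2, h3]
      ring
    · refine ((isNegligible_iff.1 hs (Icc (-T) T) isCompact_Icc).add
        (((hfx'.mul_moderate hδm).const_mul (-(1 / 2))).add
          ((hδn.mul_moderate hfy').const_mul (-(1 / 2))))).of_le ?_
      filter_upwards [eventually_small hκ] with ε hε t ht
      refine ⟨ht, le_of_eq (congrArg _root_.abs ?_)⟩
      rw [diffAlong_eq_deriv hf (hx ε hε t)]
      ring
  refine negligibleOn_of_hasDerivAt hκ (fun ε hε t =>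
    ((hv' ε hε).differentiable (by simp) t).hasDerivAt.sub (h.hasDerivAt ε hε t).1) hT ?_ ?_
  · refine (hv0.negligibleOn_singleton (a := fun ε t => v' ε t - v₀)).of_le ?_
    filter_upwards [eventually_small hκ] with ε hε t ht
    rw [mem_singleton_iff] at ht
    subst ht
    exact ⟨rfl, by rw [Pi.sub_apply, (h.init_v ε hε).1]⟩
  · refine (hZ.add (hE.const_mul (-1))).of_le ?_
    filter_upwards [eventually_small hκ] with ε hε t ht
    exact ⟨ht, le_of_eq (congrArg _root_.abs (by ring))⟩

variable [IsManifold (𝓡 n) ∞ N]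

/-- Nets which are close in the sense of the controlling functions are equivalent. -/
theorem negligibleOn_comp_sub {κ T : ℝ} (hκ : 0 < κ) {v v' : ℝ → ℝ → ℝ} {x y : ℝ → ℝ → N}
    {L : Set N} (hL : IsCompact L) (hyL : ∀ ε ∈ Ioo 0 κ, ∀ t ∈ Icc (-T) T, y ε t ∈ L) {B : ℝ}
    (hB : ∀ ε ∈ Ioo 0 κ, ∀ t ∈ Icc (-T) T, |v ε t| ≤ B)
    (hv : NegligibleOn (fun _ => Icc (-T) T) fun ε t => v' ε t - v ε t)
    (hx : ∀ G : N → ℝ, ContMDiff (𝓡 n) 𝓘(ℝ, ℝ) ∞ G →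
      NegligibleOn (fun _ => Icc (-T) T) fun ε t => G (x ε t) - G (y ε t))
    {ψ : ℝ × N → ℝ} (hψ : ContMDiff (𝓘(ℝ, ℝ).prod (𝓡 n)) 𝓘(ℝ, ℝ) ∞ ψ) :
    NegligibleOn (fun _ => Icc (-T) T) fun ε t => ψ (v' ε t, x ε t) - ψ (v ε t, y ε t) := by
  refine NegligibleOn.of_cover hL (y := y) ?_ fun p _ => ?_
  · filter_upwards [eventually_small hκ] with ε hε using hyL ε hε
  obtain ⟨r, Φ, hΦ⟩ := exists_isChartControl (n := n) p
  refine ⟨chartNhd (n := n) p r, chartNhd_mem_nhds p hΦ.pos, ?_⟩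
  set e := chartAt 𝔼 p with hedef
  have he : e ∈ IsManifold.maximalAtlas (𝓡 n) ∞ N := IsManifold.chart_mem_maximalAtlas _
  have hq : ContDiffOn ℝ ∞ (fun c : ℝ × 𝔼 => ψ (c.1, e.symm c.2)) (univ ×ˢ e.target) := by
    rw [← contMDiffOn_iff_contDiffOn]
    refine hψ.comp_contMDiffOn (ContMDiffOn.prodMk ?_ ?_)
    · exact contMDiffOn_iff_contDiffOn.2 contDiff_fst.contDiffOn
    · exact (contMDiffOn_symm_of_mem_maximalAtlas he).comp
        (contMDiffOn_iff_contDiffOn.2 contDiff_snd.contDiffOn) fun c hc => hc.2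
  obtain ⟨M, hM0, hM⟩ := exists_lipschitz_bound (isOpen_univ.prod e.open_target) hq
    ((isCompact_closedBall (0 : ℝ) (B + 1)).prod (isCompact_closedBall (e p) (2 * r)))
    ((convex_closedBall _ _).prod (convex_closedBall _ _)) (prod_mono (subset_univ _) hΦ.subset)
  have hsum := (hv.abs.add (NegligibleOn.sum (s := Finset.univ) fun i _ =>
    (hx (Φ (some i)) (hΦ.smooth _)).abs)).const_mul M
  refine hsum.of_le ?_
  -- Order 1 suffices to make the cutoffs differ by less than 1, and order 0 to keep v' within 1 of
  -- v. Both pairs of points then lie in one compact convex set of the chart.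
  have h1 := hx (Φ none) (hΦ.smooth _) 1
  filter_upwards [h1, hv 0, eventually_small hκ, eventually_small one_pos]
    with ε h1 h2 hε hε1 t ht
  refine ⟨ht.1, ?_⟩
  obtain ⟨hye, hyb⟩ := hΦ.chartNhd_subset ht.2
  obtain ⟨hxe, hxb⟩ := hΦ.mem_source ht.2
    ((h1 t ht.1).trans_lt (by rw [pow_one]; exact hε1.2))
  have hyb := Metric.ball_subset_closedBall hyb
  have hxb := Metric.ball_subset_closedBall hxb
  have h3 := hB ε hε t ht.1
  have h4 := h2 t ht.1
  rw [pow_zero] at h4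
  have h5 : |v' ε t| ≤ B + 1 := by
    linarith [abs_sub_abs_le_abs_sub (v' ε t) (v ε t)]
  have h6 := hM (v' ε t, e (x ε t)) ⟨mem_closedBall_zero_iff.2 h5, hxb⟩
    (v ε t, e (y ε t)) ⟨mem_closedBall_zero_iff.2 (h3.trans (by linarith)), hyb⟩
  rw [Real.norm_eq_abs] at h6
  simp only [e.left_inv hxe, e.left_inv hye] at h6
  refine h6.trans (le_trans (mul_le_mul_of_nonneg_left ?_ hM0) (le_abs_self _))
  have h7 : ‖e (x ε t) - e (y ε t)‖ ≤ ∑ i, |Φ (some i) (x ε t) - Φ (some i) (y ε t)| := by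
    refine (norm_le_sum_abs _).trans (le_of_eq (Finset.sum_congr rfl fun i _ => ?_))
    rw [hΦ.coord i _ hxe hxb, hΦ.coord i _ hye hyb]
    rfl
  have h8 : 0 ≤ ∑ i, |Φ (some i) (x ε t) - Φ (some i) (y ε t)| :=
    Finset.sum_nonneg fun i _ => abs_nonneg _
  refine max_le ?_ (h7.trans (le_add_of_nonneg_left (abs_nonneg _)))
  exact le_add_of_nonneg_right h8

theorem IsSmoothNet.contMDiffAt_snd
    {w : ℝ → ℝ → ℝ × N} (hw : IsSmoothNet (𝓘(ℝ, ℝ).prod (𝓡 n)) w) {ε : ℝ}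
    (hε : ε ∈ Ioc (0 : ℝ) 1) : ContDiff ℝ ∞ (fun t => (w ε t).1) ∧
      ∀ t, ContMDiffAt 𝓘(ℝ, ℝ) (𝓡 n) ∞ (fun t => (w ε t).2) t := by
  have h1 : ContMDiff 𝓘(ℝ, ℝ) (𝓘(ℝ, ℝ).prod (𝓡 n)) ∞ (w ε) := by
    rw [← contMDiffOn_univ]
    refine hw.comp (t := Ioc (0 : ℝ) 1 ×ˢ univ) (f := fun t : ℝ => (ε, t)) ?_
      fun t _ => ⟨hε, mem_univ _⟩
    exact (contMDiff_iff_contDiff.2 (contDiff_const.prodMk contDiff_id)).contMDiffOn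
  exact ⟨contMDiff_iff_contDiff.1 (contMDiff_fst.comp h1), fun t =>
    (contMDiff_snd.comp h1) t⟩

end Main

end Colombeau

end

theorem theorem1 {n : ℕ} {N : Type*} [MetricSpace N] [SecondCountableTopology N]
    [ChartedSpace (EuclideanSpace ℝ (Fin n)) N] [IsManifold (𝓡 n) ∞ N]
    [RiemannianBundle (fun p : N => TangentSpace (𝓡 n) p)]
    [IsContMDiffRiemannianBundle (𝓡 n) ∞ (EuclideanSpace ℝ (Fin n))
      (fun p : N => TangentSpace (𝓡 n) p)]
    [IsRiemannianManifold (𝓡 n) N] [CompleteSpace N]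
    (D : Colombeau.GenFun) (hD : D.IsDelta)
    (f : N → ℝ) (hf : ContMDiff (𝓡 n) 𝓘(ℝ, ℝ) ∞ f)
    (v₀ v₁ : ℝ) (x₀ : N) (x₁ : TangentSpace (𝓡 n) x₀) :
    ∃! S : Colombeau.GenMap (𝓘(ℝ, ℝ).prod (𝓡 n)) (ℝ × N),
      Colombeau.IsGeodesicSolution f D v₀ v₁ x₀ x₁ S := by
  obtain ⟨δ, hδ, rfl⟩ := hD
  obtain ⟨κ, hκ, v, p, y, h⟩ := Colombeau.exists_referenceNet hf hδ v₀ v₁ x₀ x₁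
  obtain ⟨w, hw, hsol⟩ := h.exists_solution hf hκ
  refine ⟨⟦w⟧, hsol, ?_⟩
  -- The competing solution may use another representative δ' of D, which need not be a strict delta
  -- net. The support and L¹ bounds are invoked only for δ.
  rintro _ ⟨δ', w', hδδ', rfl, hv, hx, hv0, hv1, hx0⟩
  refine Quotient.sound ?_
  intro ψ hψ
  have hsub : ∀ ε ∈ Ioo 0 κ, ε ∈ Ioc (0 : ℝ) 1 := fun ε hε => ⟨hε.1, hε.2.le.trans hκ.2.le⟩
  have hδs : ∀ ε ∈ Ioc (0 : ℝ) 1, ContDiff ℝ ∞ (δ.1 ε) := fun ε hε =>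
    Colombeau.contDiff_of_net δ.2.1.contDiffOn hε
  obtain ⟨C, hC⟩ := hδ.exists_bound fun ε hε => (hδs ε hε).continuous
  have hneg : Colombeau.IsNegligible fun ε t => δ'.1 ε t - δ.1 ε t := Quotient.exact hδδ'
  have hw's := fun ε (hε : ε ∈ Ioo 0 κ) => w'.2.1.contMDiffAt_snd (hsub ε hε)
  refine Colombeau.isNegligible_iff.2 fun K hK => ?_
  obtain ⟨R, hR⟩ := hK.isBounded.subset_closedBall 0
  rw [Real.closedBall_eq_Icc, zero_sub, zero_add] at hR
  have hKT : K ⊆ Icc (-max 1 R) (max 1 R) :=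
    hR.trans (Icc_subset_Icc (neg_le_neg (le_max_right _ _)) (le_max_right _ _))
  have hT : 1 ≤ max 1 R := le_max_left _ _
  have hX := fun G (hG : ContMDiff (𝓡 n) 𝓘(ℝ, ℝ) ∞ G) =>
    h.negligibleOn_sub hf hκ.1 (fun ε hε => (hδs ε (hsub ε hε)).continuous) hT
      (fun ε hε => hC ε (hsub ε hε) _ _ (by linarith)) hneg (fun ε hε => (hw's ε hε).2) hx hx0 hG
  obtain ⟨L, hL, hyL⟩ := h.compact (max 1 R)
  obtain ⟨B, hB⟩ := h.bound_v (max 1 R)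
  have hV := h.negligibleOn_sub_fst hf hκ.1
    (fun ε hε => Colombeau.contDiff_of_net δ'.2.1.contDiffOn (hsub ε hε)) δ'.2.2 hT hneg
    (fun ε hε => (hw's ε hε).2) (fun ε hε => (hw's ε hε).1) hv hv0 hv1 (hX f hf).1 (hX f hf).2
  refine (Colombeau.negligibleOn_comp_sub hκ.1 hL hyL (fun ε hε t ht => (hB ε hε t ht).1) hV
    (fun G hG => (hX G hG).1) hψ).of_le ?_
  filter_upwards [hw] with ε hε t ht
  refine ⟨hKT ht, ?_⟩
  rw [hε]
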